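/- **Setting.** Let $M$ be a complete connected smooth Riemannian manifold with distance $d$, and let $D(x,R)$ be the closed ball of centre $x$ and radius $R$. A set $Q\subset M$ is *$K$-separated* if $d(x,y)\ge K$ for all $x\neq y$ in $Q$, *separated* if this holds for some $K>0$, and *$C$-relatively dense* if $d(x,Q)\le C$ for all $x\in M$. Let $T^{(0)}M=M$, $T^{(m+1)}M=T(T^{(m)}M)$, let $g^{(0)}=g$, let $g^{(m+1)}$ be the Sasaki metric of $g^{(m)}$, and let $D^{(m)}(x,R)$ be the closed $g^{(m)}$-ball in $T^{(m)}M$ centred at $x\in M\subset T^{(m)}M$ (zero sections). For $m\in\mathbb N$, $R>0$, $\lambda\ge1$, an *$(m,R,\lambda)$-p.p.q.i.* $h:(M,x)\rightarrowtail(M,x')$ is a map $h$ with domain $D(x,R)$ and $h(x)=x'$ that extends to a $C^{m+1}$ diffeomorphism $\tilde h$ between open subsets of $M$ such that the $m$-fold iterated tangent map $\tilde h^{(m)}_*$ is defined on a neighbourhood of $D^{(m)}(x,R)$ and satisfies there $\lambda^{-1}|w|\le|(\tilde h^{(m)}_*)_*w|\le\lambda|w|$ for all tangent vectors $w$ of $T^{(m)}M$.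 For $p\in M$ let $\Omega(m,R,\lambda)$ be the set of all $x$ for which there is an $(m,R,\lambda)$-p.p.q.i. $(M,p)\rightarrowtail(M,x)$. $M$ is *repetitive* if, for every $p\in M$, all the sets $\Omega(m,R,\lambda)$ with $m\in\mathbb N$, $R>0$, $\lambda>1$ are relatively dense in $M$ (that is, $C$-relatively dense for some $C>0$). Fix $p\in M$ and assume that $M$ is repetitive. **Admissible sequences.** Let $0<r_i,s_i,t_i\uparrow\infty$ and $\lambda_i\downarrow1$ ($i\ge0$), let $\Lambda_{i,j}=\prod_{k=i}^{j}\lambda_k$ (equal to $1$ if $j<i$), $\Lambda_i=\prod_{k\ge i}\lambda_k$, $\Omega_i=\Omega(i,r_i,\lambda_i)$, and let $\omega_i$ be the infimum of the $\omega>0$ such that $\Omega_i$ is $\omega$-relatively dense; put $r_{-1}=s_{-1}=t_{-1}=\omega_{-1}=0$. The sequences are *admissible* if, for all $i\ge0$, $$r_i>\tfrac{\lambda_0^5}{\lambda_0-1}(r_{i-1}+s_{i-1}+t_{i-1}+2\omega_{i-1}+1),\qquad s_i>2\lambda_0^5(r_i+s_{i-1}+\omega_i),$$ $$t_i>\lambda_0^3(5t_{i-1}+r_i+s_{i-1}+2\omega_{i-1}+1),\qquad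 t_i>4\tfrac{\lambda_i^4+\lambda_i^2-1}{\lambda_i^2}r_i+t_{i-1}+\Lambda_i(s_{i-1}+2\omega_{i-1}+\omega_i),$$ and, for all $i\ge1$, $\lambda_i^2<\lambda_{i-1}$ and $$2^{2^{-i}}>\frac{r_i(\lambda_i^q-1)\lambda_{i-1}^2}{r_{i-1}(\lambda_{i-1}^q-1)\lambda_i^2}\qquad(q=5,6).$$ **Nested systems.** A *nested system* for admissible sequences consists of sets $\widehat M_i^j\subset M_i^j\subset M$ for $0\le i<j$ and, for each $x\in M_i^j$, an $(i,r_i,\Lambda_{i,j-1})$-p.p.q.i. $h^j_{i,x}:(M,p)\rightarrowtail(M,x)$, with the convention $M_i^i=\{p\}$, $h^i_{i,p}=\mathrm{id}_{D(p,r_i)}$, such that the following holds for all $0\le i<j$. Here $P_i^j=\{(l,z)\mid i<l<j,\ z\in M_l^j\}$, one writes $(l,z)<(l',z')$ if $l<l'$ and $z\in h^j_{l',z'}(M_l^{l'})$, and $\overline P_i^j$ is the set of maximal elements of $P_i^j$. 1. The balls $D(z,\lambda_l\Lambda_{l,j-1}(r_l+s_i))$, $(l,z)\in\overline P_i^j$,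 are pairwise disjoint, and $\widehat M_i^j$ is a maximal $s_i$-separated subset of $\Omega_i\cap D(p,r_j-t_i)\setminus\bigcup_{(l,z)\in\overline P_i^j}D(z,\lambda_l\Lambda_{l,j-1}(r_l+s_i))$. 2. $M_i^j$ is an $s_i/\Lambda_{i+1,j-1}$-separated subset of $\Omega(i,r_i,\Lambda_{i,j-1})\cap D(p,r_j-t_i)$. 3. If $(l,z)\in P_i^j$, $x\in M_i^j\cap h^j_{l,z}(D(p,r_l))$ and $x'=(h^j_{l,z})^{-1}(x)$, then $h^j_{i,x}=h^j_{l,z}h^l_{i,x'}$ (in particular, $h^l_{i,x'}$ maps $D(p,r_i)$ into $D(p,r_l)$). 4. If $(l,z)\in P_i^j$, then $M_i^j\cap h^j_{l,z}(D(p,r_l))=h^j_{l,z}(M_i^l)$. 5. If $x\in M_i^j$ and $(l,z)\in P_i^j$, then $d(x,z)\ge\lambda_l\Lambda_j(r_l+s_i)$ or $x\in h^j_{l,z}(M_i^l)$. 6. If $0\le k\le l$ and either $l<j$, $k\ge i$, or $l=j$, $k>i$, then $M_k^l\subset M_i^j$, and $h^j_{i,z}=h^l_{k,z}|_{D(p,r_i)}$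 for $z\in M_k^l$. 7. $p\in M_i^j$ and $h^j_{i,p}=\mathrm{id}_{D(p,r_i)}$. For a nested system, let $M_i=\bigcup_{j\ge i}M_i^j$, let $h_{i,x}=h^j_{i,x}$ if $x\in M_i^j$ (this does not depend on $j$, by 6), and let $P_0=\{(l,z)\mid l>0,\ z\in M_l\}$. **Theorem.** Let $M$ be a repetitive complete connected Riemannian manifold, and let $p\in M$. Then there are admissible sequences for which a nested system exists. Moreover, for all admissible sequences, every nested system for them and every $\eta>0$, there is a separated $\eta$-relatively dense subset $X\subset M$ such that $p\in X$ and, for all $(l,z)\in P_0$, $$X\cap h_{l,z}(D(p,r_l))=h_{l,z}(X\cap D(p,r_l)).$$ -/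

import Mathlib

open Set Filter Topology Metric Manifold
open scoped ContDiff ENNReal

noncomputable section

/-! ## Riemannian spaces, the Sasaki metric and iterated tangent bundles -/

/-- A positive definite bilinear form on a finite dimensional space satisfies `c ‖v‖² ≤ B v v`. -/
theorem exists_pos_mul_sq_le_of_posDef {E : Type*} [NormedAddCommGroup E] [NormedSpace ℝ E]
    [FiniteDimensional ℝ E] (B : E →L[ℝ] E →L[ℝ] ℝ) (hpos : ∀ v, v ≠ 0 → 0 < B v v) :
    ∃ c : ℝ, 0 < c ∧ ∀ v, c * ‖v‖ ^ 2 ≤ B v v := by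
  have hcont : Continuous fun v : E => B v v := B.continuous.clm_apply continuous_id
  by_cases hne : (sphere (0 : E) 1).Nonempty
  · obtain ⟨u, hu, hmin⟩ := (isCompact_sphere (0 : E) 1).exists_isMinOn hne hcont.continuousOn
    have hu1 : ‖u‖ = 1 := by simpa using hu
    refine ⟨B u u, hpos u (by intro h; simp [h] at hu1), fun v => ?_⟩
    rcases eq_or_ne v 0 with rfl | hv
    · simp
    have hv' : ‖v‖ ≠ 0 := norm_ne_zero_iff.2 hv
    have hmem : (‖v‖⁻¹ • v) ∈ sphere (0 : E) 1 := by
      simp [norm_smul, hv']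
    have hle : B u u ≤ B (‖v‖⁻¹ • v) (‖v‖⁻¹ • v) := hmin hmem
    have hexp : B (‖v‖⁻¹ • v) (‖v‖⁻¹ • v) * ‖v‖ ^ 2 = B v v := by
      simp only [map_smul, smul_eq_mul, _root_.smul_apply]
      field_simp
    rw [← hexp]
    exact mul_le_mul_of_nonneg_right hle (by positivity)
  · refine ⟨1, one_pos, fun v => ?_⟩
    have hv : v = 0 := by
      by_contra hv
      exact hne ⟨‖v‖⁻¹ • v, by simp [norm_smul, norm_ne_zero_iff.2 hv]⟩
    simp [hv]

/-- The unit ball of a positive definite form on a finite dimensional space is bounded. -/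
theorem isVonNBounded_of_posDef {E : Type*} [NormedAddCommGroup E] [NormedSpace ℝ E]
    [FiniteDimensional ℝ E] (B : E →L[ℝ] E →L[ℝ] ℝ) (hpos : ∀ v, v ≠ 0 → 0 < B v v) :
    Bornology.IsVonNBounded ℝ {v : E | B v v < 1} := by
  obtain ⟨c, hc, hB⟩ := exists_pos_mul_sq_le_of_posDef B hpos
  refine (NormedSpace.isVonNBounded_closedBall ℝ E (1 / c + 1)).subset fun v hv => ?_
  have h1 : c * ‖v‖ ^ 2 < 1 := lt_of_le_of_lt (hB v) hv
  have h2 : ‖v‖ ^ 2 < 1 / c := by rwa [lt_div_iff₀ hc, mul_comm]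
  rw [mem_closedBall_zero_iff]
  nlinarith [sq_nonneg (‖v‖ - 1), norm_nonneg v]

/-- A positive definite symmetric bilinear form as an element of `LinearMap.BilinForm`. -/
def toBilin {E : Type*} [NormedAddCommGroup E] [NormedSpace ℝ E]
    (B : E →L[ℝ] E →L[ℝ] ℝ) : LinearMap.BilinForm ℝ E :=
  LinearMap.mk₂ ℝ (fun a b => B a b) (by simp) (by simp) (by simp) (by simp)

theorem toBilin_nondegenerate {E : Type*} [NormedAddCommGroup E] [NormedSpace ℝ E]
    (B : E →L[ℝ] E →L[ℝ] ℝ) (hpos : ∀ v, v ≠ 0 → 0 < B v v) :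
    (toBilin B).Nondegenerate := by
  constructor
  · intro v hv
    by_contra h
    exact (hpos v h).ne' (hv v)
  · intro v hv
    by_contra h
    exact (hpos v h).ne' (hv v)

/-- Christoffel symbols of the first kind, at the point `y`, of a metric `G = (g_ij)` on (an open
subset of) a vector space, where `D` stands for the derivative of `G` at `y`:
`koszul G y v a w = (D_a G (v, w) + D_v G (a, w) - D_w G (a, v)) / 2`. -/
def koszul {E : Type*} [NormedAddCommGroup E] [NormedSpace ℝ E]
    (G : E → E →L[ℝ] E →L[ℝ] ℝ) (y v : E) : E →ₗ[ℝ] Module.Dual ℝ E :=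
  LinearMap.mk₂ ℝ
    (fun a w => (fderiv ℝ G y a v w + fderiv ℝ G y v a w - fderiv ℝ G y w a v) / 2)
    (by intros; simp; ring) (by intros; simp; ring) (by intros; simp; ring)
    (by intros; simp; ring)

/-- Christoffel symbols of the second kind: `christoffelOf B _ G y v a = Γ (a, v)` is the vector
with `B (Γ (a, v), w) = koszul G y v a w` for all `w`, where `B` is the metric at `y`. -/
def christoffelOf {E : Type*} [NormedAddCommGroup E] [NormedSpace ℝ E] [FiniteDimensional ℝ E]
    (B : E →L[ℝ] E →L[ℝ] ℝ) (hpos : ∀ v, v ≠ 0 → 0 < B v v)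
    (G : E → E →L[ℝ] E →L[ℝ] ℝ) (y v : E) : E →L[ℝ] E :=
  LinearMap.toContinuousLinearMap
    (((toBilin B).toDual (toBilin_nondegenerate B hpos)).symm.toLinearMap ∘ₗ koszul G y v)

/-- The defining property of the Christoffel symbols. -/
theorem christoffelOf_spec {E : Type*} [NormedAddCommGroup E] [NormedSpace ℝ E]
    [FiniteDimensional ℝ E] (B : E →L[ℝ] E →L[ℝ] ℝ) (hpos : ∀ v, v ≠ 0 → 0 < B v v)
    (G : E → E →L[ℝ] E →L[ℝ] ℝ) (y v a w : E) :
    B (christoffelOf B hpos G y v a) w =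
      (fderiv ℝ G y a v w + fderiv ℝ G y v a w - fderiv ℝ G y w a v) / 2 :=
  LinearMap.BilinForm.apply_toDual_symm_apply
    (hB := toBilin_nondegenerate B hpos) (koszul G y v a) w

end

open Bundle

noncomputable section

/-- A finite dimensional smooth manifold without boundary, together with a Riemannian metric
`g`.  (The metrics to which this is applied below are all smooth.) -/
structure RiemSpace where
  E : Type
  [normedE : NormedAddCommGroup E]
  [spaceE : NormedSpace ℝ E]
  [finE : FiniteDimensional ℝ E]
  H : Type
  [topH : TopologicalSpace H]
  I : ModelWithCorners ℝ E H
  [boundaryless : I.Boundaryless]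
  M : Type*
  [topM : TopologicalSpace M]
  [charted : ChartedSpace H M]
  [smooth : IsManifold I ∞ M]
  g : RiemannianMetric (fun x : M => TangentSpace I x)

attribute [instance] RiemSpace.normedE RiemSpace.spaceE RiemSpace.finE RiemSpace.topH
  RiemSpace.boundaryless RiemSpace.topM RiemSpace.charted RiemSpace.smooth

namespace RiemSpace

universe u

variable (A : RiemSpace.{u})

/-- The metric at `x`, a bilinear form on the model space `E`, which by definition is the
tangent space at `x`, read in the preferred chart at `x`. -/
def form (x : A.M) : A.E →L[ℝ] A.E →L[ℝ] ℝ := A.g.inner x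

theorem form_pos (x : A.M) : ∀ v : A.E, v ≠ 0 → 0 < A.form x v v := fun v hv => A.g.pos x v hv

theorem form_symm (x : A.M) : ∀ v w : A.E, A.form x v w = A.form x w v :=
  fun v w => A.g.symm x v w

/-- The norm of a tangent vector. -/
def tnorm (x : A.M) (v : TangentSpace A.I x) : ℝ := √(A.g.inner x v v)

/-- The Riemannian distance (infimum of the lengths of `C^1` paths), with values in `[0, ∞]`. -/
def rdist (x y : A.M) : ℝ≥0∞ :=
  letI : RiemannianBundle (fun x : A.M => TangentSpace A.I x) := ⟨A.g⟩
  Manifold.riemannianEDist A.I x y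

/-- The matrix `(g_ij)` of the metric in the coordinates given by the preferred chart at `x`,
as a function on the model space, with values in bilinear forms. -/
def coordForm (x : A.M) (y : A.E) : A.E →L[ℝ] A.E →L[ℝ] ℝ :=
  let z : A.M := (extChartAt A.I x).symm y
  (A.form z).bilinearComp (tangentCoordChange A.I x z z) (tangentCoordChange A.I x z z)

/-- The Christoffel symbols of the Levi-Civita connection at `x` in the preferred chart at `x`:
`christoffel x v a = Γ (a, v)`. -/
def christoffel (x : A.M) (v : A.E) : A.E →L[ℝ] A.E :=
  christoffelOf (A.form x) (A.form_pos x) (A.coordForm x) (extChartAt A.I x x) v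

/-- The connector `K : T_ξ(TM) → T_xM` of the Levi-Civita connection at `ξ = (x, v)`, in the
induced coordinates: `K (a, b) = b + Γ (a, v)`.  Its kernel is the horizontal space. -/
def connector (ξ : TangentBundle A.I A.M) : (A.E × A.E) →L[ℝ] A.E :=
  ContinuousLinearMap.snd ℝ A.E A.E +
    (A.christoffel ξ.proj ξ.2).comp (ContinuousLinearMap.fst ℝ A.E A.E)

/-- The Sasaki metric at `ξ ∈ TM`:  `⟨w, w'⟩ = g (π_* w, π_* w') + g (K w, K w')`. -/
def sasakiForm (ξ : TangentBundle A.I A.M) : (A.E × A.E) →L[ℝ] (A.E × A.E) →L[ℝ] ℝ :=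
  (A.form ξ.proj).bilinearComp (ContinuousLinearMap.fst ℝ A.E A.E)
      (ContinuousLinearMap.fst ℝ A.E A.E) +
    (A.form ξ.proj).bilinearComp (A.connector ξ) (A.connector ξ)

theorem sasakiForm_apply (ξ : TangentBundle A.I A.M) (w w' : A.E × A.E) :
    A.sasakiForm ξ w w' = A.form ξ.proj w.1 w'.1 +
      A.form ξ.proj (w.2 + A.christoffel ξ.proj ξ.2 w.1)
        (w'.2 + A.christoffel ξ.proj ξ.2 w'.1) := rfl

theorem sasakiForm_pos (ξ : TangentBundle A.I A.M) :
    ∀ w : A.E × A.E, w ≠ 0 → 0 < A.sasakiForm ξ w w := by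
  have nonneg : ∀ v : A.E, 0 ≤ A.form ξ.proj v v := fun v => by
    rcases eq_or_ne v 0 with rfl | hv
    · simp
    · exact (A.form_pos _ v hv).le
  intro w hw
  rw [sasakiForm_apply]
  by_cases h1 : w.1 = 0
  · have h2 : w.2 ≠ 0 := fun h => hw (Prod.ext h1 h)
    have h3 := A.form_pos ξ.proj w.2 h2
    simpa [h1] using h3
  · exact add_pos_of_pos_of_nonneg (A.form_pos _ _ h1) (nonneg _)

theorem sasakiForm_symm (ξ : TangentBundle A.I A.M) (w w' : A.E × A.E) :
    A.sasakiForm ξ w w' = A.sasakiForm ξ w' w := by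
  rw [sasakiForm_apply, sasakiForm_apply, A.form_symm, A.form_symm ξ.proj (_ + _)]

/-- The Sasaki metric on `TM`. -/
def sasaki : RiemannianMetric (fun ξ : TangentBundle A.I A.M => TangentSpace A.I.tangent ξ) where
  inner ξ := A.sasakiForm ξ
  symm ξ w w' := by
    exact A.sasakiForm_symm ξ w w'
  pos ξ w hw := A.sasakiForm_pos ξ w hw
  continuousAt ξ :=
    ((A.sasakiForm ξ).continuous.clm_apply continuous_id).continuousAt
  isVonNBounded ξ := isVonNBounded_of_posDef (A.sasakiForm ξ) (A.sasakiForm_pos ξ)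

/-- The tangent bundle with its Sasaki metric. -/
def tangent : RiemSpace.{u} where
  E := A.E × A.E
  H := ModelProd A.H A.E
  I := A.I.tangent
  M := TangentBundle A.I A.M
  g := A.sasaki

/-- The iterated tangent bundle `T^(m) M` with the metric `g^(m)`. -/
def iter : ℕ → RiemSpace.{u}
  | 0 => A
  | m + 1 => (iter m).tangent

/-- The inclusion `M → T^(m) M` by zero sections. -/
def zeroSec : ∀ m : ℕ, A.M → (A.iter m).M
  | 0, x => x
  | m + 1, x => (⟨zeroSec m x, 0⟩ : TangentBundle (A.iter m).I (A.iter m).M)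

/-- The projection `T^(m) M → M`. -/
def base : ∀ m : ℕ, (A.iter m).M → A.M
  | 0, x => x
  | m + 1, ξ => base m (show TangentBundle (A.iter m).I (A.iter m).M from ξ).proj

/-- The iterated tangent map `h_*^(m) : T^(m) M → T^(m) M`. -/
def iterMap (h : A.M → A.M) : ∀ m : ℕ, (A.iter m).M → (A.iter m).M
  | 0 => h
  | m + 1 => tangentMap (A.iter m).I (A.iter m).I (iterMap h m)

end RiemSpace

/-- `Q` is `K`-separated. -/
def IsSep {X : Type*} [MetricSpace X] (K : ℝ) (Q : Set X) : Prop :=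
  ∀ x ∈ Q, ∀ y ∈ Q, x ≠ y → K ≤ dist x y

/-- `Q` is `C`-relatively dense: every point is at distance at most `C` from `Q`. -/
def IsRelDense {X : Type*} [MetricSpace X] (C : ℝ) (Q : Set X) : Prop :=
  cthickening C Q = univ

section Manifold

variable (n : ℕ) {M : Type*} [MetricSpace M] [ChartedSpace (EuclideanSpace ℝ (Fin n)) M]
  [IsManifold (𝓡 n) ∞ M] [RiemannianBundle (fun x : M => TangentSpace (𝓡 n) x)]

/-- The Riemannian manifold `M` as a `RiemSpace`. -/
def RiemSpace.of (M : Type*) [MetricSpace M] [ChartedSpace (EuclideanSpace ℝ (Fin n)) M]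
    [IsManifold (𝓡 n) ∞ M] [RiemannianBundle (fun x : M => TangentSpace (𝓡 n) x)] :
    RiemSpace where
  E := EuclideanSpace ℝ (Fin n)
  H := EuclideanSpace ℝ (Fin n)
  I := 𝓡 n
  M := M
  g := RiemannianBundle.g

/-- The closed ball `D^(m)(x, R)` of `T^(m) M` centred at `x ∈ M ⊆ T^(m) M`. -/
def iterBall (m : ℕ) (x : M) (R : ℝ) : Set ((RiemSpace.of n M).iter m).M :=
  {ξ | ((RiemSpace.of n M).iter m).rdist ((RiemSpace.of n M).zeroSec m x) ξ ≤ ENNReal.ofReal R}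

/-- `h`, restricted to `D(x, R)`, is an `(m, R, lam)`-pointed partial quasi-isometry
`(M, x) ⤚ (M, x')`.  Values of `h` outside of `D(x, R)` are irrelevant. -/
def IsPPQI (m : ℕ) (R lam : ℝ) (x x' : M) (h : M → M) : Prop :=
  h x = x' ∧
  ∃ e : OpenPartialHomeomorph M M,
    ContMDiffOn (𝓡 n) (𝓡 n) ((m + 1 : ℕ) : ℕ∞) e e.source ∧
    ContMDiffOn (𝓡 n) (𝓡 n) ((m + 1 : ℕ) : ℕ∞) e.symm e.target ∧
    closedBall x R ⊆ e.source ∧ EqOn h e (closedBall x R) ∧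
    ∃ W : Set ((RiemSpace.of n M).iter m).M, IsOpen W ∧ iterBall n m x R ⊆ W ∧
      (∀ ξ ∈ W, (RiemSpace.of n M).base m ξ ∈ e.source) ∧
      ∀ ξ ∈ W, ∀ w : TangentSpace ((RiemSpace.of n M).iter m).I ξ,
        lam⁻¹ * ((RiemSpace.of n M).iter m).tnorm ξ w ≤
          ((RiemSpace.of n M).iter m).tnorm _
            (mfderiv ((RiemSpace.of n M).iter m).I ((RiemSpace.of n M).iter m).I
              ((RiemSpace.of n M).iterMap e m) ξ w) ∧
        ((RiemSpace.of n M).iter m).tnorm _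
            (mfderiv ((RiemSpace.of n M).iter m).I ((RiemSpace.of n M).iter m).I
              ((RiemSpace.of n M).iterMap e m) ξ w) ≤
          lam * ((RiemSpace.of n M).iter m).tnorm ξ w

/-- `Ω(m, R, lam)`: the points `x` for which there is an `(m, R, lam)`-p.p.q.i. from `p` to `x`. -/
def Omega (p : M) (m : ℕ) (R lam : ℝ) : Set M :=
  {x | ∃ h : M → M, IsPPQI n m R lam p x h}

variable (M) in
/-- `M` is repetitive. -/
def IsRepetitive : Prop :=
  ∀ (p : M) (m : ℕ) (R lam : ℝ), 0 < R → 1 < lam →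
    ∃ C : ℝ, 0 < C ∧ IsRelDense C (Omega n p m R lam)

/-! ## Admissible sequences -/

/-- The sequence shifted by one, with value `0` at the index "`-1`". -/
def prev (f : ℕ → ℝ) : ℕ → ℝ
  | 0 => 0
  | i + 1 => f i

/-- `LamFin lam i j = ∏ lam k` over `i ≤ k ≤ j - 1`. -/
def LamFin (lam : ℕ → ℝ) (i j : ℕ) : ℝ := ∏ k ∈ Finset.Ico i j, lam k

/-- `LamInf lam i = ∏ lam k` over `k ≥ i`. -/
def LamInf (lam : ℕ → ℝ) (i : ℕ) : ℝ := ∏' k : ℕ, lam (i + k)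

/-- The smallest `ω_i` for which `Ω(i, r_i, lam_i)` is `ω_i`-relatively dense. -/
def omegaSeq (p : M) (r lam : ℕ → ℝ) (i : ℕ) : ℝ :=
  sInf {C : ℝ | 0 < C ∧ IsRelDense C (Omega n p i (r i) (lam i))}

/-- The sequences `r_i, s_i, t_i ↑ ∞` and `lam_i ↓ 1` grow (converge) as fast as required. -/
structure IsAdmissible (p : M) (r s t lam : ℕ → ℝ) : Prop where
  r_pos : ∀ i, 0 < r i
  s_pos : ∀ i, 0 < s i
  t_pos : ∀ i, 0 < t i
  r_mono : Monotone r
  s_mono : Monotone s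
  t_mono : Monotone t
  r_lim : Tendsto r atTop atTop
  s_lim : Tendsto s atTop atTop
  t_lim : Tendsto t atTop atTop
  lam_anti : Antitone lam
  lam_lim : Tendsto lam atTop (𝓝 1)
  r_gt : ∀ i, lam 0 ^ 5 / (lam 0 - 1) *
    (prev r i + prev s i + prev t i + 2 * prev (omegaSeq n p r lam) i + 1) < r i
  s_gt : ∀ i, 2 * lam 0 ^ 5 * (r i + prev s i + omegaSeq n p r lam i) < s i
  t_gt : ∀ i, lam 0 ^ 3 *
    (5 * prev t i + r i + prev s i + 2 * prev (omegaSeq n p r lam) i + 1) < t i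
  t_gt' : ∀ i, 4 * ((lam i ^ 4 + lam i ^ 2 - 1) / lam i ^ 2) * r i + prev t i +
    LamInf lam i * (prev s i + 2 * prev (omegaSeq n p r lam) i + omegaSeq n p r lam i) < t i
  lam_sq : ∀ i, lam (i + 1) ^ 2 < lam i
  lam_five : ∀ i, r (i + 1) * (lam (i + 1) ^ 5 - 1) * lam i ^ 2 /
    (r i * (lam i ^ 5 - 1) * lam (i + 1) ^ 2) < (2 : ℝ) ^ ((2 : ℝ) ^ (-((i : ℝ) + 1)))
  lam_six : ∀ i, r (i + 1) * (lam (i + 1) ^ 6 - 1) * lam i ^ 2 /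
    (r i * (lam i ^ 6 - 1) * lam (i + 1) ^ 2) < (2 : ℝ) ^ ((2 : ℝ) ^ (-((i : ℝ) + 1)))

/-! ## The nested system of pointed partial quasi-isometries

`net i j` stands for `M_i^j` and `map i j x` for `h^j_{i,x}` (with domain `D(p, r_i)`). -/

/-- `P_i^j`: the pairs `(l, z)` with `i < l < j` and `z ∈ M_l^j`. -/
def pairs {M : Type*} (net : ℕ → ℕ → Set M) (i j : ℕ) : Set (ℕ × M) :=
  {a | i < a.1 ∧ a.1 < j ∧ a.2 ∈ net a.1 j}

/-- `(l, z) < (l', z')` in `P_i^j`: `l < l'` and `z ∈ h^j_{l',z'}(M_l^{l'})`. -/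
def pairLT {M : Type*} (net : ℕ → ℕ → Set M) (map : ℕ → ℕ → M → M → M) (j : ℕ)
    (a b : ℕ × M) : Prop :=
  a.1 < b.1 ∧ a.2 ∈ map b.1 j b.2 '' net a.1 b.1

/-- The set of maximal elements of `P_i^j`. -/
def maxPairs {M : Type*} (net : ℕ → ℕ → Set M) (map : ℕ → ℕ → M → M → M) (i j : ℕ) :
    Set (ℕ × M) :=
  {a | a ∈ pairs net i j ∧ ∀ b ∈ pairs net i j, ¬ pairLT net map j a b}

/-- The balls `D(z, lam_l Λ_{l,j-1} (r_l + s_i))` for `a = (l, z)`. -/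
def fatBall {M : Type*} [MetricSpace M] (r s lam : ℕ → ℝ) (i j : ℕ) (a : ℕ × M) : Set M :=
  closedBall a.2 (lam a.1 * LamFin lam a.1 j * (r a.1 + s i))

/-- A nested system of pointed partial quasi-isometries for the sequences `r, s, t, lam`. -/
structure NestedSystem (p : M) (r s t lam : ℕ → ℝ) where
  net : ℕ → ℕ → Set M
  /-- The part `\hat M_i^j` of `M_i^j`. -/
  hatNet : ℕ → ℕ → Set M
  map : ℕ → ℕ → M → M → M
  net_self : ∀ i, net i i = {p}
  map_self : ∀ i, EqOn (map i i p) id (closedBall p (r i))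
  hatNet_subset : ∀ i j, i < j → hatNet i j ⊆ net i j
  isPPQI : ∀ i j, i < j → ∀ x ∈ net i j, IsPPQI n i (r i) (LamFin lam i j) p x (map i j x)
  fatBall_disjoint : ∀ i j, i < j → (maxPairs net map i j).PairwiseDisjoint (fatBall r s lam i j)
  hatNet_maximal : ∀ i j, i < j →
    Maximal (fun Q : Set M => Q ⊆ (Omega n p i (r i) (lam i) ∩ closedBall p (r j - t i)) \
      (⋃ a ∈ maxPairs net map i j, fatBall r s lam i j a) ∧ IsSep (s i) Q) (hatNet i j)
  net_sep : ∀ i j, i < j → IsSep (s i / LamFin lam (i + 1) j) (net i j)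
  net_subset : ∀ i j, i < j →
    net i j ⊆ Omega n p i (r i) (LamFin lam i j) ∩ closedBall p (r j - t i)
  map_comp : ∀ i j, i < j → ∀ a ∈ pairs net i j, ∀ x ∈ net i j,
    ∀ x' ∈ closedBall p (r a.1), map a.1 j a.2 x' = x →
      MapsTo (map i a.1 x') (closedBall p (r i)) (closedBall p (r a.1)) ∧
      EqOn (map i j x) (map a.1 j a.2 ∘ map i a.1 x') (closedBall p (r i))
  net_inter : ∀ i j, i < j → ∀ a ∈ pairs net i j,
    net i j ∩ map a.1 j a.2 '' closedBall p (r a.1) = map a.1 j a.2 '' net i a.1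
  net_far_or : ∀ i j, i < j → ∀ x ∈ net i j, ∀ a ∈ pairs net i j,
    lam a.1 * LamInf lam j * (r a.1 + s i) ≤ dist x a.2 ∨ x ∈ map a.1 j a.2 '' net i a.1
  net_mono : ∀ i j, i < j → ∀ k l, k ≤ l → (l < j ∧ i ≤ k ∨ l = j ∧ i < k) →
    net k l ⊆ net i j ∧ ∀ z ∈ net k l, EqOn (map i j z) (map k l z) (closedBall p (r i))
  base_mem : ∀ i j, i < j → p ∈ net i j
  map_base : ∀ i j, i < j → EqOn (map i j p) id (closedBall p (r i))

namespace NestedSystem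

variable {n} {p : M} {r s t lam : ℕ → ℝ} (S : NestedSystem n p r s t lam)

/-- `M_i = ⋃ M_i^j` over `j ≥ i`. -/
def limNet (i : ℕ) : Set M := ⋃ j ≥ i, S.net i j

/-- `P_i`: the pairs `(l, z)` with `l > i` and `z ∈ M_l`. -/
def limPairs (i : ℕ) : Set (ℕ × M) := {a | i < a.1 ∧ a.2 ∈ S.limNet a.1}

open Classical in
/-- `h_{i,x} = h^j_{i,x}` for `x ∈ M_i`, where `j ≥ i` is such that `x ∈ M_i^j`; on `D(p, r_i)`
this does not depend on `j`, and we take the least one. -/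
def limMap (i : ℕ) (x : M) : M → M :=
  if hx : ∃ j, i ≤ j ∧ x ∈ S.net i j then S.map i (Nat.find hx) x else id

end NestedSystem

end Manifold

end

/-! Construction of X. Fix a small ρ. For each level l, choose a maximal ρ-separated set `Y l` of
points of D(p, r_l) that stay ρ away from the boundary (`dist p y ≤ r l - ρ`) and from all smaller
balls h_{k,w}(D(p, r_k)), 0 < k < l, w ∈ M_k^l. X is the union of the sets h_{l,z}(`Y l`) with l > 0
and z ∈ M_l (`translates`). The levels can be treated independently because of a dichotomy
(`one_le_dist_of_ne`, `one_le_dist_or_exists`): two distinct balls h_{l,z}(D(p, r_l)) of positive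
level are at distance at least 1, or one comes from a ball inside the model of the other, and then
the maps compose accordingly. So h_{l,z}(D(p, r_l)) meets only those pieces of X which h_{l,z}
carries over from D(p, r_l); this is the invariance (`translates_inter_eq`). Separation holds
because the maps distort by at most λ_0² and each `Y l` avoids the smaller balls. For density,
represent a point at the least possible level. Away from the smaller balls, a small push towards the
centre reaches the region where `Y l` is maximal. Close to a smaller ball, minimality places the
point near the boundary of that ball, where no still smaller ball interferes.

Metric input. A p.p.q.i. controls only the lengths of paths inside its ball, so distances are
compared through nearly minimal paths that provably stay there (`IsPPQI.dist_le_mul`,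
`IsPPQI.exists_lift`, `IsPPQI.min_le_mul_dist`). Composition (`IsPPQI.comp`) is needed for closed
balls of T^(m)M; it uses that small balls of the iterated Sasaki metrics are small neighbourhoods,
hence that these metrics are continuous. This is obtained by computing the Sasaki metric in charts
(`coordForm_tangent`).

Existence of nested systems. M_i^j depends only on data with smaller difference j - i: it is a
maximal separated set outside the fat balls together with the translates of the sets M_i^l. All
properties are proved by induction on j - i; the core is that the fat balls are disjoint and that
each meets M_i^j only in the translate it carries. The induction uses two conditions beyond
admissibility, r_l (λ_l³ - 1) ≤ 1 for l > 0 and s_i ≤ t_i, which can be arranged because λ_l is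
chosen after r_l and t_i after s_i. -/

noncomputable section

set_option maxSynthPendingDepth 3

/-! ### Christoffel symbols and the Sasaki metric in coordinates. -/

section CoordinateCalculus

variable {E : Type*} [NormedAddCommGroup E] [NormedSpace ℝ E] [FiniteDimensional ℝ E]

omit [FiniteDimensional ℝ E] in
/-- Transformation law of the Christoffel symbols of the first kind under a change of
coordinates `φ`. -/
theorem koszul_pullback {G₁ G₂ : E → E →L[ℝ] E →L[ℝ] ℝ} {φ : E → E} {y : E}
    (hG : G₁ =ᶠ[𝓝 y] fun y' => (G₂ (φ y')).bilinearComp (fderiv ℝ φ y') (fderiv ℝ φ y'))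
    (hG₂ : DifferentiableAt ℝ G₂ (φ y)) (hsymm : ∀ v w, G₂ (φ y) v w = G₂ (φ y) w v)
    (hφ : ContDiffAt ℝ 2 φ y) (u a w : E) :
    koszul G₁ y u a w =
      koszul G₂ (φ y) (fderiv ℝ φ y u) (fderiv ℝ φ y a) (fderiv ℝ φ y w) +
        G₂ (φ y) (fderiv ℝ (fderiv ℝ φ) y a u) (fderiv ℝ φ y w) := by
  have hφ1 : DifferentiableAt ℝ φ y := hφ.differentiableAt (by norm_num)
  have hφ2 : DifferentiableAt ℝ (fderiv ℝ φ) y :=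
    (hφ.fderiv_right (m := 1) (by norm_num)).differentiableAt (by norm_num)
  have hsec : ∀ v w, fderiv ℝ (fderiv ℝ φ) y v w = fderiv ℝ (fderiv ℝ φ) y w v := by
    intro v w
    exact (hφ.isSymmSndFDerivAt (by simp)).eq v w
  have key : ∀ a v w : E, fderiv ℝ G₁ y a v w =
      fderiv ℝ G₂ (φ y) (fderiv ℝ φ y a) (fderiv ℝ φ y v) (fderiv ℝ φ y w) +
      G₂ (φ y) (fderiv ℝ (fderiv ℝ φ) y a v) (fderiv ℝ φ y w) +
      G₂ (φ y) (fderiv ℝ φ y v) (fderiv ℝ (fderiv ℝ φ) y a w) := by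
    intro a v w
    have hG₁d : DifferentiableAt ℝ G₁ y := by
      refine DifferentiableAt.congr_of_eventuallyEq ?_ hG
      have : (fun y' => (G₂ (φ y')).bilinearComp (fderiv ℝ φ y') (fderiv ℝ φ y')) =
          fun y' => ((ContinuousLinearMap.compL ℝ E (E →L[ℝ] ℝ) (E →L[ℝ] ℝ)
            ((ContinuousLinearMap.compL ℝ E E ℝ).flip (fderiv ℝ φ y')))
              ((G₂ (φ y')).comp (fderiv ℝ φ y'))) := by
        ext; rfl
      rw [this]
      have h1 : DifferentiableAt ℝ (fun y' => G₂ (φ y')) y := hG₂.comp y hφ1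
      fun_prop
    have e1 : fderiv ℝ G₁ y a v w = fderiv ℝ (fun y' => G₁ y' v w) y a := by
      have h := ((hG₁d.hasFDerivAt.clm_apply (hasFDerivAt_const v y)).clm_apply
        (hasFDerivAt_const w y)).fderiv
      rw [h]; simp
    have e2 : (fun y' => G₁ y' v w) =ᶠ[𝓝 y]
        fun y' => G₂ (φ y') (fderiv ℝ φ y' v) (fderiv ℝ φ y' w) := by
      filter_upwards [hG] with y' hy'
      rw [hy']; rfl
    rw [e1, e2.fderiv_eq]
    have h1 : HasFDerivAt (fun y' => G₂ (φ y')) ((fderiv ℝ G₂ (φ y)).comp (fderiv ℝ φ y)) y :=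
      hG₂.hasFDerivAt.comp y hφ1.hasFDerivAt
    have hv := hφ2.hasFDerivAt.clm_apply (hasFDerivAt_const v y)
    have hw := hφ2.hasFDerivAt.clm_apply (hasFDerivAt_const w y)
    rw [((h1.clm_apply hv).clm_apply hw).fderiv]
    simp
    ring
  simp only [koszul, LinearMap.mk₂_apply]
  -- Six terms contain second derivatives of φ. By symmetry of G₂ and of the second derivative, four
  -- cancel and the other two agree, which absorbs the factor 1/2.
  rw [key, key, key, hsec u a, hsec w a, hsec w u,
    hsymm (fderiv ℝ φ y u), hsymm (fderiv ℝ φ y a) (fderiv ℝ (fderiv ℝ φ) y u w)]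
  ring

/-- The Christoffel symbols of the second kind of a symmetric nondegenerate form `G`, by a
formula which depends smoothly on the point. -/
def coordGamma (G : E → E →L[ℝ] E →L[ℝ] ℝ) (y u : E) : E →L[ℝ] E :=
  (ContinuousLinearMap.inverse (G y)).comp
    ((1 / 2 : ℝ) • ((fderiv ℝ G y).flip u + fderiv ℝ G y u - ((fderiv ℝ G y).flip u).flip))

omit [FiniteDimensional ℝ E] in
theorem injective_of_posDef {B : E →L[ℝ] E →L[ℝ] ℝ} (hpos : ∀ v, v ≠ 0 → 0 < B v v) :
    Function.Injective B := by
  rw [injective_iff_map_eq_zero]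
  intro v hv
  by_contra h
  have := hpos v h
  simp [hv] at this

/-- A positive definite form as an isomorphism onto the dual space. -/
theorem exists_equiv_of_posDef {B : E →L[ℝ] E →L[ℝ] ℝ} (hpos : ∀ v, v ≠ 0 → 0 < B v v) :
    ∃ e : E ≃L[ℝ] (E →L[ℝ] ℝ), (e : E →L[ℝ] E →L[ℝ] ℝ) = B := by
  have hdim : Module.finrank ℝ E = Module.finrank ℝ (E →L[ℝ] ℝ) := by
    rw [← (LinearMap.toContinuousLinearMap : (E →ₗ[ℝ] ℝ) ≃ₗ[ℝ] E →L[ℝ] ℝ).finrank_eq]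
    exact (Subspace.dual_finrank_eq (K := ℝ) (V := E)).symm
  refine ⟨(LinearEquiv.ofInjectiveOfFinrankEq (B : E →ₗ[ℝ] E →L[ℝ] ℝ)
    (injective_of_posDef hpos) hdim).toContinuousLinearEquiv, ?_⟩
  ext v w
  rfl

/-- Symmetry of `G` is required near `y`, not only at `y`, because the symmetry of its derivative
enters. -/
theorem coordGamma_spec {G : E → E →L[ℝ] E →L[ℝ] ℝ} {y : E}
    (hpos : ∀ v, v ≠ 0 → 0 < G y v v) (hd : DifferentiableAt ℝ G y)
    (hsymm : ∀ᶠ y' in 𝓝 y, ∀ v w, G y' v w = G y' w v) (u a w : E) :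
    G y (coordGamma G y u a) w = koszul G y u a w := by
  obtain ⟨e, he⟩ := exists_equiv_of_posDef hpos
  have hs : ∀ a v w, fderiv ℝ G y a v w = fderiv ℝ G y a w v := by
    intro a v w
    have h1 : ∀ v w, fderiv ℝ G y a v w = fderiv ℝ (fun y' => G y' v w) y a := by
      intro v w
      have h := ((hd.hasFDerivAt.clm_apply (hasFDerivAt_const v y)).clm_apply
        (hasFDerivAt_const w y)).fderiv
      rw [h]; simp
    rw [h1, h1]
    congr 1
    apply Filter.EventuallyEq.fderiv_eq
    filter_upwards [hsymm] with y' hy' using hy' v w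
  have h2 : ∀ f, G y (ContinuousLinearMap.inverse (G y) f) = f := by
    intro f
    rw [← he, ContinuousLinearMap.inverse_equiv]
    simp
  simp only [coordGamma, koszul, LinearMap.mk₂_apply, ContinuousLinearMap.comp_apply, h2]
  simp
  rw [hs w u a]
  ring

/-- Inversion of continuous linear maps is smooth at invertible ones, and positive definite forms
are invertible; everything else is polynomial in the derivative of `G`. -/
theorem contDiffOn_coordGamma {G : E → E →L[ℝ] E →L[ℝ] ℝ} {U : Set E} (hU : IsOpen U)
    (hG : ContDiffOn ℝ ∞ G U) (hpos : ∀ y ∈ U, ∀ v, v ≠ 0 → 0 < G y v v) :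
    ContDiffOn ℝ ∞ (fun q : E × E => coordGamma G q.1 q.2) (U ×ˢ univ) := by
  have hfst : MapsTo (Prod.fst : E × E → E) (U ×ˢ univ) U := fun q hq => hq.1
  have hinv : ContDiffOn ℝ ∞ (fun y => ContinuousLinearMap.inverse (G y)) U := by
    intro y hy
    obtain ⟨e, he⟩ := exists_equiv_of_posDef (hpos y hy)
    have := contDiffAt_map_inverse (n := ∞) e
    rw [he] at this
    exact this.comp_contDiffWithinAt y (hG y hy)
  have hD : ContDiffOn ℝ ∞ (fderiv ℝ G) U := hG.fderiv_of_isOpen hU (by simp)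
  have hDq : ContDiffOn ℝ ∞ (fun q : E × E => fderiv ℝ G q.1) (U ×ˢ univ) :=
    hD.comp contDiff_fst.contDiffOn hfst
  have hIq : ContDiffOn ℝ ∞ (fun q : E × E => ContinuousLinearMap.inverse (G q.1)) (U ×ˢ univ) :=
    hinv.comp contDiff_fst.contDiffOn hfst
  have hsnd : ContDiffOn ℝ ∞ (fun q : E × E => q.2) (U ×ˢ univ) := contDiff_snd.contDiffOn
  rw [contDiffOn_clm_apply]
  intro a
  simp only [coordGamma, ContinuousLinearMap.comp_apply]
  refine hIq.clm_apply ?_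
  rw [contDiffOn_clm_apply]
  intro w
  simp only [_root_.smul_apply, _root_.add_apply, _root_.sub_apply,
    ContinuousLinearMap.flip_apply, smul_eq_mul]
  exact contDiffOn_const.mul
    (((((hDq.clm_apply contDiffOn_const).clm_apply hsnd).clm_apply contDiffOn_const).add
      (((hDq.clm_apply hsnd).clm_apply contDiffOn_const).clm_apply contDiffOn_const)).sub
      (((hDq.clm_apply contDiffOn_const).clm_apply hsnd).clm_apply contDiffOn_const))

/-- The Sasaki metric in coordinates. -/
def coordSasaki (G : E → E →L[ℝ] E →L[ℝ] ℝ) (q : E × E) : (E × E) →L[ℝ] (E × E) →L[ℝ] ℝ :=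
  (G q.1).bilinearComp (ContinuousLinearMap.fst ℝ E E) (ContinuousLinearMap.fst ℝ E E) +
    (G q.1).bilinearComp
      (ContinuousLinearMap.snd ℝ E E + (coordGamma G q.1 q.2).comp (ContinuousLinearMap.fst ℝ E E))
      (ContinuousLinearMap.snd ℝ E E + (coordGamma G q.1 q.2).comp (ContinuousLinearMap.fst ℝ E E))

omit [FiniteDimensional ℝ E] in
theorem coordSasaki_apply (G : E → E →L[ℝ] E →L[ℝ] ℝ) (q w w' : E × E) :
    coordSasaki G q w w' = G q.1 w.1 w'.1 +
      G q.1 (w.2 + coordGamma G q.1 q.2 w.1) (w'.2 + coordGamma G q.1 q.2 w'.1) := rfl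

theorem contDiffOn_coordSasaki {G : E → E →L[ℝ] E →L[ℝ] ℝ} {U : Set E} (hU : IsOpen U)
    (hG : ContDiffOn ℝ ∞ G U) (hpos : ∀ y ∈ U, ∀ v, v ≠ 0 → 0 < G y v v) :
    ContDiffOn ℝ ∞ (coordSasaki G) (U ×ˢ univ) := by
  have hΓ := contDiffOn_coordGamma hU hG hpos
  have hGq : ContDiffOn ℝ ∞ (fun q : E × E => G q.1) (U ×ˢ univ) :=
    hG.comp contDiff_fst.contDiffOn fun q hq => hq.1
  rw [contDiffOn_clm_apply]
  intro w
  rw [contDiffOn_clm_apply]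
  intro w'
  simp only [coordSasaki_apply]
  refine ContDiffOn.add ?_ ?_
  · exact (hGq.clm_apply contDiffOn_const).clm_apply contDiffOn_const
  · exact (hGq.clm_apply (contDiffOn_const.add (hΓ.clm_apply contDiffOn_const))).clm_apply
      (contDiffOn_const.add (hΓ.clm_apply contDiffOn_const))

end CoordinateCalculus

/-! ### Metric coefficients and Christoffel symbols under changes of charts. -/

namespace RiemSpace

universe u

variable (A : RiemSpace.{u})

/-- The metric has smooth coefficients in the preferred charts. -/
def IsSmooth : Prop :=
  ∀ x : A.M, ContDiffOn ℝ ∞ (A.coordForm x) (extChartAt A.I x).target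

theorem isOpen_target (x : A.M) : IsOpen (extChartAt A.I x).target :=
  isOpen_extChartAt_target x

theorem coordForm_apply (x : A.M) (y v w : A.E) :
    A.coordForm x y v w =
      A.form ((extChartAt A.I x).symm y)
        (tangentCoordChange A.I x ((extChartAt A.I x).symm y) ((extChartAt A.I x).symm y) v)
        (tangentCoordChange A.I x ((extChartAt A.I x).symm y) ((extChartAt A.I x).symm y) w) := rfl

theorem coordForm_symm (x : A.M) (y v w : A.E) : A.coordForm x y v w = A.coordForm x y w v := by
  rw [coordForm_apply, coordForm_apply, A.form_symm]

theorem tangentCoordChange_inv {x z : A.M} (hz : z ∈ (extChartAt A.I x).source) (v : A.E) :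
    tangentCoordChange A.I z x z (tangentCoordChange A.I x z z v) = v := by
  rw [tangentCoordChange_comp ⟨⟨hz, mem_extChartAt_source z⟩, hz⟩, tangentCoordChange_self hz]

theorem tangentCoordChange_inv' {x z : A.M} (hz : z ∈ (extChartAt A.I x).source) (v : A.E) :
    tangentCoordChange A.I x z z (tangentCoordChange A.I z x z v) = v := by
  rw [tangentCoordChange_comp ⟨⟨mem_extChartAt_source z, hz⟩, mem_extChartAt_source z⟩,
    tangentCoordChange_self (mem_extChartAt_source z)]

theorem coordForm_pos {x : A.M} {y : A.E} (hy : y ∈ (extChartAt A.I x).target) (v : A.E)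
    (hv : v ≠ 0) : 0 < A.coordForm x y v v := by
  rw [coordForm_apply]
  refine A.form_pos _ _ fun h => hv ?_
  rw [← A.tangentCoordChange_inv ((extChartAt A.I x).map_target hy) v, h, map_zero]

theorem coordForm_self (x : A.M) : A.coordForm x (extChartAt A.I x x) = A.form x := by
  ext v w
  rw [coordForm_apply]
  simp only [extChartAt_to_inv]
  rw [tangentCoordChange_self (mem_extChartAt_source x),
    tangentCoordChange_self (mem_extChartAt_source x)]

theorem tangentCoordChange_eq_fderiv (x z z' : A.M) :
    tangentCoordChange A.I x z z' =
      fderiv ℝ (extChartAt A.I z ∘ (extChartAt A.I x).symm) (extChartAt A.I x z') := by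
  rw [tangentCoordChange_def, A.I.range_eq_univ, fderivWithin_univ]

theorem isOpen_transition (x z : A.M) :
    IsOpen ((extChartAt A.I x).symm ≫ extChartAt A.I z).source := by
  rw [PartialEquiv.trans_source, PartialEquiv.symm_source]
  exact (continuousOn_extChartAt_symm x).isOpen_inter_preimage (A.isOpen_target x)
    (isOpen_extChartAt_source z)

theorem contDiffOn_transition (x z : A.M) :
    ContDiffOn ℝ ∞ (extChartAt A.I z ∘ (extChartAt A.I x).symm)
      ((extChartAt A.I x).symm ≫ extChartAt A.I z).source :=
  contDiffOn_ext_coord_change z x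

theorem coordForm_transition {x z : A.M} {y : A.E}
    (hy : y ∈ ((extChartAt A.I x).symm ≫ extChartAt A.I z).source) :
    A.coordForm x y =
      (A.coordForm z ((extChartAt A.I z ∘ (extChartAt A.I x).symm) y)).bilinearComp
        (fderiv ℝ (extChartAt A.I z ∘ (extChartAt A.I x).symm) y)
        (fderiv ℝ (extChartAt A.I z ∘ (extChartAt A.I x).symm) y) := by
  have hy1 : y ∈ (extChartAt A.I x).target := hy.1
  have hy2 : (extChartAt A.I x).symm y ∈ (extChartAt A.I z).source := hy.2
  set z' := (extChartAt A.I x).symm y with hz'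
  have hyz : extChartAt A.I x z' = y := (extChartAt A.I x).right_inv hy1
  have hz1 : z' ∈ (extChartAt A.I x).source := (extChartAt A.I x).map_target hy1
  have h3 : (extChartAt A.I z).symm ((extChartAt A.I z ∘ (extChartAt A.I x).symm) y) = z' :=
    (extChartAt A.I z).left_inv hy2
  have h4 : fderiv ℝ (extChartAt A.I z ∘ (extChartAt A.I x).symm) y =
      tangentCoordChange A.I x z z' := by
    rw [tangentCoordChange_eq_fderiv, hyz]
  ext v w
  rw [ContinuousLinearMap.bilinearComp_apply, coordForm_apply, coordForm_apply, h3, h4, ← hz',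
    tangentCoordChange_comp ⟨⟨hz1, hy2⟩, mem_extChartAt_source z'⟩,
    tangentCoordChange_comp ⟨⟨hz1, hy2⟩, mem_extChartAt_source z'⟩]

theorem christoffel_spec (x : A.M) (v a w : A.E) :
    A.form x (A.christoffel x v a) w = koszul (A.coordForm x) (extChartAt A.I x x) v a w :=
  LinearMap.BilinForm.apply_toDual_symm_apply
    (hB := toBilin_nondegenerate (A.form x) (A.form_pos x)) (koszul _ _ v a) w

/-- At zero vectors the connector is therefore the plain vertical projection, which makes the zero
section isometric (`tnorm_zero`). -/
theorem christoffel_zero (x : A.M) : A.christoffel x 0 = 0 := by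
  ext a
  refine injective_of_posDef (A.form_pos x) ?_
  ext w
  rw [christoffel_spec]
  simp [koszul]

variable {A}

/-- Transformation law of the Christoffel symbols. -/
theorem christoffel_transition (hA : A.IsSmooth) {x : A.M} {y : A.E}
    (hy : y ∈ (extChartAt A.I x).target) (u a : A.E) :
    let z := (extChartAt A.I x).symm y
    let φ := extChartAt A.I z ∘ (extChartAt A.I x).symm
    fderiv ℝ φ y (coordGamma (A.coordForm x) y u a) =
      A.christoffel z (fderiv ℝ φ y u) (fderiv ℝ φ y a) + fderiv ℝ (fderiv ℝ φ) y a u := by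
  intro z φ
  have hz1 : z ∈ (extChartAt A.I x).source := (extChartAt A.I x).map_target hy
  have hyz : extChartAt A.I x z = y := (extChartAt A.I x).right_inv hy
  have hyV : y ∈ ((extChartAt A.I x).symm ≫ extChartAt A.I z).source :=
    ⟨hy, mem_extChartAt_source z⟩
  have hV := (A.isOpen_transition x z).mem_nhds hyV
  have hφy : φ y = extChartAt A.I z z := rfl
  have hz2 : φ y ∈ (extChartAt A.I z).target := mem_extChartAt_target z
  have hL : fderiv ℝ φ y = tangentCoordChange A.I x z z := by
    rw [tangentCoordChange_eq_fderiv, hyz]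
  have hpull := koszul_pullback (G₁ := A.coordForm x) (G₂ := A.coordForm z) (φ := φ) (y := y)
    (by filter_upwards [hV] with y' hy' using A.coordForm_transition hy')
    (((hA z).contDiffAt ((A.isOpen_target z).mem_nhds hz2)).differentiableAt (by simp))
    (A.coordForm_symm z (φ y))
    (((A.contDiffOn_transition x z).contDiffAt hV).of_le ENat.LEInfty.out) u a
  refine injective_of_posDef (A.form_pos z) ?_
  ext w
  -- Test vectors may be taken in the image of the derivative of φ, where the pullback formula
  -- applies.
  have hw : w = fderiv ℝ φ y (tangentCoordChange A.I z x z w) := by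
    rw [hL, A.tangentCoordChange_inv' hz1]
  rw [hw]
  have hcg := coordGamma_spec (G := A.coordForm x) (y := y) (A.coordForm_pos hy)
    (((hA x).contDiffAt ((A.isOpen_target x).mem_nhds hy)).differentiableAt (by simp))
    (Eventually.of_forall (A.coordForm_symm x)) u a (tangentCoordChange A.I z x z w)
  rw [hpull, A.coordForm_transition hyV, ContinuousLinearMap.bilinearComp_apply] at hcg
  change A.coordForm z (φ y) _ _ = _ at hcg
  rw [hφy, coordForm_self, ← christoffel_spec] at hcg
  rw [map_add, _root_.add_apply]
  exact hcg

end RiemSpace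

/-! ### Smoothness of the iterated Sasaki metrics. -/

namespace RiemSpace

universe u

variable {A : RiemSpace.{u}}

theorem extChartAt_tangent_apply (ζ ξ : TangentBundle A.I A.M) :
    extChartAt A.I.tangent ζ ξ =
      (extChartAt A.I ζ.proj ξ.proj, tangentCoordChange A.I ξ.proj ζ.proj ξ.proj ξ.2) := rfl

theorem extChartAt_tangent_symm_apply (ξ : TangentBundle A.I A.M) (q : A.E × A.E) :
    (extChartAt A.I.tangent ξ).symm q =
      (⟨(extChartAt A.I ξ.proj).symm q.1,
        tangentCoordChange A.I ξ.proj ((extChartAt A.I ξ.proj).symm q.1)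
          ((extChartAt A.I ξ.proj).symm q.1) q.2⟩ : TangentBundle A.I A.M) := rfl

theorem extChartAt_tangent_target (ξ : TangentBundle A.I A.M) :
    (extChartAt A.I.tangent ξ).target = (extChartAt A.I ξ.proj).target ×ˢ univ := by
  rw [ModelWithCorners.tangent, FiberBundle.extChartAt_target]
  congr 1
  rw [inter_eq_left]
  intro y hy
  have := (extChartAt A.I ξ.proj).map_target hy
  rwa [extChartAt_source] at this

/-- The derivative of a change of charts of the tangent bundle. -/
theorem tangentCoordChange_tangent {ξ : TangentBundle A.I A.M} {q : A.E × A.E}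
    (hq : q.1 ∈ (extChartAt A.I ξ.proj).target) (w : A.E × A.E) :
    let ζ : TangentBundle A.I A.M := (extChartAt A.I.tangent ξ).symm q
    let φ := extChartAt A.I ζ.proj ∘ (extChartAt A.I ξ.proj).symm
    tangentCoordChange A.I.tangent ξ ζ ζ w =
      (fderiv ℝ φ q.1 w.1, fderiv ℝ (fderiv ℝ φ) q.1 w.1 q.2 + fderiv ℝ φ q.1 w.2) := by
  intro ζ φ
  have hζ : extChartAt A.I.tangent ξ ζ = q :=
    (extChartAt A.I.tangent ξ).right_inv (by rw [extChartAt_tangent_target]; exact ⟨hq, trivial⟩)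
  have h1 : tangentCoordChange A.I.tangent ξ ζ ζ =
      fderiv ℝ (extChartAt A.I.tangent ζ ∘ (extChartAt A.I.tangent ξ).symm) q := by
    have := A.tangent.tangentCoordChange_eq_fderiv ξ ζ ζ
    exact this.trans (by rw [← hζ]; rfl)
  have hqV : q.1 ∈ ((extChartAt A.I ξ.proj).symm ≫ extChartAt A.I ζ.proj).source :=
    ⟨hq, mem_extChartAt_source ζ.proj⟩
  have hV := (A.isOpen_transition ξ.proj ζ.proj).mem_nhds hqV
  -- A change of charts of TM is the tangent map of a change of charts of M.
  have hev : (extChartAt A.I.tangent ζ ∘ (extChartAt A.I.tangent ξ).symm) =ᶠ[𝓝 q]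
      fun q' : A.E × A.E => (φ q'.1, fderiv ℝ φ q'.1 q'.2) := by
    filter_upwards [continuous_fst.continuousAt.preimage_mem_nhds hV] with q' hq'
    have hq1 : q'.1 ∈ (extChartAt A.I ξ.proj).target := hq'.1
    have hq2 : (extChartAt A.I ξ.proj).symm q'.1 ∈ (extChartAt A.I ζ.proj).source := hq'.2
    have hq3 := (extChartAt A.I ξ.proj).map_target hq1
    rw [Function.comp_apply, extChartAt_tangent_apply, extChartAt_tangent_symm_apply]
    refine Prod.ext rfl ?_
    dsimp only
    rw [tangentCoordChange_comp ⟨⟨hq3, mem_extChartAt_source _⟩, hq2⟩,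
      tangentCoordChange_eq_fderiv, (extChartAt A.I ξ.proj).right_inv hq1]
  have hφ := (A.contDiffOn_transition ξ.proj ζ.proj).contDiffAt hV
  have hφ1 : HasFDerivAt φ (fderiv ℝ φ q.1) q.1 :=
    (hφ.differentiableAt (by simp)).hasFDerivAt
  have hφ2 : HasFDerivAt (fderiv ℝ φ) (fderiv ℝ (fderiv ℝ φ) q.1) q.1 :=
    (((hφ.of_le (n := ∞) (m := 2) ENat.LEInfty.out).fderiv_right (m := 1) (by norm_num)).differentiableAt
      (by norm_num)).hasFDerivAt
  have hd1 : HasFDerivAt (fun q' : A.E × A.E => φ q'.1)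
      ((fderiv ℝ φ q.1).comp (ContinuousLinearMap.fst ℝ A.E A.E)) q := hφ1.comp q hasFDerivAt_fst
  have hd2 : HasFDerivAt (fun q' : A.E × A.E => fderiv ℝ φ q'.1)
      ((fderiv ℝ (fderiv ℝ φ) q.1).comp (ContinuousLinearMap.fst ℝ A.E A.E)) q :=
    hφ2.comp q hasFDerivAt_fst
  have hd := hd1.prodMk (hd2.clm_apply (hasFDerivAt_snd (𝕜 := ℝ) (p := q)))
  rw [h1, hev.fderiv_eq, hd.fderiv]
  simp [add_comm]

/-- The coordinates of the Sasaki metric. -/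
theorem coordForm_tangent (hA : A.IsSmooth) (ξ : TangentBundle A.I A.M) {q : A.E × A.E}
    (hq : q.1 ∈ (extChartAt A.I ξ.proj).target) :
    A.tangent.coordForm ξ q = coordSasaki (A.coordForm ξ.proj) q := by
  suffices h : ∀ w w' : A.E × A.E,
      A.tangent.coordForm ξ q w w' = coordSasaki (A.coordForm ξ.proj) q w w' from
    ContinuousLinearMap.ext fun w => ContinuousLinearMap.ext fun w' => h w w'
  intro w w'
  set ζ : TangentBundle A.I A.M := (extChartAt A.I.tangent ξ).symm q with hζ
  have h1 : A.tangent.coordForm ξ q w w' =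
      A.sasakiForm ζ (tangentCoordChange A.I.tangent ξ ζ ζ w)
        (tangentCoordChange A.I.tangent ξ ζ ζ w') := rfl
  have hqV : q.1 ∈ ((extChartAt A.I ξ.proj).symm ≫ extChartAt A.I ζ.proj).source :=
    ⟨hq, mem_extChartAt_source ζ.proj⟩
  have hqz : extChartAt A.I ξ.proj ζ.proj = q.1 := (extChartAt A.I ξ.proj).right_inv hq
  have hζ2 : ζ.2 = fderiv ℝ (extChartAt A.I ζ.proj ∘ (extChartAt A.I ξ.proj).symm) q.1 q.2 := by
    have : ζ.2 = tangentCoordChange A.I ξ.proj ζ.proj ζ.proj q.2 := rfl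
    rw [this, tangentCoordChange_eq_fderiv, hqz]
  have hform : A.coordForm ζ.proj ((extChartAt A.I ζ.proj ∘ (extChartAt A.I ξ.proj).symm) q.1) =
      A.form ζ.proj := A.coordForm_self ζ.proj
  -- The second derivative in the change of charts of TM is the inhomogeneous term in the
  -- transformation law of the Christoffel symbols, so the two combine and the connector transforms
  -- as a tensor.
  have hc := fun a => christoffel_transition hA hq q.2 a
  change ∀ a, fderiv ℝ (extChartAt A.I ζ.proj ∘ (extChartAt A.I ξ.proj).symm) q.1 _ =
    A.christoffel ζ.proj (fderiv ℝ (extChartAt A.I ζ.proj ∘ (extChartAt A.I ξ.proj).symm) q.1 q.2)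
      (fderiv ℝ (extChartAt A.I ζ.proj ∘ (extChartAt A.I ξ.proj).symm) q.1 a) + fderiv ℝ (fderiv ℝ
        (extChartAt A.I ζ.proj ∘ (extChartAt A.I ξ.proj).symm)) q.1 a q.2 at hc
  rw [h1, sasakiForm_apply, coordSasaki_apply, tangentCoordChange_tangent hq,
    tangentCoordChange_tangent hq, A.coordForm_transition hqV]
  simp only [ContinuousLinearMap.bilinearComp_apply, hform, ← hζ, map_add, hc, hζ2,
    _root_.add_apply]
  abel

theorem IsSmooth.tangent (hA : A.IsSmooth) : A.tangent.IsSmooth := by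
  intro (ξ : TangentBundle A.I A.M)
  have h := (contDiffOn_coordSasaki (A.isOpen_target ξ.proj) (hA ξ.proj)
    (fun y hy v hv => A.coordForm_pos hy v hv)).congr
      fun q hq => coordForm_tangent hA ξ hq.1
  rw [← extChartAt_tangent_target] at h
  exact h

theorem IsSmooth.iter (hA : A.IsSmooth) : ∀ m, (A.iter m).IsSmooth
  | 0 => hA
  | m + 1 => (IsSmooth.iter hA m).tangent

end RiemSpace

/-! ### Continuity of the metrics and the topology of the iterated bundles. -/

namespace RiemSpace

universe u

variable {A : RiemSpace.{u}}

/-- The dictionary between regularity of the metric as a section of a bundle of forms and regularity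
of its coefficients in charts. -/
theorem trivializationAt_inner (A : RiemSpace.{u}) {x₀ x : A.M}
    (hx : x ∈ (extChartAt A.I x₀).source) :
    (trivializationAt (A.E →L[ℝ] A.E →L[ℝ] ℝ)
      (fun x : A.M => TangentSpace A.I x →L[ℝ] TangentSpace A.I x →L[ℝ] ℝ) x₀
      ⟨x, A.g.inner x⟩).2 = A.coordForm x₀ (extChartAt A.I x₀ x) := by
  have hx' : x ∈ (chartAt A.H x₀).source := by rwa [extChartAt_source] at hx
  ext v w
  rw [hom_trivializationAt_apply]
  dsimp only
  rw [inCoordinates_apply_eq₂ (by simpa using hx') (by simpa using hx') (mem_univ _),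
    coordForm_apply, (extChartAt A.I x₀).left_inv hx]
  have h : ∀ v : A.E, (trivializationAt A.E (TangentSpace A.I) x₀).symm x v =
      tangentCoordChange A.I x₀ x x v := by
    intro v
    rw [← Trivialization.symmL_apply (R := ℝ), TangentBundle.symmL_trivializationAt_eq_core hx']
    · rfl
    · simpa using hx'
  rw [h, h]
  simp
  rfl

/-- The metric as a Riemannian structure on the tangent bundle. -/
abbrev bundle (A : RiemSpace.{u}) : RiemannianBundle (fun x : A.M => TangentSpace A.I x) := ⟨A.g⟩

theorem IsSmooth.isContinuousRiemannianBundle (hA : A.IsSmooth) :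
    letI := A.bundle
    IsContinuousRiemannianBundle A.E (fun x : A.M => TangentSpace A.I x) := by
  let := A.bundle
  refine ⟨⟨A.g.inner, continuous_iff_continuousAt.2 fun x₀ => ?_, fun x v w => rfl⟩⟩
  rw [FiberBundle.continuousAt_totalSpace]
  refine ⟨continuousAt_id, ?_⟩
  have h : ContinuousAt (fun x => A.coordForm x₀ (extChartAt A.I x₀ x)) x₀ :=
    ContinuousAt.comp (((hA x₀).continuousOn).continuousAt
      ((A.isOpen_target x₀).mem_nhds (mem_extChartAt_target x₀))) (continuousAt_extChartAt x₀)
  refine h.congr ?_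
  filter_upwards [extChartAt_source_mem_nhds (I := A.I) x₀] with x hx
  exact (A.trivializationAt_inner hx).symm

/-- Vectors over different points are separated in the base, vectors over the same point in a
trivialization. -/
theorem t2Space_tangent [T2Space A.M] : T2Space A.tangent.M := by
  change T2Space (TangentBundle A.I A.M)
  refine t2Space_iff_disjoint_nhds.2 fun ξ ζ hne => ?_
  have hcont : Continuous (fun ξ : TangentBundle A.I A.M => ξ.proj) :=
    FiberBundle.continuous_proj A.E (TangentSpace A.I)
  by_cases h : ξ.proj = ζ.proj
  · set e := trivializationAt A.E (TangentSpace A.I) ξ.proj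
    have h1 : ξ ∈ e.source := FiberBundle.mem_trivializationAt_proj_source
    have h2 : ζ ∈ e.source := by
      rw [e.mem_source, ← h]; exact mem_baseSet_trivializationAt _ _ _
    have hne' : e ξ ≠ e ζ := fun hh => hne (e.injOn h1 h2 hh)
    exact Tendsto.disjoint (e.toOpenPartialHomeomorph.continuousAt h1)
      (disjoint_nhds_nhds.2 hne') (e.toOpenPartialHomeomorph.continuousAt h2)
  · exact Tendsto.disjoint hcont.continuousAt (disjoint_nhds_nhds.2 h) hcont.continuousAt

theorem t2Space_iter [T2Space A.M] : ∀ m, T2Space (A.iter m).M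
  | 0 => ‹_›
  | m + 1 => by
    have := t2Space_iter m
    exact t2Space_tangent (A := A.iter m)

theorem regularSpace [T2Space A.M] : RegularSpace A.M := by
  have := Manifold.locallyCompact_of_finiteDimensional (M := A.M) A.I
  infer_instance

/-- Small balls of the Riemannian distance are small neighborhoods. -/
theorem IsSmooth.exists_rdist_lt_subset [T2Space A.M] (hA : A.IsSmooth) {x : A.M} {s : Set A.M}
    (hs : s ∈ 𝓝 x) : ∃ c : ℝ≥0∞, 0 < c ∧ {y | A.rdist x y < c} ⊆ s := by
  let := A.bundle
  have := hA.isContinuousRiemannianBundle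
  have := regularSpace (A := A)
  exact setOfPred_riemannianEDist_lt_subset_nhds' A.I hs

theorem isSmooth_of (n : ℕ) (M : Type*) [MetricSpace M]
    [ChartedSpace (EuclideanSpace ℝ (Fin n)) M] [IsManifold (𝓡 n) ∞ M]
    [RiemannianBundle (fun x : M => TangentSpace (𝓡 n) x)]
    [h : IsContMDiffRiemannianBundle (𝓡 n) ∞ (EuclideanSpace ℝ (Fin n))
      (fun x : M => TangentSpace (𝓡 n) x)] : (RiemSpace.of n M).IsSmooth := by
  obtain ⟨g, hg, hgi⟩ := h.exists_contMDiff
  have hgg : ∀ x, g x = (RiemSpace.of n M).g.inner x := by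
    intro x
    ext v w
    exact (hgi x v w).symm
  intro (x : M)
  have h1 := hg.contMDiffOn (s := (extChartAt (𝓡 n) x).source)
  have h2 := (contMDiffOn_extChartAt_symm (I := 𝓡 n) (n := ∞) x)
  have h3 := ((trivializationAt
    (EuclideanSpace ℝ (Fin n) →L[ℝ] EuclideanSpace ℝ (Fin n) →L[ℝ] ℝ)
    (fun x : M => TangentSpace (𝓡 n) x →L[ℝ] TangentSpace (𝓡 n) x →L[ℝ] ℝ)
      x).contMDiffOn_section_iff (IB := 𝓡 n) (n := ∞) (s := g) (isOpen_extChartAt_source x)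
      (by simp [hom_trivializationAt])).1 h1
  have h4 := h3.comp h2 (extChartAt (𝓡 n) x).mapsTo_symm
  refine (contMDiffOn_iff_contDiffOn.1 h4).congr fun y hy => ?_
  have h5 := (RiemSpace.of n M).trivializationAt_inner
    ((extChartAt (𝓡 n) x).map_target hy)
  simp only [Function.comp_apply, hgg]
  refine Eq.trans ?_ h5.symm
  congr 1
  exact ((extChartAt (𝓡 n) x).right_inv hy).symm

end RiemSpace

/-! ### Lengths of paths and distances under maps with bounded derivative. -/

namespace RiemSpace

universe u v

variable {A : RiemSpace.{u}} {B : RiemSpace.{v}}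

/-- The length of a path. -/
def plen (A : RiemSpace.{u}) (γ : ℝ → A.M) (a b : ℝ) : ℝ≥0∞ :=
  letI := A.bundle
  pathELength A.I γ a b

theorem enorm_eq_tnorm (x : A.M) (v : TangentSpace A.I x) :
    letI := A.bundle
    ‖v‖ₑ = ENNReal.ofReal (A.tnorm x v) := by
  let := A.bundle
  rw [← ofReal_norm, norm_eq_sqrt_real_inner]
  rfl

theorem plen_mono {γ : ℝ → A.M} {a b a' b' : ℝ} (h : a' ≤ a) (h' : b ≤ b') :
    A.plen γ a b ≤ A.plen γ a' b' := by
  let := A.bundle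
  exact pathELength_mono h h'

theorem plen_add (γ : ℝ → A.M) {a b c : ℝ} (h : a ≤ b) (h' : b ≤ c) :
    A.plen γ a b + A.plen γ b c = A.plen γ a c := by
  let := A.bundle
  exact pathELength_add h h'

theorem rdist_le_plen {γ : ℝ → A.M} {a b : ℝ} (hγ : ContMDiffOn 𝓘(ℝ, ℝ) A.I 1 γ (Icc a b))
    (hab : a ≤ b) : A.rdist (γ a) (γ b) ≤ A.plen γ a b := by
  let := A.bundle
  exact riemannianEDist_le_pathELength hγ rfl rfl hab

theorem exists_path_of_rdist_lt {x y : A.M} {r : ℝ≥0∞} (h : A.rdist x y < r) :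
    ∃ γ : ℝ → A.M, γ 0 = x ∧ γ 1 = y ∧ ContMDiffOn 𝓘(ℝ, ℝ) A.I 1 γ (Icc 0 1) ∧
      A.plen γ 0 1 < r := by
  let := A.bundle
  exact exists_lt_of_riemannianEDist_lt h

theorem rdist_comm (x y : A.M) : A.rdist x y = A.rdist y x := by
  let := A.bundle
  exact riemannianEDist_comm

theorem rdist_triangle (x y z : A.M) : A.rdist x z ≤ A.rdist x y + A.rdist y z := by
  let := A.bundle
  exact riemannianEDist_triangle

/-- A map which expands tangent vectors by at most `L` expands lengths by at most `L`. -/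
theorem plen_comp_le {f : A.M → B.M} {W : Set A.M} (hW : IsOpen W)
    (hf : ContMDiffOn A.I B.I 1 f W) {L : ℝ} (hL : 0 ≤ L)
    (hb : ∀ ξ ∈ W, ∀ w : TangentSpace A.I ξ,
      B.tnorm (f ξ) (mfderiv A.I B.I f ξ w) ≤ L * A.tnorm ξ w)
    {γ : ℝ → A.M} {a b : ℝ} (hγ : ContMDiffOn 𝓘(ℝ, ℝ) A.I 1 γ (Icc a b))
    (hγW : ∀ t ∈ Icc a b, γ t ∈ W) :
    B.plen (f ∘ γ) a b ≤ ENNReal.ofReal L * A.plen γ a b := by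
  let := A.bundle
  let := B.bundle
  rcases le_or_gt b a with hab | hab
  · rcases hab.eq_or_lt with rfl | hab
    · simp [plen]
    · simp [plen, pathELength_eq_lintegral_mfderiv_Icc, Icc_eq_empty (not_le.2 hab)]
  unfold plen
  rw [pathELength_eq_lintegral_mfderivWithin_Icc, pathELength_eq_lintegral_mfderivWithin_Icc,
    ← MeasureTheory.lintegral_const_mul' _ _ ENNReal.ofReal_ne_top]
  refine MeasureTheory.setLIntegral_mono' measurableSet_Icc fun t ht => ?_
  have h1 : mfderivWithin 𝓘(ℝ, ℝ) B.I (f ∘ γ) (Icc a b) t =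
      (mfderiv A.I B.I f (γ t)).comp (mfderivWithin 𝓘(ℝ, ℝ) A.I γ (Icc a b) t) := by
    apply mfderiv_comp_mfderivWithin
    · exact ((hf _ (hγW t ht)).contMDiffAt (hW.mem_nhds (hγW t ht))).mdifferentiableAt one_ne_zero
    · exact hγ.mdifferentiableOn one_ne_zero t ht
    · rw [uniqueMDiffWithinAt_iff_uniqueDiffWithinAt]
      exact uniqueDiffOn_Icc hab _ ht
  have h2 : mfderivWithin 𝓘(ℝ, ℝ) B.I (f ∘ γ) (Icc a b) t 1 =
      mfderiv A.I B.I f (γ t) (mfderivWithin 𝓘(ℝ, ℝ) A.I γ (Icc a b) t 1) := congr($h1 1)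
  rw [h2, Function.comp_apply, enorm_eq_tnorm, enorm_eq_tnorm, ← ENNReal.ofReal_mul hL]
  exact ENNReal.ofReal_le_ofReal (hb _ (hγW t ht) _)

theorem rdist_map_le_plen {f : A.M → B.M} {W : Set A.M} (hW : IsOpen W)
    (hf : ContMDiffOn A.I B.I 1 f W) {L : ℝ} (hL : 0 ≤ L)
    (hb : ∀ ξ ∈ W, ∀ w : TangentSpace A.I ξ,
      B.tnorm (f ξ) (mfderiv A.I B.I f ξ w) ≤ L * A.tnorm ξ w)
    {γ : ℝ → A.M} {a b : ℝ} (hab : a ≤ b) (hγ : ContMDiffOn 𝓘(ℝ, ℝ) A.I 1 γ (Icc a b))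
    (hγW : ∀ t ∈ Icc a b, γ t ∈ W) :
    B.rdist (f (γ a)) (f (γ b)) ≤ ENNReal.ofReal L * A.plen γ a b :=
  (rdist_le_plen (hf.comp hγ hγW) hab).trans (plen_comp_le hW hf hL hb hγ hγW)

/-- Used to pass from nearly minimal paths to the distance, since minimal paths need not be
available. -/
theorem le_mul_of_eventually_le_mul_add {x l q : ℝ≥0∞} (hl : l ≠ ⊤)
    (h : ∀ᶠ c in 𝓝[>] (0 : ℝ≥0∞), x ≤ l * (q + c)) : x ≤ l * q := by
  have hc : Continuous fun c : ℝ≥0∞ => l * (q + c) :=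
    (ENNReal.continuous_const_mul hl).comp (continuous_const.add continuous_id)
  have ht := (hc.tendsto 0).mono_left (nhdsWithin_le_nhds (s := Ioi 0))
  rw [add_zero] at ht
  exact ge_of_tendsto ht h

theorem rdist_map_le {f : A.M → B.M} (hf : ContMDiff A.I B.I 1 f) {L : ℝ} (hL : 0 < L)
    (hb : ∀ ξ, ∀ w : TangentSpace A.I ξ,
      B.tnorm (f ξ) (mfderiv A.I B.I f ξ w) ≤ L * A.tnorm ξ w) (x y : A.M) :
    B.rdist (f x) (f y) ≤ ENNReal.ofReal L * A.rdist x y := by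
  by_cases hfin : A.rdist x y = ⊤
  -- At infinite distance positivity of `L` matters, since 0 · ⊤ = 0.
  · rw [hfin, ENNReal.mul_top (by simpa using hL)]
    exact le_top
  refine le_mul_of_eventually_le_mul_add ENNReal.ofReal_ne_top ?_
  filter_upwards [self_mem_nhdsWithin] with c hc
  obtain ⟨γ, h0, h1, hγ, hl⟩ := exists_path_of_rdist_lt
    (ENNReal.lt_add_right hfin (ne_of_gt hc))
  rw [← h0, ← h1] at hl ⊢
  exact (rdist_map_le_plen isOpen_univ hf.contMDiffOn hL.le (fun ξ _ => hb ξ) zero_le_one hγ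
    fun t _ => mem_univ _).trans (by gcongr)

/-- Version for two points of a ball with a short path between them. -/
theorem rdist_map_le_of_add_lt {f : A.M → B.M} {W : Set A.M} (hW : IsOpen W)
    (hf : ContMDiffOn A.I B.I 1 f W) {L : ℝ} (hL : 0 ≤ L)
    (hb : ∀ ξ ∈ W, ∀ w : TangentSpace A.I ξ,
      B.tnorm (f ξ) (mfderiv A.I B.I f ξ w) ≤ L * A.tnorm ξ w)
    {x a b : A.M} {R : ℝ≥0∞} (hR : {y | A.rdist x y ≤ R} ⊆ W)
    (hab : A.rdist x a + A.rdist a b < R) :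
    B.rdist (f a) (f b) ≤ ENNReal.ofReal L * A.rdist a b := by
  have hfin : A.rdist a b ≠ ⊤ := ne_top_of_lt (lt_of_le_of_lt le_add_self hab)
  refine le_mul_of_eventually_le_mul_add ENNReal.ofReal_ne_top ?_
  have hc : Continuous fun c : ℝ≥0∞ => A.rdist x a + (A.rdist a b + c) :=
    continuous_const.add (continuous_const.add continuous_id)
  have ht := (hc.tendsto 0).mono_left (nhdsWithin_le_nhds (s := Ioi 0))
  rw [add_zero] at ht
  filter_upwards [self_mem_nhdsWithin, ht.eventually_lt_const hab] with c hc hcR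
  obtain ⟨γ, h0, h1, hγ, hl⟩ := exists_path_of_rdist_lt
    (ENNReal.lt_add_right hfin (ne_of_gt hc))
  -- The path stays in the ball: its points are within d(x,a) plus its length of the centre.
  have := rdist_map_le_plen hW hf hL hb zero_le_one hγ fun t ht => hR (le_trans ?_ hcR.le)
  · rw [h0, h1] at this
    exact this.trans (by gcongr)
  · refine (rdist_triangle x a (γ t)).trans (add_le_add le_rfl (le_trans ?_ hl.le))
    have := rdist_le_plen (hγ.mono (Icc_subset_Icc_right ht.2)) ht.1
    rw [h0] at this
    exact this.trans (plen_mono le_rfl ht.2)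

/-- Version for the center and a point of a closed ball. -/
theorem rdist_map_le_of_closedBall [T2Space A.M] (hA : A.IsSmooth) {f : A.M → B.M} {W : Set A.M}
    (hW : IsOpen W) (hf : ContMDiffOn A.I B.I 1 f W) {L : ℝ} (hL : 0 ≤ L)
    (hb : ∀ ξ ∈ W, ∀ w : TangentSpace A.I ξ,
      B.tnorm (f ξ) (mfderiv A.I B.I f ξ w) ≤ L * A.tnorm ξ w)
    {x y : A.M} {R : ℝ≥0∞} (hRtop : R ≠ ⊤) (hR : {y | A.rdist x y ≤ R} ⊆ W)
    (hy : A.rdist x y ≤ R) :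
    B.rdist (f x) (f y) ≤ ENNReal.ofReal L * R := by
  obtain ⟨c, hc, hcW⟩ := hA.exists_rdist_lt_subset (hW.mem_nhds (hR hy))
  have key : ∀ c' : ℝ≥0∞, 0 < c' → c' ≤ c → B.rdist (f x) (f y) ≤
      ENNReal.ofReal L * (R + c') := by
    intro c' hc0 hc'
    obtain ⟨γ, h0, h1, hγ, hl⟩ := exists_path_of_rdist_lt
      (lt_of_le_of_lt hy (ENNReal.lt_add_right hRtop hc0.ne'))
    rw [← h0, ← h1]
    refine (rdist_map_le_plen hW hf hL hb zero_le_one hγ fun t ht => ?_).trans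
      (by gcongr)
    -- A path of length less than R + c' can leave the closed ball only after using up length R. The
    -- rest is then shorter than c', so the path is already in the neighbourhood of `y` contained in
    -- `W`.
    by_cases hlt : A.plen γ 0 t ≤ R
    · refine hR (le_trans ?_ hlt)
      have := rdist_le_plen (hγ.mono (Icc_subset_Icc_right ht.2)) ht.1
      rwa [h0] at this
    · refine hcW (lt_of_le_of_lt (b := A.plen γ t 1) ?_ (lt_of_lt_of_le ?_ hc'))
      · have := rdist_le_plen (hγ.mono (Icc_subset_Icc_left ht.1)) ht.2
        rwa [h1, rdist_comm] at this
      · have h2 := plen_add γ ht.1 ht.2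
        by_contra hcon
        push Not at hlt hcon
        rw [← h2] at hl
        exact absurd hl (not_lt.2 (add_le_add hlt.le hcon))
  refine le_mul_of_eventually_le_mul_add ENNReal.ofReal_ne_top ?_
  filter_upwards [self_mem_nhdsWithin, nhdsWithin_le_nhds (Iic_mem_nhds hc)] with c' h1 h2
  exact key c' h1 h2

end RiemSpace

/-! ### Zero sections, distortion of tangent vectors, and iterated tangent maps. -/

namespace RiemSpace

universe u

variable {A : RiemSpace.{u}}

/-- The zero section of the tangent bundle. -/
def zero (A : RiemSpace.{u}) (x : A.M) : A.tangent.M := (⟨x, 0⟩ : TangentBundle A.I A.M)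

theorem contMDiff_zero {k : ℕ∞ω} (hk : k ≤ (∞ : ℕ∞ω)) : ContMDiff A.I A.tangent.I k A.zero := by
  have := Bundle.contMDiff_zeroSection ℝ (TangentSpace A.I : A.M → Type _) (F := A.E) (IB := A.I)
    (n := (∞ : ℕ∞ω))
  exact this.of_le hk

theorem hasMFDerivAt_zero (x : A.M) :
    HasMFDerivAt A.I A.tangent.I A.zero x (ContinuousLinearMap.inl ℝ A.E A.E) := by
  refine ⟨(contMDiff_zero (k := 0) (by simp)).continuous.continuousAt, ?_⟩
  have h : HasFDerivAt (fun y : A.E => (y, (0 : A.E))) (ContinuousLinearMap.inl ℝ A.E A.E)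
      (extChartAt A.I x x) := hasFDerivAt_prodMk_left _ _
  refine (h.congr_of_eventuallyEq ?_).hasFDerivWithinAt
  filter_upwards [(A.isOpen_target x).mem_nhds (mem_extChartAt_target x)] with y hy
  have h1 : writtenInExtChartAt A.I A.tangent.I x A.zero y =
      (extChartAt A.I x ((extChartAt A.I x).symm y),
        tangentCoordChange A.I ((extChartAt A.I x).symm y) x ((extChartAt A.I x).symm y) 0) := rfl
  rw [h1, (extChartAt A.I x).right_inv hy, map_zero]

theorem tnorm_zero (x : A.M) (w : A.E) : A.tangent.tnorm (A.zero x) (w, (0 : A.E)) = A.tnorm x w := by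
  have h : A.sasakiForm (⟨x, 0⟩ : TangentBundle A.I A.M) (w, (0 : A.E)) (w, (0 : A.E)) =
      A.form x w w := by
    rw [sasakiForm_apply]
    have : A.christoffel (⟨x, 0⟩ : TangentBundle A.I A.M).proj
        (⟨x, 0⟩ : TangentBundle A.I A.M).2 = 0 := A.christoffel_zero x
    rw [this]
    simp
  exact congrArg Real.sqrt h

theorem rdist_zero_le (x y : A.M) : A.tangent.rdist (A.zero x) (A.zero y) ≤ A.rdist x y := by
  have h := rdist_map_le (A := A) (B := A.tangent) (f := A.zero)
    (contMDiff_zero ENat.LEInfty.out) one_pos (fun ξ w => by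
      rw [(hasMFDerivAt_zero ξ).mfderiv, one_mul]
      exact (tnorm_zero ξ w).le) x y
  simpa using h

theorem rdist_zeroSec_le (m : ℕ) (x y : A.M) :
    (A.iter m).rdist (A.zeroSec m x) (A.zeroSec m y) ≤ A.rdist x y := by
  induction m with
  | zero => exact le_rfl
  | succ m ih => exact (rdist_zero_le (A := A.iter m) _ _).trans ih

/-- `f` distorts the lengths of the vectors tangent to points of `W` by at most `L`. -/
def QIOn (A : RiemSpace.{u}) (L : ℝ) (f : A.M → A.M) (W : Set A.M) : Prop :=
  ∀ ξ ∈ W, ∀ w : TangentSpace A.I ξ,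
    L⁻¹ * A.tnorm ξ w ≤ A.tnorm (f ξ) (mfderiv A.I A.I f ξ w) ∧
      A.tnorm (f ξ) (mfderiv A.I A.I f ξ w) ≤ L * A.tnorm ξ w

theorem tnorm_nonneg (x : A.M) (w : TangentSpace A.I x) : 0 ≤ A.tnorm x w := Real.sqrt_nonneg _

theorem QIOn.mono {L L' : ℝ} {f : A.M → A.M} {W : Set A.M} (h : A.QIOn L f W) (hL : 0 < L)
    (hLL : L ≤ L') : A.QIOn L' f W := fun ξ hξ w =>
  ⟨(mul_le_mul_of_nonneg_right (inv_anti₀ hL hLL) (tnorm_nonneg _ _)).trans (h ξ hξ w).1,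
    (h ξ hξ w).2.trans (mul_le_mul_of_nonneg_right hLL (tnorm_nonneg _ _))⟩

theorem QIOn.comp {L L' : ℝ} {f g : A.M → A.M} {W V : Set A.M} (hg : A.QIOn L' g V)
    (hf : A.QIOn L f W) (hL' : 0 < L') (hfd : ∀ ξ ∈ W, MDifferentiableAt A.I A.I f ξ)
    (hgd : ∀ ξ ∈ V, MDifferentiableAt A.I A.I g ξ) :
    A.QIOn (L * L') (g ∘ f) (W ∩ f ⁻¹' V) := by
  intro ξ hξ w
  have h1 := hf ξ hξ.1 w
  have h2 := hg (f ξ) hξ.2 (mfderiv A.I A.I f ξ w)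
  have h3 : mfderiv A.I A.I (g ∘ f) ξ w =
      mfderiv A.I A.I g (f ξ) (mfderiv A.I A.I f ξ w) := by
    rw [mfderiv_comp ξ (hgd _ hξ.2) (hfd _ hξ.1)]; rfl
  rw [h3]
  constructor
  · calc (L * L')⁻¹ * A.tnorm ξ w = L'⁻¹ * (L⁻¹ * A.tnorm ξ w) := by rw [mul_inv]; ring
      _ ≤ _ := mul_le_mul_of_nonneg_left h1.1 (by positivity)
      _ ≤ _ := h2.1
  · calc _ ≤ _ := h2.2
      _ ≤ L' * (L * A.tnorm ξ w) := mul_le_mul_of_nonneg_left h1.2 hL'.le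
      _ = _ := by ring

/-- The tangent map. -/
def tmap (A : RiemSpace.{u}) (f : A.M → A.M) : A.tangent.M → A.tangent.M := tangentMap A.I A.I f

theorem tmap_zero (f : A.M → A.M) (x : A.M) : A.tmap f (A.zero x) = A.zero (f x) := by
  refine TotalSpace.ext rfl (heq_of_eq ?_)
  exact map_zero (mfderiv A.I A.I f x)

theorem tnorm_congr {x y : A.M} (h : x = y) (v : A.E) : A.tnorm x v = A.tnorm y v := by
  subst h; rfl

/-- A bound for the distortion of the tangent map gives the same bound for the map. -/
theorem QIOn.of_tmap {L : ℝ} {f : A.M → A.M} {W : Set A.tangent.M}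
    (h : A.tangent.QIOn L (A.tmap f) W)
    (hf : ∀ x, A.zero x ∈ W → MDifferentiableAt A.I A.I f x)
    (hf' : ∀ x, A.zero x ∈ W →
      MDifferentiableAt A.tangent.I A.tangent.I (A.tmap f) (A.zero x)) :
    A.QIOn L f (A.zero ⁻¹' W) := by
  intro x hx w
  -- It is enough to test vectors tangent to the zero section, which is isometric and intertwines
  -- `f` with its tangent map.
  have h1 := h (A.zero x) hx (w, (0 : A.E))
  have hcomp : A.tmap f ∘ A.zero = A.zero ∘ f := funext fun x => tmap_zero f x
  have h2 : HasMFDerivAt A.I A.tangent.I (A.tmap f ∘ A.zero) x _ :=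
    (hf' x hx).hasMFDerivAt.comp x (hasMFDerivAt_zero x)
  have h3 : HasMFDerivAt A.I A.tangent.I (A.zero ∘ f) x _ :=
    (hasMFDerivAt_zero (f x)).comp x (hf x hx).hasMFDerivAt
  rw [hcomp] at h2
  have h5 : mfderiv A.tangent.I A.tangent.I (A.tmap f) (A.zero x) (w, (0 : A.E)) =
      (mfderiv A.I A.I f x w, (0 : A.E)) := congr($(hasMFDerivAt_unique h2 h3) w)
  have h4 : A.tangent.tnorm (A.tmap f (A.zero x))
      (mfderiv A.tangent.I A.tangent.I (A.tmap f) (A.zero x) (w, (0 : A.E))) =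
      A.tnorm (f x) (mfderiv A.I A.I f x w) := by
    rw [← tnorm_zero (f x) (mfderiv A.I A.I f x w), h5]
    exact tnorm_congr (A := A.tangent) (tmap_zero f x) _
  have h6 : A.tangent.tnorm (A.zero x) (w, (0 : A.E)) = A.tnorm x w := tnorm_zero x w
  rw [h4, h6] at h1
  exact h1

theorem contMDiffOn_tmap {f : A.M → A.M} {U : Set A.M} (hU : IsOpen U) {k l : ℕ∞ω}
    (hf : ContMDiffOn A.I A.I l f U) (hkl : k + 1 ≤ l) :
    ContMDiffOn A.tangent.I A.tangent.I k (A.tmap f)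
      ((fun ξ : TangentBundle A.I A.M => ξ.proj) ⁻¹' U) := by
  have h := hf.contMDiffOn_tangentMapWithin hkl hU.uniqueMDiffOn
  refine h.congr fun ξ hξ => ?_
  have hl : l ≠ 0 := by rintro rfl; simp at hkl
  exact (tangentMapWithin_eq_tangentMap (hU.uniqueMDiffOn _ hξ)
    (((hf _ hξ).contMDiffAt (hU.mem_nhds hξ)).mdifferentiableAt hl)).symm

theorem continuous_base (m : ℕ) : Continuous (A.base m) := by
  induction m with
  | zero => exact continuous_id
  | succ m ih =>
    exact ih.comp (FiberBundle.continuous_proj (A.iter m).E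
      (TangentSpace (A.iter m).I : (A.iter m).M → Type))

theorem contMDiffOn_iterMap {f : A.M → A.M} {U : Set A.M} (hU : IsOpen U) (m : ℕ) {k l : ℕ}
    (hf : ContMDiffOn A.I A.I (l : ℕ∞) f U) (hkl : m + k ≤ l) :
    ContMDiffOn (A.iter m).I (A.iter m).I (k : ℕ∞) (A.iterMap f m) (A.base m ⁻¹' U) := by
  induction m generalizing k with
  | zero => exact hf.of_le (by exact_mod_cast (by omega : k ≤ l))
  | succ m ih =>
    exact contMDiffOn_tmap (A := A.iter m) (hU.preimage (continuous_base m))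
      (ih (k := k + 1) (by omega)) (by norm_cast)

theorem base_iterMap (f : A.M → A.M) (m : ℕ) (ξ : (A.iter m).M) :
    A.base m (A.iterMap f m ξ) = f (A.base m ξ) := by
  induction m with
  | zero => rfl
  | succ m ih => exact ih _

theorem iterMap_zeroSec (f : A.M → A.M) (m : ℕ) (x : A.M) :
    A.iterMap f m (A.zeroSec m x) = A.zeroSec m (f x) := by
  induction m with
  | zero => rfl
  | succ m ih =>
    refine (tmap_zero (A := A.iter m) _ _).trans ?_
    rw [ih]; rfl

theorem iterMap_id (m : ℕ) : A.iterMap id m = id := by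
  induction m with
  | zero => rfl
  | succ m ih =>
    change (A.iter m).tmap (A.iterMap id m) = id
    rw [ih]
    exact tangentMap_id

/-- The chain rule, iterated. Equality at one order is needed on a whole neighbourhood, because the
next order differentiates it. -/
theorem iterMap_comp {f g : A.M → A.M} {U V : Set A.M} (hU : IsOpen U) (hV : IsOpen V)
    (m : ℕ) {l : ℕ} (hf : ContMDiffOn A.I A.I (l : ℕ∞) f U) (hg : ContMDiffOn A.I A.I (l : ℕ∞) g V)
    (hfV : MapsTo f U V) (hml : m ≤ l) {ξ : (A.iter m).M} (hξ : A.base m ξ ∈ U) :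
    A.iterMap (g ∘ f) m ξ = A.iterMap g m (A.iterMap f m ξ) := by
  induction m with
  | zero => rfl
  | succ m ih =>
    change TangentBundle (A.iter m).I (A.iter m).M at ξ
    have hUo : IsOpen (A.base m ⁻¹' U) := hU.preimage (continuous_base m)
    have hξ' : ξ.proj ∈ A.base m ⁻¹' U := hξ
    have hev : A.iterMap (g ∘ f) m =ᶠ[𝓝 ξ.proj] A.iterMap g m ∘ A.iterMap f m := by
      filter_upwards [hUo.mem_nhds hξ'] with ζ hζ using ih (by omega) hζ
    have h1 : MDifferentiableAt (A.iter m).I (A.iter m).I (A.iterMap f m) ξ.proj :=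
      ((contMDiffOn_iterMap hU m (k := 1) hf (by omega)).contMDiffAt
        (hUo.mem_nhds hξ')).mdifferentiableAt one_ne_zero
    have h2 : MDifferentiableAt (A.iter m).I (A.iter m).I (A.iterMap g m)
        (A.iterMap f m ξ.proj) :=
      ((contMDiffOn_iterMap hV m (k := 1) hg (by omega)).contMDiffAt
        ((hV.preimage (continuous_base m)).mem_nhds (by
          rw [mem_preimage, base_iterMap]; exact hfV hξ'))).mdifferentiableAt one_ne_zero
    refine TotalSpace.ext hev.eq_of_nhds (heq_of_eq ?_)
    change mfderiv (A.iter m).I (A.iter m).I (A.iterMap (g ∘ f) m) ξ.proj ξ.2 =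
      mfderiv (A.iter m).I (A.iter m).I (A.iterMap g m) (A.iterMap f m ξ.proj)
        (mfderiv (A.iter m).I (A.iter m).I (A.iterMap f m) ξ.proj ξ.2)
    rw [hev.mfderiv_eq, mfderiv_comp _ h2 h1]
    rfl

/-- Bounds for the distortion of an iterated tangent map hold for the lower ones. -/
theorem QIOn.of_iterMap_succ {L : ℝ} {f : A.M → A.M} {U : Set A.M} (hU : IsOpen U) {m l : ℕ}
    (hf : ContMDiffOn A.I A.I (l : ℕ∞) f U) (hml : m + 2 ≤ l) {W : Set (A.iter (m + 1)).M}
    (hWU : ∀ ξ ∈ W, A.base (m + 1) ξ ∈ U)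
    (h : (A.iter (m + 1)).QIOn L (A.iterMap f (m + 1)) W) :
    (A.iter m).QIOn L (A.iterMap f m) ((A.iter m).zero ⁻¹' W) := by
  refine QIOn.of_tmap (A := A.iter m) h (fun x hx => ?_) fun x hx => ?_
  · exact ((contMDiffOn_iterMap hU m (k := 1) hf (by omega)).contMDiffAt
      ((hU.preimage (continuous_base m)).mem_nhds (hWU _ hx))).mdifferentiableAt one_ne_zero
  · exact ((contMDiffOn_iterMap hU (m + 1) (k := 1) hf (by omega)).contMDiffAt
      ((hU.preimage (continuous_base (m + 1))).mem_nhds (hWU _ hx))).mdifferentiableAt one_ne_zero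

end RiemSpace

/-! ### Metric properties of pointed partial quasi-isometries. -/

section PPQI

open RiemSpace

variable {n : ℕ} {M : Type*} [MetricSpace M] [ChartedSpace (EuclideanSpace ℝ (Fin n)) M]
  [IsManifold (𝓡 n) ∞ M] [RiemannianBundle (fun x : M => TangentSpace (𝓡 n) x)]

theorem rdist_of [h : IsRiemannianManifold (𝓡 n) M] (x y : M) :
    (RiemSpace.of n M).rdist x y = edist x y := (h.out x y).symm

theorem isPPQI_iff {m : ℕ} {R lam : ℝ} {x x' : M} {h : M → M} :
    IsPPQI n m R lam x x' h ↔ h x = x' ∧ ∃ e : OpenPartialHomeomorph M M,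
      ContMDiffOn (𝓡 n) (𝓡 n) ((m + 1 : ℕ) : ℕ∞) e e.source ∧
      ContMDiffOn (𝓡 n) (𝓡 n) ((m + 1 : ℕ) : ℕ∞) e.symm e.target ∧
      closedBall x R ⊆ e.source ∧ EqOn h e (closedBall x R) ∧
      ∃ W : Set ((RiemSpace.of n M).iter m).M, IsOpen W ∧ iterBall n m x R ⊆ W ∧
        (∀ ξ ∈ W, (RiemSpace.of n M).base m ξ ∈ e.source) ∧
        ((RiemSpace.of n M).iter m).QIOn lam ((RiemSpace.of n M).iterMap e m) W := Iff.rfl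

/-- The open set one order lower is the preimage under the zero section; it contains the required
ball since the zero section does not increase distances. -/
theorem IsPPQI.of_succ {m : ℕ} {R lam : ℝ} {x x' : M} {h : M → M}
    (H : IsPPQI n (m + 1) R lam x x' h) : IsPPQI n m R lam x x' h := by
  rw [isPPQI_iff] at H ⊢
  obtain ⟨h0, e, he, he', hs, hE, W, hW, hbW, hWs, hq⟩ := H
  refine ⟨h0, e, he.of_le (by norm_cast; omega), he'.of_le (by norm_cast; omega), hs, hE,
    ((RiemSpace.of n M).iter m).zero ⁻¹' W, hW.preimage (contMDiff_zero (k := 0) (by simp)).continuous,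
    fun ξ hξ => hbW ((rdist_zero_le (A := (RiemSpace.of n M).iter m) _ _).trans hξ),
    fun ξ hξ => hWs _ hξ, ?_⟩
  exact QIOn.of_iterMap_succ (A := RiemSpace.of n M) e.open_source he (by omega) hWs hq

theorem IsPPQI.of_le {m m' : ℕ} (hm : m ≤ m') {R lam : ℝ} {x x' : M} {h : M → M}
    (H : IsPPQI n m' R lam x x' h) : IsPPQI n m R lam x x' h := by
  induction m', hm using Nat.le_induction with
  | base => exact H
  | succ k _ ih => exact ih H.of_succ

theorem IsPPQI.mono {m : ℕ} {R lam lam' : ℝ} (h0 : 0 < lam) (hl : lam ≤ lam') {x x' : M}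
    {h : M → M} (H : IsPPQI n m R lam x x' h) : IsPPQI n m R lam' x x' h := by
  rw [isPPQI_iff] at H ⊢
  obtain ⟨h0, e, he, he', hs, hE, W, hW, hbW, hWs, hq⟩ := H
  exact ⟨h0, e, he, he', hs, hE, W, hW, hbW, hWs, hq.mono ‹_› hl⟩

theorem isPPQI_id (m : ℕ) (R : ℝ) {lam : ℝ} (hl : 1 ≤ lam) (x : M) :
    IsPPQI n m R lam x x id := by
  refine IsPPQI.mono one_pos hl ?_
  rw [isPPQI_iff]
  refine ⟨rfl, OpenPartialHomeomorph.refl M, contMDiffOn_id, contMDiffOn_id, subset_univ _,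
    fun _ _ => rfl, univ, isOpen_univ, subset_univ _, fun _ _ => mem_univ _, fun ξ _ w => ?_⟩
  have h1 : (RiemSpace.of n M).iterMap (OpenPartialHomeomorph.refl M) m = id :=
    iterMap_id (A := RiemSpace.of n M) m
  rw [h1, mfderiv_id]
  simp

/-- The zeroth order information contained in a pointed partial quasi-isometry. -/
theorem IsPPQI.exists_zero {m : ℕ} {R lam : ℝ} {x x' : M} {h : M → M}
    [IsRiemannianManifold (𝓡 n) M] (H : IsPPQI n m R lam x x' h) :
    h x = x' ∧ ∃ e : OpenPartialHomeomorph M M,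
      ContMDiffOn (𝓡 n) (𝓡 n) 1 e e.source ∧ ContMDiffOn (𝓡 n) (𝓡 n) 1 e.symm e.target ∧
      EqOn h e (closedBall x R) ∧
      ∃ W : Set M, IsOpen W ∧ closedBall x R ⊆ W ∧ W ⊆ e.source ∧
        (RiemSpace.of n M).QIOn lam e W := by
  obtain ⟨h0, e, he, he', hs, hE, W, hW, hbW, hWs, hq⟩ := isPPQI_iff.1 (H.of_le (Nat.zero_le m))
  refine ⟨h0, e, he, he', hE, W, hW, fun y hy => hbW ?_, hWs, hq⟩
  rw [mem_closedBall, dist_comm] at hy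
  refine (rdist_of x y).trans_le ?_
  rw [edist_dist]
  exact ENNReal.ofReal_le_ofReal hy

theorem IsPPQI.continuousOn {m : ℕ} {R lam : ℝ} {x x' : M} {h : M → M}
    [IsRiemannianManifold (𝓡 n) M] (H : IsPPQI n m R lam x x' h) :
    ContinuousOn h (closedBall x R) := by
  obtain ⟨-, e, -, -, hE, W, -, hbW, hWs, -⟩ := H.exists_zero
  exact (e.continuousOn.mono (hbW.trans hWs)).congr hE

theorem IsPPQI.injOn {m : ℕ} {R lam : ℝ} {x x' : M} {h : M → M}
    [IsRiemannianManifold (𝓡 n) M] (H : IsPPQI n m R lam x x' h) :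
    InjOn h (closedBall x R) := by
  obtain ⟨-, e, -, -, hE, W, -, hbW, hWs, -⟩ := H.exists_zero
  exact (e.injOn.mono (hbW.trans hWs)).congr hE.symm

/-- The bound on `dist x a + dist a b` keeps nearly minimal paths from `a` to `b` inside the ball,
where the derivative is controlled. -/
theorem IsPPQI.dist_le_of_add_lt {m : ℕ} {R lam : ℝ} {x x' : M} {h : M → M}
    [IsRiemannianManifold (𝓡 n) M] (H : IsPPQI n m R lam x x' h) (hl : 0 ≤ lam) {a b : M}
    (hab : dist x a + dist a b < R) : dist (h a) (h b) ≤ lam * dist a b := by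
  obtain ⟨-, e, he, -, hE, W, hW, hbW, hWs, hq⟩ := H.exists_zero
  have ha : a ∈ closedBall x R := by
    rw [mem_closedBall, dist_comm]; linarith [dist_nonneg (x := a) (y := b)]
  have hb : b ∈ closedBall x R := by
    rw [mem_closedBall, dist_comm]; linarith [dist_triangle x a b]
  have h1 := rdist_map_le_of_add_lt (A := RiemSpace.of n M) (B := RiemSpace.of n M) (f := e)
    (x := x) (a := a) (b := b) (R := ENNReal.ofReal R) hW (he.mono hWs) hl
    (fun ξ hξ w => (hq ξ hξ w).2) (fun y hy => hbW ?_) ?_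
  · rw [rdist_of, rdist_of, edist_dist, edist_dist, ← ENNReal.ofReal_mul hl,
      ENNReal.ofReal_le_ofReal_iff (by positivity)] at h1
    rwa [hE ha, hE hb]
  · change M at y
    have h2 : edist x y ≤ ENNReal.ofReal R := (rdist_of x y).symm.trans_le hy
    rw [edist_dist, ENNReal.ofReal_le_ofReal_iff (by
      have := dist_nonneg (x := x) (y := a); have := dist_nonneg (x := a) (y := b); linarith)] at h2
    rwa [mem_closedBall, dist_comm]
  · rw [rdist_of, rdist_of, edist_dist, edist_dist, ← ENNReal.ofReal_add dist_nonneg dist_nonneg]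
    exact (ENNReal.ofReal_lt_ofReal_iff (by
      have := dist_nonneg (x := x) (y := a); have := dist_nonneg (x := a) (y := b); linarith)).2 hab

theorem exists_path_of_dist_lt [IsRiemannianManifold (𝓡 n) M] {x y : M} {l : ℝ}
    (h : dist x y < l) : ∃ γ : ℝ → M, γ 0 = x ∧ γ 1 = y ∧
      ContMDiffOn 𝓘(ℝ, ℝ) (𝓡 n) 1 γ (Icc 0 1) ∧
      (RiemSpace.of n M).plen γ 0 1 < ENNReal.ofReal l := by
  refine exists_path_of_rdist_lt (A := RiemSpace.of n M) ((rdist_of x y).trans_lt ?_)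
  rw [edist_dist]
  exact (ENNReal.ofReal_lt_ofReal_iff (lt_of_le_of_lt dist_nonneg h)).2 h

theorem edist_le_plen [IsRiemannianManifold (𝓡 n) M] {γ : ℝ → M} {a b : ℝ}
    (hγ : ContMDiffOn 𝓘(ℝ, ℝ) (𝓡 n) 1 γ (Icc a b)) (hab : a ≤ b) :
    edist (γ a) (γ b) ≤ (RiemSpace.of n M).plen γ a b :=
  (rdist_of (γ a) (γ b)).symm.trans_le (rdist_le_plen (A := RiemSpace.of n M) hγ hab)

/-- The substitute for a point on a minimal geodesic: cut a nearly minimal path at a suitable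
distance from `x`. -/
theorem exists_dist_lt_dist_lt (n : ℕ) {M : Type*} [MetricSpace M]
    [ChartedSpace (EuclideanSpace ℝ (Fin n)) M]
    [IsManifold (𝓡 n) ∞ M] [RiemannianBundle (fun x : M => TangentSpace (𝓡 n) x)]
    [IsRiemannianManifold (𝓡 n) M] {x y : M} {α β : ℝ} (hα : 0 < α)
    (hβ : 0 < β) (h : dist x y < α + β) : ∃ z : M, dist x z < α ∧ dist z y < β := by
  rcases lt_or_ge (dist x y) α with h1 | h1
  · exact ⟨y, h1, by simpa using hβ⟩
  obtain ⟨γ, h0, h1', hγ, hl⟩ := exists_path_of_dist_lt (n := n) h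
  have hfin : (RiemSpace.of n M).plen γ 0 1 ≠ ⊤ := ne_top_of_lt hl
  rw [← ENNReal.ofReal_toReal hfin, ENNReal.ofReal_lt_ofReal_iff (by positivity)] at hl
  set l := ((RiemSpace.of n M).plen γ 0 1).toReal with hldef
  -- With α' > l - β, a point of the path at distance α' from `x` is at distance less than β from
  -- `y`.
  obtain ⟨α', ha1, ha2⟩ := exists_between (max_lt hα (show l - β < α by linarith))
  have hcont : ContinuousOn (fun t => dist x (γ t)) (Icc 0 1) :=
    (continuous_const.dist continuous_id).comp_continuousOn hγ.continuousOn
  obtain ⟨t, ht, hta⟩ : α' ∈ (fun t => dist x (γ t)) '' Icc 0 1 := by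
    refine intermediate_value_Icc zero_le_one hcont ⟨?_, ?_⟩
    · simpa [h0] using (le_max_left _ _).trans ha1.le
    · simpa [h1'] using ha2.le.trans h1
  refine ⟨γ t, by simpa [hta] using ha2, ?_⟩
  have e1 := edist_le_plen (n := n) (hγ.mono (Icc_subset_Icc_right ht.2)) ht.1
  have e2 := edist_le_plen (n := n) (hγ.mono (Icc_subset_Icc_left ht.1)) ht.2
  have e3 : edist (γ 0) (γ t) + edist (γ t) (γ 1) ≤ ENNReal.ofReal l := by
    rw [ENNReal.ofReal_toReal hfin, ← plen_add (A := RiemSpace.of n M) γ ht.1 ht.2]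
    exact add_le_add e1 e2
  rw [edist_dist, edist_dist, ← ENNReal.ofReal_add dist_nonneg dist_nonneg,
    ENNReal.ofReal_le_ofReal_iff ENNReal.toReal_nonneg, h0, h1'] at e3
  dsimp only at hta
  have := le_max_right 0 (l - β)
  linarith

/-- Absolute continuity of the integral of the speed. -/
theorem tendsto_plen {A : RiemSpace} {γ : ℝ → A.M} (hfin : A.plen γ 0 1 ≠ ⊤) {t₀ : ℝ} (h0 : 0 < t₀)
    (h1 : t₀ ≤ 1) : Tendsto (fun t => A.plen γ t t₀) (𝓝[<] t₀) (𝓝 0) := by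
  let := A.bundle
  unfold plen at hfin ⊢
  simp only [pathELength_eq_lintegral_mfderiv_Icc] at hfin ⊢
  have h2 : Tendsto (MeasureTheory.volume.restrict (Icc (0 : ℝ) 1) ∘ fun t => Icc t t₀)
      (𝓝[<] t₀) (𝓝 0) := by
    have h3 : Tendsto (fun t : ℝ => ENNReal.ofReal (t₀ - t)) (𝓝[<] t₀) (𝓝 0) := by
      have : Continuous fun t : ℝ => ENNReal.ofReal (t₀ - t) :=
        ENNReal.continuous_ofReal.comp (by fun_prop)
      simpa using (this.tendsto t₀).mono_left (nhdsWithin_le_nhds (s := Iio t₀))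
    refine tendsto_of_tendsto_of_tendsto_of_le_of_le tendsto_const_nhds h3 (fun _ => zero_le)
      fun t => ?_
    rw [← Real.volume_Icc]
    exact MeasureTheory.Measure.restrict_apply_le _ _
  refine (MeasureTheory.tendsto_setLIntegral_zero hfin h2).congr' ?_
  filter_upwards [Ioo_mem_nhdsLT h0] with t ht
  rw [MeasureTheory.Measure.restrict_restrict measurableSet_Icc,
    inter_eq_left.2 (Icc_subset_Icc ht.1.le h1)]

/-- Points close to the image of an interior point of the domain of a pointed partial quasi-isometry
are themselves in the image. -/
theorem IsPPQI.exists_lift {m : ℕ} {R lam : ℝ} {x x' : M} {h : M → M} [CompleteSpace M]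
    [IsRiemannianManifold (𝓡 n) M] (H : IsPPQI n m R lam x x' h) (hl : 0 < lam) {a y : M} {s : ℝ}
    (ha : dist x a + lam * s ≤ R) (hy : dist (h a) y < s) :
    ∃ c, dist a c < lam * s ∧ h c = y := by
  obtain ⟨-, e, he, he', hE, W, hW, hbW, hWs, hq⟩ := H.exists_zero
  have hs : 0 < s := lt_of_le_of_lt dist_nonneg hy
  have hls : 0 < lam * s := by positivity
  have hbs : ball x R ⊆ W := ball_subset_closedBall.trans hbW
  have haR : a ∈ ball x R := by rw [mem_ball, dist_comm]; linarith
  set U := e '' ball x R with hU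
  have hUo : IsOpen U := e.isOpen_image_of_subset_source isOpen_ball (hbs.trans hWs)
  have hUt : U ⊆ e.target := by
    rintro _ ⟨z, hz, rfl⟩; exact e.map_source (hWs (hbs hz))
  have hUl : ∀ z ∈ U, e.symm z ∈ ball x R ∧ e (e.symm z) = z := by
    rintro _ ⟨z, hz, rfl⟩
    rw [e.left_inv (hWs (hbs hz))]; exact ⟨hz, rfl⟩
  have hea : h a = e a := hE (ball_subset_closedBall haR)
  have heaU : e a ∈ U := ⟨a, haR, rfl⟩
  have hsymm : e.symm (e a) = a := e.left_inv (hWs (hbs haR))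
  -- The lower bound for the derivative of `e` is an upper bound for that of its inverse, so a path
  -- in `U` lifts with length multiplied by at most `lam`.
  have hbound : ∀ ξ ∈ U, ∀ w : TangentSpace (𝓡 n) ξ, (RiemSpace.of n M).tnorm (e.symm ξ)
      (mfderiv (𝓡 n) (𝓡 n) e.symm ξ w) ≤ lam * (RiemSpace.of n M).tnorm ξ w := by
    rintro _ ⟨z, hz, rfl⟩ w
    have hz1 := hWs (hbs hz)
    have d1 : MDifferentiableAt (𝓡 n) (𝓡 n) e z :=
      (he.contMDiffAt (e.open_source.mem_nhds hz1)).mdifferentiableAt one_ne_zero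
    have d2 : MDifferentiableAt (𝓡 n) (𝓡 n) e.symm (e z) :=
      (he'.contMDiffAt (e.open_target.mem_nhds (e.map_source hz1))).mdifferentiableAt one_ne_zero
    have h3 : e ∘ e.symm =ᶠ[𝓝 (e z)] id := by
      filter_upwards [e.open_target.mem_nhds (e.map_source hz1)] with y hy using e.right_inv hy
    have hzz : e.symm (e z) = z := e.left_inv hz1
    have h4 : (mfderiv (𝓡 n) (𝓡 n) e (e.symm (e z))).comp (mfderiv (𝓡 n) (𝓡 n) e.symm (e z)) =
        ContinuousLinearMap.id ℝ (TangentSpace (𝓡 n) (e z)) := by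
      rw [← mfderiv_comp (e z) (by rwa [hzz]) d2, h3.mfderiv_eq, mfderiv_id]
    have h5 := (hq (e.symm (e z)) (by rw [hzz]; exact hbs hz)
      (mfderiv (𝓡 n) (𝓡 n) e.symm (e z) w)).1
    have h6 : mfderiv (𝓡 n) (𝓡 n) e (e.symm (e z)) (mfderiv (𝓡 n) (𝓡 n) e.symm (e z) w) = w :=
      congr($h4 w)
    change lam⁻¹ * (RiemSpace.of n M).tnorm (e.symm (e z)) (mfderiv (𝓡 n) (𝓡 n) e.symm (e z) w) ≤
      (RiemSpace.of n M).tnorm (e (e.symm (e z)))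
        (mfderiv (𝓡 n) (𝓡 n) e (e.symm (e z)) (mfderiv (𝓡 n) (𝓡 n) e.symm (e z) w)) at h5
    rw [h6, inv_mul_le_iff₀ hl] at h5
    refine h5.trans_eq ?_
    exact congrArg (lam * ·) (tnorm_congr (A := RiemSpace.of n M) (congrArg e hzz) w)
  obtain ⟨γ, h0, h1, hγ, hlen⟩ := exists_path_of_dist_lt (n := n) (hea ▸ hy)
  have hfin : (RiemSpace.of n M).plen γ 0 1 ≠ ⊤ := ne_top_of_lt hlen
  have hseg : ∀ u v : ℝ, 0 ≤ u → u ≤ v → v ≤ 1 → (∀ t ∈ Icc u v, γ t ∈ U) →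
      edist (e.symm (γ u)) (e.symm (γ v)) ≤
        ENNReal.ofReal lam * (RiemSpace.of n M).plen γ u v := by
    intro u v hu huv hv hUv
    have := rdist_map_le_plen (A := RiemSpace.of n M) (B := RiemSpace.of n M) (f := e.symm) hUo
      (he'.mono hUt) hl.le hbound huv (hγ.mono (Icc_subset_Icc hu hv)) hUv
    rwa [rdist_of] at this
  have hlt : ENNReal.ofReal lam * (RiemSpace.of n M).plen γ 0 1 < ENNReal.ofReal (lam * s) := by
    rw [ENNReal.ofReal_mul hl.le]
    exact ENNReal.mul_lt_mul_right (by simpa using hl) ENNReal.ofReal_ne_top hlen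
  have hstart : ∀ v : ℝ, 0 ≤ v → v ≤ 1 → (∀ t ∈ Icc 0 v, γ t ∈ U) →
      edist a (e.symm (γ v)) ≤ ENNReal.ofReal lam * (RiemSpace.of n M).plen γ 0 1 := by
    intro v hv hv1 hUv
    have := hseg 0 v le_rfl hv hv1 hUv
    rw [h0, hsymm] at this
    exact this.trans (by gcongr; exact plen_mono le_rfl hv1)
  suffices hall : ∀ t ∈ Icc (0 : ℝ) 1, γ t ∈ U by
    have hy1 : y ∈ U := h1 ▸ hall 1 ⟨zero_le_one, le_rfl⟩
    refine ⟨e.symm y, ?_, ?_⟩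
    · have := (hstart 1 zero_le_one le_rfl hall).trans_lt hlt
      rw [h1, edist_dist, ENNReal.ofReal_lt_ofReal_iff hls] at this
      exact this
    · rw [hE (ball_subset_closedBall (hUl y hy1).1), (hUl y hy1).2]
  -- If the path leaves the image `U` of the open ball, take its first exit time t₀ and lift the
  -- part before t₀.
  by_contra hcon
  push Not at hcon
  set T := Icc (0 : ℝ) 1 ∩ γ ⁻¹' Uᶜ with hT
  have hTc : IsCompact T := isCompact_Icc.of_isClosed_subset
    (hγ.continuousOn.preimage_isClosed_of_isClosed isClosed_Icc hUo.isClosed_compl)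
    inter_subset_left
  obtain ⟨t₀, ht₀, hmin⟩ := hTc.exists_isLeast (by
    obtain ⟨t, ht, htU⟩ := hcon; exact ⟨t, ht, htU⟩)
  have hpos : 0 < t₀ := by
    refine lt_of_le_of_ne ht₀.1.1 fun h => ht₀.2 ?_
    rw [← h, h0]; exact heaU
  have hbefore : ∀ t, 0 ≤ t → t < t₀ → γ t ∈ U := by
    intro t ht htt
    by_contra hh
    exact absurd (hmin ⟨⟨ht, htt.le.trans ht₀.1.2⟩, hh⟩) (not_le.2 htt)
  have hsmall : Tendsto (fun t => ENNReal.ofReal lam * (RiemSpace.of n M).plen γ t t₀)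
      (𝓝[<] t₀) (𝓝 0) := by
    rw [← mul_zero (ENNReal.ofReal lam)]
    refine ENNReal.Tendsto.const_mul ?_ (Or.inr ENNReal.ofReal_ne_top)
    exact tendsto_plen (A := RiemSpace.of n M) hfin hpos ht₀.1.2
  -- The lift has finite length, hence converges at t₀ by completeness.
  have hcauchy : Cauchy (map (fun t => e.symm (γ t)) (𝓝[<] t₀)) := by
    rw [EMetric.cauchy_iff]
    refine ⟨(Filter.NeBot.map (f := 𝓝[<] t₀) inferInstance _).ne, fun ε hε => ?_⟩
    have h3 := (hsmall.eventually_lt_const hε).and (Ioo_mem_nhdsLT hpos)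
    obtain ⟨t₁, hlt1, ht1⟩ := h3.exists
    refine ⟨_, image_mem_map (Ioo_mem_nhdsLT ht1.2), ?_⟩
    have key : ∀ u ∈ Ioo t₁ t₀, ∀ v ∈ Ioo t₁ t₀, u ≤ v →
        edist (e.symm (γ u)) (e.symm (γ v)) < ε := by
      intro u hu v hv huv
      refine (hseg u v (ht1.1.trans hu.1).le huv (hv.2.le.trans ht₀.1.2) fun t ht =>
        hbefore t ((ht1.1.trans hu.1).le.trans ht.1) (ht.2.trans_lt hv.2)).trans_lt
        (lt_of_le_of_lt ?_ hlt1)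
      gcongr
      exact plen_mono hu.1.le hv.2.le
    rintro _ ⟨u, hu, rfl⟩ _ ⟨v, hv, rfl⟩
    rcases le_total u v with huv | huv
    · exact key u hu v hv huv
    · rw [edist_comm]; exact key v hv u hu huv
  obtain ⟨c, hc⟩ := CompleteSpace.complete hcauchy
  change Tendsto (fun t => e.symm (γ t)) (𝓝[<] t₀) (𝓝 c) at hc
  have hIoo : Ioo 0 t₀ ∈ 𝓝[<] t₀ := Ioo_mem_nhdsLT hpos
  -- Since the length is strictly below `s`, the limit `c` is still in the open ball, and `e c = γ
  -- t₀` contradicts the exit from `U`.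
  have hac : edist a c < ENNReal.ofReal (lam * s) := by
    refine lt_of_le_of_lt (le_of_tendsto (tendsto_const_nhds.edist hc) ?_) hlt
    filter_upwards [hIoo] with t ht
    exact hstart t ht.1.le (ht.2.le.trans ht₀.1.2) fun u hu => hbefore u hu.1 (hu.2.trans_lt ht.2)
  rw [edist_dist, ENNReal.ofReal_lt_ofReal_iff hls] at hac
  have hcR : c ∈ ball x R := by
    rw [mem_ball, dist_comm]; linarith [dist_triangle x a c]
  have hlim1 : Tendsto (fun t => e (e.symm (γ t))) (𝓝[<] t₀) (𝓝 (e c)) :=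
    (e.continuousAt (hWs (hbs hcR))).tendsto.comp hc
  have hlim2 : Tendsto γ (𝓝[<] t₀) (𝓝 (γ t₀)) := by
    have := (hγ.continuousOn t₀ ht₀.1).mono_left
      (show 𝓝[Ioo 0 t₀] t₀ ≤ 𝓝[Icc 0 1] t₀ from
        nhdsWithin_mono _ fun t ht => ⟨ht.1.le, ht.2.le.trans ht₀.1.2⟩)
    rwa [nhdsWithin_Ioo_eq_nhdsLT hpos] at this
  have heq : e c = γ t₀ := by
    refine tendsto_nhds_unique (hlim1.congr' ?_) hlim2
    filter_upwards [hIoo] with t ht using (hUl _ (hbefore t ht.1.le ht.2)).2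
  exact ht₀.2 (heq ▸ ⟨c, hcR, rfl⟩)

/-- Unlike in `IsPPQI.dist_le_of_add_lt`, one of the points is the centre, and the other may lie on
the boundary sphere. -/
theorem IsPPQI.dist_le_mul {m : ℕ} {R lam : ℝ} {x x' : M} {h : M → M}
    [IsContMDiffRiemannianBundle (𝓡 n) ∞ (EuclideanSpace ℝ (Fin n))
      (fun x : M => TangentSpace (𝓡 n) x)]
    [IsRiemannianManifold (𝓡 n) M] (H : IsPPQI n m R lam x x' h) (hl : 0 ≤ lam) {y : M}
    (hy : dist x y ≤ R) : dist x' (h y) ≤ lam * dist x y := by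
  obtain ⟨h0, e, he, -, hE, W, hW, hbW, hWs, hq⟩ := H.exists_zero
  have : T2Space (RiemSpace.of n M).M := inferInstanceAs (T2Space M)
  have hR := dist_nonneg.trans hy
  have h1 := rdist_map_le_of_closedBall (A := RiemSpace.of n M) (B := RiemSpace.of n M) (f := e)
    (x := x) (y := y) (R := edist x y) (isSmooth_of n M) hW (he.mono hWs) hl
    (fun ξ hξ w => (hq ξ hξ w).2) (edist_ne_top _ _) (fun z hz => hbW ?_) (rdist_of x y).le
  · rw [rdist_of, edist_dist, edist_dist, ← ENNReal.ofReal_mul hl,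
      ENNReal.ofReal_le_ofReal_iff (by positivity)] at h1
    rwa [← h0, hE (mem_closedBall_self hR), hE (by rwa [mem_closedBall, dist_comm])]
  · change M at z
    have h2 : edist x z ≤ edist x y := (rdist_of x z).symm.trans_le hz
    rw [edist_dist, edist_dist, ENNReal.ofReal_le_ofReal_iff dist_nonneg] at h2
    rw [mem_closedBall, dist_comm]
    exact h2.trans hy

/-- If `h b` were too close to `h a`, it would lift to a point close to `a`, and by injectivity this
point is `b`. The lift requires room ρ around `a`, hence the minimum; `b` may be anywhere in the
ball. -/
theorem IsPPQI.min_le_mul_dist {m : ℕ} {R lam ρ : ℝ} {x x' : M} {h : M → M} [CompleteSpace M]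
    [IsRiemannianManifold (𝓡 n) M] (H : IsPPQI n m R lam x x' h) (hl : 0 < lam) {a b : M}
    (ha : dist x a + ρ ≤ R) (hb : dist x b ≤ R) :
    min ρ (dist a b) ≤ lam * dist (h a) (h b) := by
  by_contra hcon
  push Not at hcon
  obtain ⟨s, h1, h2⟩ := exists_between hcon
  have hs : dist (h a) (h b) < s / lam := by rwa [lt_div_iff₀ hl, mul_comm]
  have hls : lam * (s / lam) = s := by field_simp
  have hsρ := h2.trans_le (min_le_left _ _)
  obtain ⟨c, hc, hcb⟩ := H.exists_lift hl (a := a) (by rw [hls]; linarith) hs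
  rw [hls] at hc
  have hcR : c ∈ closedBall x R := by
    rw [mem_closedBall, dist_comm]; linarith [dist_triangle x a c]
  have hbR : b ∈ closedBall x R := by rwa [mem_closedBall, dist_comm]
  rw [H.injOn hcR hbR hcb] at hc
  exact absurd (hc.trans h2) (not_lt.2 (min_le_right _ _))

theorem _root_.RiemSpace.QIOn.congr {A : RiemSpace} {L : ℝ} {f g : A.M → A.M} {W O : Set A.M}
    (h : A.QIOn L f W) (hO : IsOpen O) (hWO : W ⊆ O) (hfg : EqOn f g O) : A.QIOn L g W := by
  intro ξ hξ w
  have h1 : g =ᶠ[𝓝 ξ] f := by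
    filter_upwards [hO.mem_nhds (hWO hξ)] with y hy using (hfg hy).symm
  have h2 := h ξ hξ w
  have h3 : A.tnorm (g ξ) (mfderiv A.I A.I g ξ w) = A.tnorm (f ξ) (mfderiv A.I A.I f ξ w) := by
    refine (tnorm_congr h1.eq_of_nhds _).trans ?_
    exact congrArg (A.tnorm (f ξ)) congr($(h1.mfderiv_eq) w)
  rwa [h3]

/-- The hypothesis `hR` makes the domains match in M. The same estimate must be repeated in T^(m)M,
where the distortion of the iterated tangent maps is measured. -/
theorem IsPPQI.comp {m m' : ℕ} {r R lam lam' : ℝ} {p x x' : M} {h h' : M → M}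
    [IsContMDiffRiemannianBundle (𝓡 n) ∞ (EuclideanSpace ℝ (Fin n))
      (fun x : M => TangentSpace (𝓡 n) x)]
    [IsRiemannianManifold (𝓡 n) M] (hr : 0 ≤ r) (H' : IsPPQI n m' R lam' p x' h')
    (H : IsPPQI n m r lam p x h) (hm : m ≤ m') (hl : 0 < lam) (hl' : 0 < lam')
    (hR : dist p x + lam * r ≤ R) :
    IsPPQI n m r (lam * lam') p (h' x) (h' ∘ h) ∧ MapsTo h (closedBall p r) (closedBall p R) := by
  have hmaps : MapsTo h (closedBall p r) (closedBall p R) := by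
    intro y hy
    rw [mem_closedBall, dist_comm] at hy ⊢
    have h1 := H.dist_le_mul hl.le hy
    have h2 : lam * dist p y ≤ lam * r := by gcongr
    linarith [dist_triangle p x (h y)]
  refine ⟨?_, hmaps⟩
  have H'm := H'.of_le hm
  rw [isPPQI_iff] at H H'm ⊢
  obtain ⟨h0, e, he, he', hs, hE, W, hW, hbW, hWs, hq⟩ := H
  obtain ⟨h0', f, hf, hf', hs', hE', V, hV, hbV, hVs, hq'⟩ := H'm
  have : T2Space (RiemSpace.of n M).M := inferInstanceAs (T2Space M)
  have hT2 := t2Space_iter (A := RiemSpace.of n M) m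
  have hem := contMDiffOn_iterMap (A := RiemSpace.of n M) e.open_source m (k := 1) he (by omega)
  have hfm := contMDiffOn_iterMap (A := RiemSpace.of n M) f.open_source m (k := 1) hf (by omega)
  have hso : IsOpen (e.source ∩ e ⁻¹' f.source) := e.isOpen_inter_preimage f.open_source
  have heW := hem.mono hWs
  have hfV := hfm.mono hVs
  have hVo : IsOpen (W ∩ (RiemSpace.of n M).iterMap e m ⁻¹' V) :=
    heW.continuousOn.isOpen_inter_preimage hW hV
  refine ⟨by rw [Function.comp_apply, h0], e.trans f, ?_, ?_, ?_, ?_,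
    W ∩ (RiemSpace.of n M).iterMap e m ⁻¹' V, hVo, ?_, ?_, ?_⟩
  · rw [OpenPartialHomeomorph.trans_source]
    exact hf.comp (he.mono inter_subset_left) fun y hy => hy.2
  · rw [OpenPartialHomeomorph.trans_target]
    exact he'.comp (hf'.mono inter_subset_left) fun y hy => hy.2
  · intro y hy
    rw [OpenPartialHomeomorph.trans_source]
    refine ⟨hs hy, ?_⟩
    change e y ∈ f.source
    rw [← hE hy]
    exact hs' (hmaps hy)
  · intro y hy
    have := hE' (hmaps hy)
    rw [Function.comp_apply, this, hE hy]; rfl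
  · intro ξ hξ
    refine ⟨hbW hξ, hbV ?_⟩
    -- The iterated tangent map carries the ball around the zero vector at `p` into the one of
    -- radius lam · r around the zero vector at `x`, and zero sections do not increase d(p,x).
    have h1 := rdist_map_le_of_closedBall (A := (RiemSpace.of n M).iter m)
      (B := (RiemSpace.of n M).iter m) (f := (RiemSpace.of n M).iterMap e m)
      ((isSmooth_of n M).iter m) hW heW hl.le (fun ξ hξ w => (hq ξ hξ w).2) ENNReal.ofReal_ne_top
      (fun ζ hζ => hbW hζ) hξ
    have h3 : (RiemSpace.of n M).iterMap e m ((RiemSpace.of n M).zeroSec m p) =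
        (RiemSpace.of n M).zeroSec m x :=
      (iterMap_zeroSec (A := RiemSpace.of n M) e m p).trans
        (congrArg _ ((hE (mem_closedBall_self hr)).symm.trans h0))
    replace h1 := (congrArg (fun y => ((RiemSpace.of n M).iter m).rdist y
      ((RiemSpace.of n M).iterMap e m ξ)) h3).symm.trans_le h1
    have h2 := (rdist_zeroSec_le (A := RiemSpace.of n M) m p x).trans_eq
      ((rdist_of p x).trans (edist_dist _ _))
    refine (rdist_triangle (A := (RiemSpace.of n M).iter m) _ _ _).trans
      ((add_le_add h2 h1).trans ?_)
    rw [← ENNReal.ofReal_mul hl.le, ← ENNReal.ofReal_add dist_nonneg (by positivity)]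
    exact ENNReal.ofReal_le_ofReal hR
  · intro ξ hξ
    rw [OpenPartialHomeomorph.trans_source]
    refine ⟨hWs _ hξ.1, ?_⟩
    have := hVs _ hξ.2
    exact mem_of_eq_of_mem (x := e ((RiemSpace.of n M).base m ξ)) (base_iterMap (A := RiemSpace.of n M) e m ξ).symm this
  · refine RiemSpace.QIOn.congr (O := (RiemSpace.of n M).base m ⁻¹' (e.source ∩ e ⁻¹' f.source))
      (QIOn.comp hq' hq hl' (fun ξ hξ => ?_) fun ξ hξ => ?_)
      (hso.preimage (continuous_base m)) (fun ξ hξ => ⟨hWs _ hξ.1, ?_⟩) fun ξ hξ => ?_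
    · exact (heW.contMDiffAt (hW.mem_nhds hξ)).mdifferentiableAt one_ne_zero
    · exact (hfV.contMDiffAt (hV.mem_nhds hξ)).mdifferentiableAt one_ne_zero
    · have := hVs _ hξ.2
      exact mem_of_eq_of_mem (x := e ((RiemSpace.of n M).base m ξ)) (base_iterMap (A := RiemSpace.of n M) e m ξ).symm this
    · exact (iterMap_comp (A := RiemSpace.of n M) hso f.open_source m (he.mono inter_subset_left)
        hf (fun y hy => hy.2) (by omega) hξ).symm

end PPQI

/-! ### Finite products of the distortion constants. -/

section LamProducts

variable {lam : ℕ → ℝ}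

theorem one_le_LamFin (h1 : ∀ i, 1 ≤ lam i) (i j : ℕ) : 1 ≤ LamFin lam i j := by
  unfold LamFin
  exact Finset.prod_induction _ (fun x => 1 ≤ x) (fun a b ha hb => by nlinarith) le_rfl
    fun k _ => h1 k

theorem one_le_LamInf (h1 : ∀ i, 1 ≤ lam i) (i : ℕ) : 1 ≤ LamInf lam i := by
  unfold LamInf
  by_cases h : Multipliable fun k => lam (i + k)
  · refine ge_of_tendsto' h.hasProd fun s => ?_
    exact Finset.prod_induction _ (fun x => 1 ≤ x) (fun a b ha hb => by nlinarith) le_rfl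
      fun k _ => h1 _
  · rw [tprod_eq_one_of_not_multipliable h]

theorem LamFin_self (i : ℕ) : LamFin lam i i = 1 := by simp [LamFin]

theorem LamFin_succ_left {i j : ℕ} (h : i < j) :
    LamFin lam i j = lam i * LamFin lam (i + 1) j := by
  unfold LamFin
  exact Finset.prod_eq_prod_Ico_succ_bot h _

theorem LamFin_succ_right {i j : ℕ} (h : i ≤ j) :
    LamFin lam i (j + 1) = LamFin lam i j * lam j := by
  unfold LamFin
  exact Finset.prod_Ico_succ_top h _

theorem LamFin_mul {i j k : ℕ} (h : i ≤ j) (h' : j ≤ k) :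
    LamFin lam i j * LamFin lam j k = LamFin lam i k := by
  unfold LamFin
  exact Finset.prod_Ico_consecutive _ h h'

/-- By induction, Λ_{i,j} ≤ λ_i λ_{i+1}² ≤ λ_i². All products are thereby controlled by λ_0 alone.
-/
theorem LamFin_le_sq (h1 : ∀ i, 1 ≤ lam i) (h2 : ∀ i, lam (i + 1) ^ 2 ≤ lam i) (i j : ℕ) :
    LamFin lam i j ≤ lam i ^ 2 := by
  rcases le_or_gt j i with h | h
  · rw [LamFin, Finset.Ico_eq_empty (by simpa using h), Finset.prod_empty]
    nlinarith [h1 i]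
  · obtain ⟨d, rfl⟩ := Nat.exists_eq_add_of_lt h
    induction d generalizing i with
    | zero =>
      rw [LamFin_succ_left (by omega), LamFin_self]
      nlinarith [h1 i]
    | succ d ih =>
      rw [LamFin_succ_left (by omega)]
      have := ih (i + 1) (by omega)
      rw [show i + 1 + d + 1 = i + (d + 1) + 1 by omega] at this
      nlinarith [h1 i, h2 i]

end LamProducts

/-! ### Consequences of admissibility, and the limit system of balls. -/

section Admissible

variable {n : ℕ} {M : Type*} [MetricSpace M] [ChartedSpace (EuclideanSpace ℝ (Fin n)) M]
  [IsManifold (𝓡 n) ∞ M] [RiemannianBundle (fun x : M => TangentSpace (𝓡 n) x)]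
  {p : M} {r s t lam : ℕ → ℝ}

theorem omegaSeq_nonneg (n : ℕ) [ChartedSpace (EuclideanSpace ℝ (Fin n)) M]
    [IsManifold (𝓡 n) ∞ M] [RiemannianBundle (fun x : M => TangentSpace (𝓡 n) x)]
    (p : M) (r lam : ℕ → ℝ) (i : ℕ) : 0 ≤ omegaSeq n p r lam i :=
  Real.sInf_nonneg fun _ h => h.1.le

theorem prev_nonneg {f : ℕ → ℝ} (hf : ∀ i, 0 ≤ f i) : ∀ i, 0 ≤ prev f i
  | 0 => le_rfl
  | i + 1 => hf i

namespace IsAdmissible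

variable (hA : IsAdmissible n p r s t lam)
include hA

theorem one_le_lam (i : ℕ) : 1 ≤ lam i := hA.lam_anti.le_of_tendsto hA.lam_lim i

theorem one_lt_lam (i : ℕ) : 1 < lam i := by
  have h1 := hA.one_le_lam (i + 1)
  nlinarith [hA.lam_sq i]

theorem lam_le (i : ℕ) : lam i ≤ lam 0 := hA.lam_anti (Nat.zero_le i)

theorem LamFin_le (i j : ℕ) : LamFin lam i j ≤ lam i ^ 2 :=
  LamFin_le_sq hA.one_le_lam (fun i => (hA.lam_sq i).le) i j

theorem lam_sq_le (i : ℕ) : lam i ^ 2 ≤ lam 0 ^ 2 := by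
  have := hA.one_le_lam i
  gcongr
  exact hA.lam_le i

theorem one_lt_r (i : ℕ) : 1 < r i := by
  refine lt_of_le_of_lt ?_ (hA.r_gt i)
  have h1 := hA.one_lt_lam 0
  have h2 : 1 ≤ lam 0 ^ 5 / (lam 0 - 1) := by
    rw [one_le_div (by linarith)]
    have := le_self_pow₀ h1.le (n := 5) (by norm_num)
    linarith
  have h3 := prev_nonneg (fun i => (hA.r_pos i).le) i
  have h4 := prev_nonneg (fun i => (hA.s_pos i).le) i
  have h5 := prev_nonneg (fun i => (hA.t_pos i).le) i
  have h6 := prev_nonneg (omegaSeq_nonneg n p r lam) i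
  nlinarith

theorem s_gt_r (i : ℕ) : 2 * lam 0 ^ 5 * (r i + prev s i) < s i := by
  refine lt_of_le_of_lt ?_ (hA.s_gt i)
  have h1 := omegaSeq_nonneg n p r lam i
  have h2 := hA.one_le_lam 0
  exact mul_le_mul_of_nonneg_left (by linarith) (by positivity)

theorem t_gt_r (i : ℕ) : lam 0 ^ 3 * (r i + 1) < t i := by
  refine lt_of_le_of_lt ?_ (hA.t_gt i)
  have h2 := hA.one_le_lam 0
  have h4 := prev_nonneg (fun i => (hA.s_pos i).le) i
  have h5 := prev_nonneg (fun i => (hA.t_pos i).le) i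
  have h6 := prev_nonneg (omegaSeq_nonneg n p r lam) i
  gcongr
  linarith

theorem add_le_t (i : ℕ) : lam 0 ^ 2 * r i + 1 ≤ t i := by
  have h1 := hA.t_gt_r i
  have h2 := hA.one_le_lam 0
  have h3 : lam 0 ^ 2 ≤ lam 0 ^ 3 := pow_le_pow_right₀ h2 (by norm_num)
  have h4 : 1 ≤ lam 0 ^ 3 := one_le_pow₀ h2
  nlinarith [hA.one_lt_r i]

/-- `lam_five` bounds the growth of r_i (λ_i⁵ - 1)/λ_i² at one step by 2^(2^(-(i+1))). The exponents
sum to 2^(-k) - 2^(-l) ≤ 1, so the total growth is at most a factor 2. -/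
theorem defect_le {k l : ℕ} (hkl : k ≤ l) :
    r l * (lam l ^ 5 - 1) / lam l ^ 2 ≤ 2 * (r k * (lam k ^ 5 - 1) / lam k ^ 2) := by
  have hpos : ∀ i, 0 < r i * (lam i ^ 5 - 1) / lam i ^ 2 := fun i => by
    have h1 := hA.one_lt_lam i
    have h2 := one_lt_pow₀ h1 (n := 5) (by norm_num)
    have h3 := hA.r_pos i
    have : 0 < lam i ^ 5 - 1 := by linarith
    positivity
  have key : r l * (lam l ^ 5 - 1) / lam l ^ 2 ≤
      (2 : ℝ) ^ ((2 : ℝ) ^ (-(k : ℝ)) - (2 : ℝ) ^ (-(l : ℝ))) *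
        (r k * (lam k ^ 5 - 1) / lam k ^ 2) := by
    induction l, hkl using Nat.le_induction with
    | base => simp
    | succ l hkl ih =>
      have h5 := hA.lam_five l
      rw [show r (l + 1) * (lam (l + 1) ^ 5 - 1) * lam l ^ 2 /
        (r l * (lam l ^ 5 - 1) * lam (l + 1) ^ 2) =
          (r (l + 1) * (lam (l + 1) ^ 5 - 1) / lam (l + 1) ^ 2) /
            (r l * (lam l ^ 5 - 1) / lam l ^ 2) by rw [div_div_div_eq]; ring_nf,
        div_lt_iff₀ (hpos l)] at h5
      refine h5.le.trans ((mul_le_mul_of_nonneg_left ih (by positivity)).trans_eq ?_)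
      rw [← mul_assoc, ← Real.rpow_add two_pos]
      congr 2
      have : (2 : ℝ) ^ (-(l : ℝ)) = 2 * (2 : ℝ) ^ (-((l : ℝ) + 1)) := by
        rw [neg_add, Real.rpow_add two_pos, Real.rpow_neg_one]; ring
      push_cast
      rw [this]; ring
  refine key.trans (mul_le_mul_of_nonneg_right ?_ (hpos k).le)
  have h1 : (2 : ℝ) ^ (-(k : ℝ)) ≤ 1 :=
    Real.rpow_le_one_of_one_le_of_nonpos one_le_two (by simp)
  have h2 : (0 : ℝ) < (2 : ℝ) ^ (-(l : ℝ)) := by positivity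
  calc (2 : ℝ) ^ ((2 : ℝ) ^ (-(k : ℝ)) - (2 : ℝ) ^ (-(l : ℝ))) ≤ (2 : ℝ) ^ (1 : ℝ) :=
        Real.rpow_le_rpow_of_exponent_le one_le_two (by linarith)
    _ = 2 := Real.rpow_one 2

/-- A ball of level l is enlarged to radius at most λ_l² r_l, whereas `net_far_or` provides only the
factor λ_l. The excess is bounded here by the radius of a lower level, so that s_k can absorb it. -/
theorem mul_lam_sub_one_le {k l : ℕ} (hkl : k ≤ l) :
    3 * (r l * (lam l ^ 2 - lam l)) ≤ 2 * (lam 0 ^ 3 * r k) := by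
  have h1 := hA.defect_le hkl
  have hl := hA.one_le_lam l
  have hk := hA.one_le_lam k
  have hrl := hA.r_pos l
  have hrk := hA.r_pos k
  have h2 : r k * (lam k ^ 5 - 1) / lam k ^ 2 ≤ lam 0 ^ 3 * r k := by
    rw [div_le_iff₀ (by positivity)]
    have h3 : lam k ^ 3 ≤ lam 0 ^ 3 := by gcongr; exact hA.lam_le k
    have h4 : lam k ^ 3 * lam k ^ 2 ≤ lam 0 ^ 3 * lam k ^ 2 := by gcongr
    have h5 : lam k ^ 3 * lam k ^ 2 = lam k ^ 5 := by ring
    nlinarith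
  have h6 : 3 * (r l * (lam l ^ 2 - lam l)) ≤ r l * (lam l ^ 5 - 1) / lam l ^ 2 := by
    rw [le_div_iff₀ (by positivity)]
    -- The product without `r l` equals λ⁵ - 1 - 3λ²(λ² - λ).
    have h7 : 0 ≤ r l * ((lam l - 1) * (lam l ^ 2 * (lam l - 1) ^ 2 + lam l + 1)) := by
      have : 0 ≤ lam l - 1 := by linarith
      positivity
    nlinarith
  linarith

end IsAdmissible

namespace NestedSystem

theorem _root_.IsPPQI.congr {m : ℕ} {R L : ℝ} {x x' : M} {h h' : M → M} (hR : 0 ≤ R)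
    (H : IsPPQI n m R L x x' h) (hh : EqOn h' h (closedBall x R)) : IsPPQI n m R L x x' h' := by
  obtain ⟨h0, e, he, he', hs, hE, hW⟩ := H
  exact ⟨(hh (mem_closedBall_self hR)).trans h0, e, he, he', hs, hh.trans hE, hW⟩

variable (hA : IsAdmissible n p r s t lam) (S : NestedSystem n p r s t lam)

/-- Finitely many points of the limit nets lie in the nets of one large index j, so questions about
the limit system reduce to a single stage. -/
theorem eventually_net {l : ℕ} {z : M} (hz : z ∈ S.limNet l) :
    ∀ᶠ j in atTop, l < j ∧ z ∈ S.net l j ∧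
      EqOn (S.limMap l z) (S.map l j z) (closedBall p (r l)) := by
  classical
  have hz' : ∃ j, l ≤ j ∧ z ∈ S.net l j := by
    simpa only [limNet, mem_iUnion, exists_prop] using hz
  have h1 : S.limMap l z = S.map l (Nat.find hz') z := by
    rw [limMap, dif_pos hz']
  filter_upwards [eventually_gt_atTop (Nat.find hz')] with j hj
  have h2 := Nat.find_spec hz'
  have h3 := S.net_mono l j (h2.1.trans_lt hj) l _ h2.1 (Or.inl ⟨hj, le_rfl⟩)
  exact ⟨h2.1.trans_lt hj, h3.1 h2.2, h1 ▸ (h3.2 z h2.2).symm⟩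

theorem mem_limNet {l j : ℕ} (h : l ≤ j) {z : M} (hz : z ∈ S.net l j) : z ∈ S.limNet l :=
  mem_iUnion₂.2 ⟨j, h, hz⟩

theorem limMap_eqOn {l j : ℕ} (h : l < j) {z : M} (hz : z ∈ S.net l j) :
    EqOn (S.limMap l z) (S.map l j z) (closedBall p (r l)) := by
  obtain ⟨k, hk, hjk⟩ := ((S.eventually_net (S.mem_limNet h.le hz)).and
    (eventually_gt_atTop j)).exists
  have h3 := (S.net_mono l k hk.1 l j h.le (Or.inl ⟨hjk, le_rfl⟩)).2 z hz
  exact hk.2.2.trans h3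

theorem base_mem_limNet (l : ℕ) : p ∈ S.limNet l := S.mem_limNet l.le_succ (S.base_mem l _ l.lt_succ_self)

theorem limMap_base (l : ℕ) : EqOn (S.limMap l p) id (closedBall p (r l)) :=
  (S.limMap_eqOn l.lt_succ_self (S.base_mem l _ l.lt_succ_self)).trans
    (S.map_base l _ l.lt_succ_self)

include hA in
theorem limMap_isPPQI {l : ℕ} {z : M} (hz : z ∈ S.limNet l) :
    IsPPQI n l (r l) (lam 0 ^ 2) p z (S.limMap l z) := by
  obtain ⟨j, hj, hzj, hE⟩ := (S.eventually_net hz).exists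
  refine ((S.isPPQI l j hj z hzj).congr (hA.r_pos l).le hE).mono ?_
    ((hA.LamFin_le l j).trans (hA.lam_sq_le l))
  linarith [one_le_LamFin hA.one_le_lam l j]

theorem dist_net_le {k l : ℕ} (hkl : k < l) {w : M} (hw : w ∈ S.net k l) : dist p w ≤ r l - t k := by
  rw [dist_comm]
  exact (S.net_subset k l hkl hw).2

/-- The cocycle rule of the limit system, the source of all invariance below. -/
theorem limMap_comp {k l : ℕ} (hkl : k < l) {w z : M} (hw : w ∈ S.net k l) (hz : z ∈ S.limNet l)
    (hwr : w ∈ closedBall p (r l)) :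
    S.limMap l z w ∈ S.limNet k ∧
    MapsTo (S.limMap k w) (closedBall p (r k)) (closedBall p (r l)) ∧
    EqOn (S.limMap k (S.limMap l z w)) (S.limMap l z ∘ S.limMap k w) (closedBall p (r k)) := by
  obtain ⟨j, hj, hzj, hE⟩ := (S.eventually_net hz).exists
  have ha : (l, z) ∈ pairs S.net k j := ⟨hkl, hj, hzj⟩
  have h1 : S.map l j z w ∈ S.net k j := by
    have := (S.net_inter k j (hkl.trans hj) _ ha).superset (mem_image_of_mem _ hw)
    exact this.1
  obtain ⟨h2, h3⟩ := S.map_comp k j (hkl.trans hj) _ ha _ h1 w hwr rfl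
  have h4 := S.limMap_eqOn hkl hw
  have h5 : MapsTo (S.limMap k w) (closedBall p (r k)) (closedBall p (r l)) := h2.congr h4.symm
  rw [hE hwr]
  refine ⟨S.mem_limNet (hkl.trans hj).le h1, h5, fun y hy => ?_⟩
  rw [S.limMap_eqOn (hkl.trans hj) h1 hy, h3 hy, Function.comp_apply, Function.comp_apply,
    hE (h5 hy), h4 hy]

variable [IsContMDiffRiemannianBundle (𝓡 n) ∞ (EuclideanSpace ℝ (Fin n))
    (fun x : M => TangentSpace (𝓡 n) x)] [IsRiemannianManifold (𝓡 n) M]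

include hA in
theorem dist_map_le {l j : ℕ} (hlj : l < j) {z : M} (hz : z ∈ S.net l j) {y : M}
    (hy : y ∈ closedBall p (r l)) : dist z (S.map l j z y) ≤ lam l ^ 2 * r l := by
  rw [mem_closedBall, dist_comm] at hy
  have h0 := one_le_LamFin hA.one_le_lam l j
  refine ((S.isPPQI l j hlj z hz).dist_le_mul (by linarith) hy).trans ?_
  have := hA.LamFin_le l j
  gcongr

include hA in
-- Centres of level l are at least s_l/λ_0 apart, which exceeds twice the radius λ_0² r_l by a
-- multiple of s_{l-1}; for l > 0 this leaves more than 1.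
theorem one_le_dist_of_ne {l : ℕ} (hl : 0 < l) {z z' : M} (hz : z ∈ S.limNet l)
    (hz' : z' ∈ S.limNet l) (hne : z ≠ z') {y y' : M} (hy : y ∈ closedBall p (r l))
    (hy' : y' ∈ closedBall p (r l)) : 1 ≤ dist (S.limMap l z y) (S.limMap l z' y') := by
  obtain ⟨j, ⟨hj, hzj, hE⟩, -, hzj', hE'⟩ :=
    ((S.eventually_net hz).and (S.eventually_net hz')).exists
  rw [hE hy, hE' hy']
  have h1 := S.dist_map_le hA hj hzj hy
  have h2 := S.dist_map_le hA hj hzj' hy'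
  have h3 := S.net_sep l j hj z hzj z' hzj' hne
  have h4 := hA.LamFin_le (l + 1) j
  have h5 := one_le_LamFin hA.one_le_lam (l + 1) j
  have h6 := hA.one_le_lam 0
  have h7 : s l / lam 0 ≤ s l / LamFin lam (l + 1) j := by
    have := hA.s_pos l
    gcongr
    exact h4.trans ((hA.lam_sq l).le.trans (hA.lam_le l))
  have h8 : 2 * lam 0 ^ 4 * (r l + prev s l) ≤ s l / lam 0 := by
    rw [le_div_iff₀ (by linarith)]
    nlinarith [hA.s_gt_r l]
  obtain ⟨k, rfl⟩ : ∃ k, l = k + 1 := ⟨l - 1, by omega⟩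
  have h9 : 2 ≤ s k := by
    have := hA.s_gt_r k
    have h10 := hA.one_lt_r k
    have h11 := prev_nonneg (fun i => (hA.s_pos i).le) k
    have h12 : 1 ≤ lam 0 ^ 5 := one_le_pow₀ h6
    nlinarith
  change 2 * lam 0 ^ 4 * (r (k + 1) + s k) ≤ _ at h8
  have h13 : lam 0 ^ 2 ≤ lam 0 ^ 4 := pow_le_pow_right₀ h6 (by norm_num)
  have h14 : 1 ≤ lam 0 ^ 4 := one_le_pow₀ h6
  have h15 := hA.lam_sq_le (k + 1)
  have h16 := hA.r_pos (k + 1)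
  have h17 : lam (k + 1) ^ 2 * r (k + 1) ≤ lam 0 ^ 4 * r (k + 1) := by gcongr; linarith
  have h18 := dist_triangle4 z (S.map (k + 1) j z y) (S.map (k + 1) j z' y') z'
  rw [dist_comm (S.map (k + 1) j z' y') z'] at h18
  nlinarith

include hA in
-- Balls of different levels are far apart or nested. If the centres are far apart, s_l pays for the
-- small ball and for the distortion of the large one, by `mul_lam_sub_one_le`.
theorem one_le_dist_or_exists {l l' : ℕ} (hl : 0 < l) (hll : l < l') {z z' : M}
    (hz : z ∈ S.limNet l) (hz' : z' ∈ S.limNet l') :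
    (∀ y ∈ closedBall p (r l), ∀ y' ∈ closedBall p (r l'),
      1 ≤ dist (S.limMap l z y) (S.limMap l' z' y')) ∨
    ∃ w ∈ S.net l l', S.limMap l' z' w = z := by
  obtain ⟨j, ⟨hj, hzj, hE⟩, hj', hzj', hE'⟩ :=
    ((S.eventually_net hz).and (S.eventually_net hz')).exists
  rcases S.net_far_or l j hj z hzj (l', z') ⟨hll, hj', hzj'⟩ with h | ⟨w, hw, hwz⟩
  · left
    intro y hy y' hy'
    rw [hE hy, hE' hy']
    have h1 := S.dist_map_le hA hj hzj hy
    have h2 := S.dist_map_le hA hj' hzj' hy'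
    have h3 := hA.mul_lam_sub_one_le hll.le
    have h4 := one_le_LamInf hA.one_le_lam j
    have h5 := hA.one_le_lam l'
    have h6 := hA.one_le_lam 0
    have h7 := hA.s_gt_r l
    obtain ⟨k, rfl⟩ : ∃ k, l = k + 1 := ⟨l - 1, by omega⟩
    have h9 : 2 ≤ s k := by
      have := hA.s_gt_r k
      have h10 := hA.one_lt_r k
      have h11 := prev_nonneg (fun i => (hA.s_pos i).le) k
      have h12 : 1 ≤ lam 0 ^ 5 := one_le_pow₀ h6
      nlinarith
    change 2 * lam 0 ^ 5 * (r (k + 1) + s k) < _ at h7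
    have h13 : lam 0 ^ 2 ≤ lam 0 ^ 5 := pow_le_pow_right₀ h6 (by norm_num)
    have h13' : lam 0 ^ 3 ≤ lam 0 ^ 5 := pow_le_pow_right₀ h6 (by norm_num)
    have h14 : 1 ≤ lam 0 ^ 5 := one_le_pow₀ h6
    have h15 := hA.lam_sq_le (k + 1)
    have h16 := hA.r_pos (k + 1)
    have h17 : lam (k + 1) ^ 2 * r (k + 1) ≤ lam 0 ^ 5 * r (k + 1) := by gcongr; linarith
    have h17' : lam 0 ^ 3 * r (k + 1) ≤ lam 0 ^ 5 * r (k + 1) := by gcongr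
    have h18 := dist_triangle4 z (S.map (k + 1) j z y) (S.map l' j z' y') z'
    rw [dist_comm (S.map l' j z' y') z'] at h18
    have h19 : lam l' * (r l' + s (k + 1)) ≤ lam l' * LamInf lam j * (r l' + s (k + 1)) := by
      have := hA.r_pos l'
      have := hA.s_pos (k + 1)
      gcongr
      nlinarith
    have h20 : s (k + 1) ≤ lam l' * s (k + 1) := le_mul_of_one_le_left (hA.s_pos _).le h5
    have h21 : s k ≤ lam 0 ^ 5 * s k := le_mul_of_one_le_left (hA.s_pos _).le h14
    dsimp only at h
    nlinarith
  · refine Or.inr ⟨w, hw, ?_⟩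
    rw [← hwz]
    refine hE' ?_
    have := (S.net_subset l l' hll hw).2
    have h2 := hA.t_pos l
    rw [mem_closedBall] at this ⊢
    linarith

end NestedSystem

end Admissible

/-! ### Maximal separated sets. -/

section MaximalSeparated

variable {X : Type*} [MetricSpace X] {ρ : ℝ} {A S : Set X}

theorem exists_maximal_isSep (hSA : S ⊆ A) (hS : IsSep ρ S) :
    ∃ Q, S ⊆ Q ∧ Maximal (fun Q => Q ⊆ A ∧ IsSep ρ Q) Q := by
  refine zorn_subset_nonempty {Q | Q ⊆ A ∧ IsSep ρ Q} (fun c hc hcc _ => ?_) S ⟨hSA, hS⟩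
  refine ⟨⋃₀ c, ⟨sUnion_subset fun Q hQ => (hc hQ).1, ?_⟩, fun Q hQ => subset_sUnion_of_mem hQ⟩
  rintro x ⟨Q, hQ, hx⟩ y ⟨Q', hQ', hy⟩ hne
  rcases hcc.total hQ hQ' with h | h
  · exact (hc hQ').2 x (h hx) y hy hne
  · exact (hc hQ).2 x hx y (h hy) hne

theorem exists_dist_lt_of_maximal_isSep (hρ : 0 < ρ) {Q : Set X}
    (hQ : Maximal (fun Q => Q ⊆ A ∧ IsSep ρ Q) Q) {a : X} (ha : a ∈ A) : ∃ q ∈ Q, dist a q < ρ := by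
  by_contra! h
  have h1 : a ∈ Q := by
    refine hQ.2 ⟨insert_subset ha hQ.1.1, ?_⟩ (subset_insert a Q) (mem_insert a Q)
    rintro x (rfl | hx) y (rfl | hy) hne
    · exact absurd rfl hne
    · exact h y hy
    · rw [dist_comm]; exact h x hx
    · exact hQ.1.2 x hx y hy hne
  have := h a h1
  rw [dist_self] at this
  linarith

theorem isSep_singleton (a : X) : IsSep ρ {a} := by
  rintro x rfl y rfl h
  exact absurd rfl h

end MaximalSeparated

/-! ### The invariant separated and relatively dense set. -/

section InvariantSet

variable {n : ℕ} {M : Type*} [MetricSpace M] [ChartedSpace (EuclideanSpace ℝ (Fin n)) M]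
  [IsManifold (𝓡 n) ∞ M] [RiemannianBundle (fun x : M => TangentSpace (𝓡 n) x)]
  {p : M} {r s t lam : ℕ → ℝ}

namespace NestedSystem

variable (hA : IsAdmissible n p r s t lam) (S : NestedSystem n p r s t lam)

/-- The points of `D(p, r_l)` at distance at least `ρ` from the boundary and from the balls
`h_{k,w}(D(p, r_k))` with `0 < k < l`. -/
def region (ρ : ℝ) (l : ℕ) : Set M :=
  {y | dist p y ≤ r l - ρ ∧ ∀ k, 0 < k → k < l → ∀ w ∈ S.net k l, ∀ u ∈ closedBall p (r k),
    ρ ≤ dist y (S.limMap k w u)}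

/-- The union of the translates of sets `Y l ⊆ D(p, r_l)`. -/
def translates (Y : ℕ → Set M) : Set M :=
  {x | ∃ l, 0 < l ∧ ∃ z ∈ S.limNet l, ∃ y ∈ Y l, x = S.limMap l z y}

/-- The part of the union of the translates that lies in `D(p, r_l)`. -/
def localTranslates (Y : ℕ → Set M) (l : ℕ) : Set M :=
  Y l ∪ {x | ∃ k, 0 < k ∧ k < l ∧ ∃ w ∈ S.net k l, ∃ y ∈ Y k, x = S.limMap k w y}

theorem exists_region_maximal {ρ : ℝ} (h1 : ρ ≤ r 1) : ∃ Y : ℕ → Set M, p ∈ Y 1 ∧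
    ∀ l, Maximal (fun Q => Q ⊆ S.region ρ l ∧ IsSep ρ Q) (Y l) := by
  have h : ∀ l, ∃ Q, {p} ∩ S.region ρ l ⊆ Q ∧
      Maximal (fun Q => Q ⊆ S.region ρ l ∧ IsSep ρ Q) Q := fun l =>
    exists_maximal_isSep inter_subset_right fun x hx y hy =>
      isSep_singleton p x hx.1 y hy.1
  choose Y hY hYm using h
  -- No level lies strictly between 0 and 1, so `p` belongs to the region at level 1 and was forced
  -- into `Y 1`.
  refine ⟨Y, hY 1 ⟨rfl, by simpa using h1, fun k hk hk' => ?_⟩, hYm⟩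
  omega

variable {S} {ρ : ℝ} {Y : ℕ → Set M}

theorem mem_closedBall_of_mem_region (hρ : 0 ≤ ρ) {l : ℕ} {y : M} (hy : y ∈ S.region ρ l) :
    y ∈ closedBall p (r l) := by
  rw [mem_closedBall, dist_comm]; linarith [hy.1]

include hA in
theorem net_subset_closedBall {k l : ℕ} (hkl : k < l) : S.net k l ⊆ closedBall p (r l) := by
  intro w hw
  have h1 := S.dist_net_le hkl hw
  have h2 := hA.t_pos k
  rw [mem_closedBall, dist_comm]; linarith

include hA in
theorem image_localTranslates_subset (hρ : 0 ≤ ρ) (hY : ∀ l, Y l ⊆ S.region ρ l) {l : ℕ}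
    (hl : 0 < l) {z : M} (hz : z ∈ S.limNet l) :
    S.limMap l z '' S.localTranslates Y l ⊆ S.translates Y := by
  rintro _ ⟨_, hy | ⟨k, hk, hkl, w, hw, y, hy, rfl⟩, rfl⟩
  · exact ⟨l, hl, z, hz, _, hy, rfl⟩
  · obtain ⟨h1, h2, h3⟩ := S.limMap_comp hkl hw hz (net_subset_closedBall hA hkl hw)
    exact ⟨k, hk, _, h1, y, hy, (h3 (mem_closedBall_of_mem_region hρ (hY k hy))).symm⟩

include hA in
theorem localTranslates_subset_closedBall (hρ : 0 ≤ ρ) (hY : ∀ l, Y l ⊆ S.region ρ l) (l : ℕ) :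
    S.localTranslates Y l ⊆ closedBall p (r l) := by
  rintro _ (hy | ⟨k, hk, hkl, w, hw, y, hy, rfl⟩)
  · exact mem_closedBall_of_mem_region hρ (hY l hy)
  · exact (S.limMap_comp hkl hw (S.base_mem_limNet l) (net_subset_closedBall hA hkl hw)).2.1
      (mem_closedBall_of_mem_region hρ (hY k hy))

variable [IsContMDiffRiemannianBundle (𝓡 n) ∞ (EuclideanSpace ℝ (Fin n))
    (fun x : M => TangentSpace (𝓡 n) x)] [IsRiemannianManifold (𝓡 n) M]

include hA in
-- By the dichotomy, a piece of level k meeting the ball is nested in it if k < l and belongs to the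
-- same centre if k = l. The case k > l is impossible because `Y k` avoids the balls of level l.
theorem translates_inter_subset (hρ : 0 < ρ) (hY : ∀ l, Y l ⊆ S.region ρ l) {l : ℕ}
    (hl : 0 < l) {z : M} (hz : z ∈ S.limNet l) :
    S.translates Y ∩ S.limMap l z '' closedBall p (r l) ⊆
      S.limMap l z '' S.localTranslates Y l := by
  rintro _ ⟨⟨k, hk, w, hw, y, hy, rfl⟩, y', hy', he⟩
  have hyb := mem_closedBall_of_mem_region hρ.le (hY k hy)
  rcases lt_trichotomy k l with hkl | rfl | hkl
  · rcases S.one_le_dist_or_exists hA hk hkl hw hz with h | ⟨v, hv, rfl⟩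
    · have := h y hyb y' hy'
      rw [he, dist_self] at this
      linarith
    · obtain ⟨h1, h2, h3⟩ := S.limMap_comp hkl hv hz (net_subset_closedBall hA hkl hv)
      exact ⟨S.limMap k v y, Or.inr ⟨k, hk, hkl, v, hv, y, hy, rfl⟩, (h3 hyb).symm⟩
  · rcases eq_or_ne w z with rfl | hne
    · exact ⟨y, Or.inl hy, rfl⟩
    · have := S.one_le_dist_of_ne hA hk hw hz hne hyb hy'
      rw [he, dist_self] at this
      linarith
  · rcases S.one_le_dist_or_exists hA hl hkl hz hw with h | ⟨v, hv, rfl⟩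
    · have := h y' hy' y hyb
      rw [he, dist_self] at this
      linarith
    · obtain ⟨h1, h2, h3⟩ := S.limMap_comp hkl hv hw (net_subset_closedBall hA hkl hv)
      have h4 : S.limMap l v y' = y := by
        refine (S.limMap_isPPQI hA hw).injOn (h2 hy') hyb ?_
        rw [← he, h3 hy', Function.comp_apply]
      have h5 := (hY k hy).2 l hl hkl v hv y' hy'
      rw [h4, dist_self] at h5
      linarith

include hA in
-- For z = p the map is the identity, so the local pattern `localTranslates` is the trace of X on
-- D(p, r_l); each h_{l,z} transports this pattern.
theorem translates_inter_eq (hρ : 0 < ρ) (hY : ∀ l, Y l ⊆ S.region ρ l) {l : ℕ}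
    (hl : 0 < l) {z : M} (hz : z ∈ S.limNet l) :
    S.translates Y ∩ S.limMap l z '' closedBall p (r l) =
      S.limMap l z '' (S.translates Y ∩ closedBall p (r l)) := by
  have hsub := localTranslates_subset_closedBall (S := S) hA hρ.le hY l
  have himg : ∀ A ⊆ closedBall p (r l), S.limMap l p '' A = A := fun A hAb => by
    rw [((S.limMap_base l).mono hAb).image_eq, image_id]
  have h2 : S.translates Y ∩ closedBall p (r l) = S.localTranslates Y l := by
    refine Subset.antisymm ?_ (subset_inter ?_ hsub)
    · have := translates_inter_subset hA hρ hY hl (S.base_mem_limNet l)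
      rwa [himg _ Subset.rfl, himg _ hsub] at this
    · have := image_localTranslates_subset hA hρ.le hY hl (S.base_mem_limNet l)
      rwa [himg _ hsub] at this
  rw [h2]
  exact Subset.antisymm (translates_inter_subset hA hρ hY hl hz)
    (subset_inter (image_localTranslates_subset hA hρ.le hY hl hz) (image_mono hsub))

include hA in
-- The margin t_k exceeds λ_0² r_k by 1: smaller balls keep distance 1 from the boundary of the
-- larger one.
theorem dist_limMap_add_one_le {k l : ℕ} (hkl : k < l) {w u : M} (hw : w ∈ S.net k l)
    (hu : u ∈ closedBall p (r k)) : dist p (S.limMap k w u) + 1 ≤ r l := by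
  have h1 := S.dist_net_le hkl hw
  rw [mem_closedBall, dist_comm] at hu
  have h2 := (S.limMap_isPPQI hA (S.mem_limNet hkl.le hw)).dist_le_mul (sq_nonneg _) hu
  have h3 : lam 0 ^ 2 * dist p u ≤ lam 0 ^ 2 * r k := by gcongr
  linarith [hA.add_le_t k, dist_triangle p w (S.limMap k w u)]

omit [IsContMDiffRiemannianBundle (𝓡 n) ∞ (EuclideanSpace ℝ (Fin n))
    (fun x : M => TangentSpace (𝓡 n) x)] in
include hA in
/-- Points far away from the smaller balls are close to the union of the translates. -/
theorem exists_translates_near (hρ : 0 < ρ) 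
    (hY : ∀ l, Maximal (fun Q => Q ⊆ S.region ρ l ∧ IsSep ρ Q) (Y l))
    {l : ℕ} (hl : 0 < l) (hρr : ρ < r l) {z y : M} (hz : z ∈ S.limNet l)
    (hy : y ∈ closedBall p (r l))
    (hfar : ∀ k, 0 < k → k < l → ∀ w ∈ S.net k l, ∀ u ∈ closedBall p (r k),
      3 * ρ ≤ dist y (S.limMap k w u)) :
    ∃ x ∈ S.translates Y, dist (S.limMap l z y) x ≤ ρ + 2 * (lam 0 ^ 2 * ρ) := by
  have H := S.limMap_isPPQI hA hz
  have hL : 0 < lam 0 ^ 2 := by have := hA.one_le_lam 0; positivity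
  -- At a boundary point `y` the Lipschitz estimate is not available; continuity is used to move
  -- slightly inwards to `y'`. A second move, of length less than ρ, gives `y₁`.
  obtain ⟨δ, hδ, hcont⟩ := Metric.continuousOn_iff.1 H.continuousOn y hy ρ hρ
  rw [mem_closedBall, dist_comm] at hy
  obtain ⟨y', hyy', hy'⟩ := exists_dist_lt_dist_lt n (x := y) (y := p) (lt_min hδ hρ) (hA.r_pos l)
    (by rw [dist_comm]; linarith [lt_min hδ hρ])
  obtain ⟨y₁, hy₁, hy₁p⟩ := exists_dist_lt_dist_lt n (x := y') (y := p) hρ (sub_pos.2 hρr)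
    (by linarith)
  -- The two moves cost less than 2ρ of the distance 3ρ to the smaller balls.
  have hreg : y₁ ∈ S.region ρ l := by
    refine ⟨by rw [dist_comm]; exact hy₁p.le, fun k hk hkl w hw u hu => ?_⟩
    have h1 := hfar k hk hkl w hw u hu
    have h2 := dist_triangle4 y y' y₁ (S.limMap k w u)
    linarith [min_le_right δ ρ]
  obtain ⟨q, hq, hqd⟩ := exists_dist_lt_of_maximal_isSep hρ (hY l) hreg
  refine ⟨_, ⟨l, hl, z, hz, q, hq, rfl⟩, ?_⟩
  have d1 : dist (S.limMap l z y') (S.limMap l z y) < ρ := by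
    refine hcont y' hy'.le ?_
    rw [dist_comm]
    exact hyy'.trans_le (min_le_left _ _)
  have d2 := H.dist_le_of_add_lt hL.le (a := y₁) (b := y') (by
    rw [dist_comm y₁ y', dist_comm p]; linarith)
  have d3 := H.dist_le_of_add_lt hL.le (a := y₁) (b := q) (by
    rw [dist_comm p]; linarith)
  have d4 := dist_triangle4 (S.limMap l z y) (S.limMap l z y') (S.limMap l z y₁) (S.limMap l z q)
  rw [dist_comm (S.limMap l z y) (S.limMap l z y'), dist_comm (S.limMap l z y') (S.limMap l z y₁)] at d4
  rw [dist_comm y₁ y'] at d2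
  have d5 : lam 0 ^ 2 * dist y' y₁ ≤ lam 0 ^ 2 * ρ := by gcongr
  have d6 : lam 0 ^ 2 * dist y₁ q ≤ lam 0 ^ 2 * ρ := by gcongr
  linarith

variable [CompleteSpace M]

include hA in
-- Points in unrelated balls are 1 apart. Otherwise both points are images under the map of the
-- larger ball, where they are ρ apart, and the room ρ around `Y l` allows `IsPPQI.min_le_mul_dist`.
theorem isSep_translates (hρ : 0 < ρ) (hY : ∀ l, Y l ⊆ S.region ρ l) (hs : ∀ l, IsSep ρ (Y l)) :
    IsSep (min 1 (ρ / lam 0 ^ 2)) (S.translates Y) := by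
  have hL : 0 < lam 0 ^ 2 := by have := hA.one_le_lam 0; positivity
  have key : ∀ k l, k ≤ l → ∀ x x', (0 < k ∧ ∃ z ∈ S.limNet k, ∃ y ∈ Y k, x = S.limMap k z y) →
      (0 < l ∧ ∃ z ∈ S.limNet l, ∃ y ∈ Y l, x' = S.limMap l z y) → x ≠ x' →
      min 1 (ρ / lam 0 ^ 2) ≤ dist x x' := by
    rintro k l hkl _ _ ⟨hk, w, hw, y, hy, rfl⟩ ⟨hl, z, hz, y', hy', rfl⟩ hne
    have hyb := mem_closedBall_of_mem_region hρ.le (hY k hy)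
    have hyb' := mem_closedBall_of_mem_region hρ.le (hY l hy')
    have h5 : ∀ v ∈ closedBall p (r l), ρ ≤ dist y' v →
        min 1 (ρ / lam 0 ^ 2) ≤ dist (S.limMap l z v) (S.limMap l z y') := by
      intro v hv hd
      refine (min_le_right _ _).trans ?_
      rw [div_le_iff₀ hL, mul_comm, dist_comm]
      rw [mem_closedBall, dist_comm] at hv
      exact (le_min le_rfl hd).trans ((S.limMap_isPPQI hA hz).min_le_mul_dist hL
        (by linarith [(hY l hy').1]) hv)
    rcases hkl.eq_or_lt with rfl | hkl
    · rcases eq_or_ne w z with rfl | hwz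
      · refine h5 y hyb (hs k y' hy' y hy ?_)
        rintro rfl
        exact hne rfl
      · exact (min_le_left _ _).trans (S.one_le_dist_of_ne hA hk hw hz hwz hyb hyb')
    · rcases S.one_le_dist_or_exists hA hk hkl hw hz with h | ⟨v, hv, rfl⟩
      · exact (min_le_left _ _).trans (h y hyb y' hyb')
      · obtain ⟨h1, h2, h3⟩ := S.limMap_comp hkl hv hz (net_subset_closedBall hA hkl hv)
        rw [h3 hyb]
        exact h5 _ (h2 hyb) ((hY l hy').2 k hk hkl v hv y hyb)
  rintro x ⟨k, hk⟩ x' ⟨l, hl⟩ hne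
  rcases le_total k l with h | h
  · exact key k l h x x' hk hl hne
  · rw [dist_comm]; exact key l k h x' x hl hk hne.symm

include hA in
-- The factor 6 is 3 for reaching a smaller ball, plus 3 from `exists_translates_near`, using ρ ≤
-- λ_0² ρ.
theorem isRelDense_translates (hρ : 0 < ρ) (hρ1 : 6 * (lam 0 ^ 2 * ρ) ≤ 1)
    (hY : ∀ l, Maximal (fun Q => Q ⊆ S.region ρ l ∧ IsSep ρ Q) (Y l)) :
    IsRelDense (6 * (lam 0 ^ 2 * ρ)) (S.translates Y) := by
  classical
  have hL1 : 1 ≤ lam 0 ^ 2 := one_le_pow₀ (hA.one_le_lam 0)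
  have hL : 0 < lam 0 ^ 2 := by linarith
  have hLρ : ρ ≤ lam 0 ^ 2 * ρ := le_mul_of_one_le_left hρ.le hL1
  have hρr : ∀ l, ρ < r l := fun l => by linarith [hA.one_lt_r l]
  refine eq_univ_of_forall fun x => ?_
  suffices h : ∃ x' ∈ S.translates Y, dist x x' ≤ 6 * (lam 0 ^ 2 * ρ) by
    obtain ⟨x', hx', hd⟩ := h
    exact mem_cthickening_of_dist_le x x' _ _ hx' hd
  -- Balls around `p` exhaust M, so some level represents `x`; the least one is used.
  have hex : ∃ l, 0 < l ∧ ∃ z ∈ S.limNet l, ∃ y ∈ closedBall p (r l), S.limMap l z y = x := by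
    obtain ⟨l, h1, h2⟩ := ((hA.r_lim.eventually_ge_atTop (dist x p)).and
      (eventually_gt_atTop 0)).exists
    exact ⟨l, h2, p, S.base_mem_limNet l, x, h1, S.limMap_base l h1⟩
  obtain ⟨hl, z, hz, y, hy, hyx⟩ := Nat.find_spec hex
  set l := Nat.find hex with hldef
  by_cases hfar : ∀ k, 0 < k → k < l → ∀ w ∈ S.net k l, ∀ u ∈ closedBall p (r k),
      3 * ρ ≤ dist y (S.limMap k w u)
  · obtain ⟨x', hx', hd⟩ := exists_translates_near hA hρ hY hl (hρr l) hz hy hfar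
    rw [hyx] at hd
    exact ⟨x', hx', by linarith⟩
  push Not at hfar
  obtain ⟨k, hk, hkl, w, hw, u, hu, hlt⟩ := hfar
  obtain ⟨h1, h2, h3⟩ := S.limMap_comp hkl hw hz (net_subset_closedBall hA hkl hw)
  -- If `u` were deep in its ball, the nearby point `y` would lift to that ball and represent `x` at
  -- the lower level k.
  have hbd : r k < dist p u + lam 0 ^ 2 * (3 * ρ) := by
    by_contra! hcon
    rw [dist_comm] at hlt
    obtain ⟨c, hc, hcy⟩ := (S.limMap_isPPQI hA (S.mem_limNet hkl.le hw)).exists_lift hL hcon hlt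
    have hcb : c ∈ closedBall p (r k) := by
      rw [mem_closedBall, dist_comm]; linarith [dist_triangle p u c]
    refine Nat.find_min hex hkl ⟨hk, _, h1, c, hcb, ?_⟩
    rw [h3 hcb, Function.comp_apply, hcy, hyx]
  -- Being near the boundary at level k, `u` is more than 1 - 3λ_0²ρ ≥ 3ρ away from the balls of
  -- lower level.
  obtain ⟨x', hx', hd⟩ := exists_translates_near hA hρ hY hk (hρr k) h1 hu
    fun m hm hmk v hv u' hu' => by
      have h4 := dist_limMap_add_one_le hA hmk hv hu'
      have h5 := dist_triangle p (S.limMap m v u') u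
      rw [dist_comm (S.limMap m v u') u] at h5
      linarith
  rw [h3 hu, Function.comp_apply] at hd
  have h6 := (S.limMap_isPPQI hA hz).dist_le_of_add_lt hL.le (a := S.limMap k w u) (b := y) (by
    rw [dist_comm _ y]
    linarith [dist_limMap_add_one_le hA hkl hw hu])
  rw [hyx, dist_comm (S.limMap k w u)] at h6
  have h7 : lam 0 ^ 2 * dist y (S.limMap k w u) ≤ lam 0 ^ 2 * (3 * ρ) := by gcongr
  refine ⟨x', hx', ?_⟩
  have h8 := dist_triangle x (S.limMap l z (S.limMap k w u)) x'
  rw [dist_comm x (S.limMap l z (S.limMap k w u))] at h8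
  linarith

variable (S)

include hA in
theorem exists_separated_dense_invariant {η : ℝ} (hη : 0 < η) :
    ∃ X : Set M, p ∈ X ∧ (∃ K : ℝ, 0 < K ∧ IsSep K X) ∧ IsRelDense η X ∧
      ∀ a ∈ S.limPairs 0, X ∩ S.limMap a.1 a.2 '' closedBall p (r a.1) =
        S.limMap a.1 a.2 '' (X ∩ closedBall p (r a.1)) := by
  have hL1 : 1 ≤ lam 0 ^ 2 := one_le_pow₀ (hA.one_le_lam 0)
  have hL : 0 < lam 0 ^ 2 := by linarith
  -- The bound η is for the density, the bound 1 for the gaps between balls.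
  obtain ⟨ρ, hρ, hρη⟩ : ∃ ρ : ℝ, 0 < ρ ∧ 6 * (lam 0 ^ 2 * ρ) = min η 1 := by
    have : 0 < min η 1 := lt_min hη one_pos
    have h0 : lam 0 ≠ 0 := by have := hA.one_le_lam 0; positivity
    exact ⟨min η 1 / (6 * lam 0 ^ 2), by positivity, by field_simp⟩
  have hLρ : ρ ≤ lam 0 ^ 2 * ρ := le_mul_of_one_le_left hρ.le hL1
  have hle := min_le_left η 1
  have hle1 := min_le_right η 1
  obtain ⟨Y, hp, hY⟩ := S.exists_region_maximal (ρ := ρ) (by linarith [hA.one_lt_r 1])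
  refine ⟨S.translates Y, ⟨1, one_pos, p, S.base_mem_limNet 1, p, hp, ?_⟩,
    ⟨_, ?_, isSep_translates hA hρ (fun l => (hY l).1.1) fun l => (hY l).1.2⟩, ?_,
    fun a ha => translates_inter_eq hA hρ (fun l => (hY l).1.1) ha.1 ha.2⟩
  · exact (S.limMap_base 1 (mem_closedBall_self (hA.r_pos 1).le)).symm
  · positivity
  · have h := isRelDense_translates hA hρ (by linarith) hY
    unfold IsRelDense at h ⊢
    exact eq_univ_of_univ_subset (h ▸ cthickening_mono (by linarith) _)

end NestedSystem

end InvariantSet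

/-! ### Infinite products of the distortion constants. -/

section InfiniteProducts

variable {lam : ℕ → ℝ}

theorem multipliable_lam (h1 : ∀ i, 1 ≤ lam i) (h2 : ∀ i, lam (i + 1) ^ 2 ≤ lam i) (i : ℕ) :
    Multipliable fun k => lam (i + k) := by
  refine Real.multipliable_of_summable_log (fun k => by linarith [h1 (i + k)]) ?_
  refine summable_of_sum_range_le (c := Real.log (lam i ^ 2)) (fun k => Real.log_nonneg (h1 _))
    fun m => ?_
  rw [← Real.log_prod (fun k _ => by linarith [h1 (i + k)])]
  have h3 : ∏ k ∈ Finset.range m, lam (i + k) = LamFin lam i (i + m) := by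
    rw [LamFin, Finset.prod_Ico_eq_prod_range, Nat.add_sub_cancel_left]
  rw [h3]
  exact Real.log_le_log (by linarith [one_le_LamFin h1 i (i + m)]) (LamFin_le_sq h1 h2 _ _)

theorem LamInf_le_sq (h1 : ∀ i, 1 ≤ lam i) (h2 : ∀ i, lam (i + 1) ^ 2 ≤ lam i) (i : ℕ) :
    LamInf lam i ≤ lam i ^ 2 := by
  refine le_of_tendsto' (multipliable_lam h1 h2 i).hasProd.tendsto_prod_nat fun m => ?_
  have h3 : ∏ k ∈ Finset.range m, lam (i + k) = LamFin lam i (i + m) := by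
    rw [LamFin, Finset.prod_Ico_eq_prod_range, Nat.add_sub_cancel_left]
  rw [h3]
  exact LamFin_le_sq h1 h2 _ _

theorem LamFin_mul_LamInf (h1 : ∀ i, 1 ≤ lam i) (h2 : ∀ i, lam (i + 1) ^ 2 ≤ lam i) {i j : ℕ}
    (h : i ≤ j) : LamFin lam i j * LamInf lam j = LamInf lam i := by
  obtain ⟨d, rfl⟩ := Nat.exists_eq_add_of_le h
  have h3 := Multipliable.prod_mul_tprod_nat_mul' (f := fun k => lam (i + k)) (k := d)
    ((multipliable_lam h1 h2 (i + d)).congr fun k => by congr 1; omega)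
  have h4 : ∏ k ∈ Finset.range d, lam (i + k) = LamFin lam i (i + d) := by
    rw [LamFin, Finset.prod_Ico_eq_prod_range, Nat.add_sub_cancel_left]
  rw [LamInf, LamInf, ← h3, h4]
  congr 1
  refine tprod_congr fun k => ?_
  congr 1
  omega

end InfiniteProducts

/-! ### Recursion on the difference of two indices. -/

section Recursion

/-- Recursion along the differences `j - i`. -/
theorem exists_rec_sub {D : Type*} (d₀ : D) (R : ℕ → ℕ → (ℕ → ℕ → D) → D → Prop)
    (hex : ∀ i j F, i < j → ∃ d, R i j F d)
    (hcongr : ∀ i j F G d, i < j → (∀ k l, l - k < j - i → F k l = G k l) → R i j F d → R i j G d) :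
    ∃ F : ℕ → ℕ → D, (∀ i, F i i = d₀) ∧ ∀ i j, i < j → R i j F (F i j) := by
  classical
  -- Off i < j, and at pairs of no smaller difference, the default `d₀` is supplied; `hcongr` makes
  -- the latter harmless.
  have hex' : ∀ i j F, ∃ d, i < j → R i j F d := fun i j F => by
    by_cases h : i < j
    · obtain ⟨d, hd⟩ := hex i j F h
      exact ⟨d, fun _ => hd⟩
    · exact ⟨d₀, fun h' => absurd h' h⟩
  choose step hstep using hex'
  let F : ℕ × ℕ → D := WellFounded.fix (measure fun a : ℕ × ℕ => a.2 - a.1).wf fun a rec =>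
    if a.1 < a.2 then
      step a.1 a.2 fun k l => if h : l - k < a.2 - a.1 then rec (k, l) h else d₀
    else d₀
  have hF : ∀ a, F a = if a.1 < a.2 then
      step a.1 a.2 fun k l => if l - k < a.2 - a.1 then F (k, l) else d₀ else d₀ := fun a => by
    simp only [F]
    rw [WellFounded.fix_eq]
    rfl
  refine ⟨fun i j => F (i, j), fun i => (hF (i, i)).trans (if_neg (lt_irrefl i)), fun i j hij => ?_⟩
  have h1 : F (i, j) = step i j fun k l => if l - k < j - i then F (k, l) else d₀ :=
    (hF (i, j)).trans (if_pos hij)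
  dsimp only
  rw [h1]
  refine hcongr i j _ _ _ hij (fun k l hkl => ?_) (hstep i j _ hij)
  exact if_pos hkl

end Recursion

/-! ### The recursive construction of nets and maps. -/

section NestedConstruction

/-- Only the nets M_l^j with l > i enter, whose index difference is below j - i; this legitimizes
the recursion. -/
theorem pairs_congr {M : Type*} {net net' : ℕ → ℕ → Set M} {i j : ℕ}
    (h : ∀ k l, l - k < j - i → net k l = net' k l) : pairs net i j = pairs net' i j := by
  ext a
  refine and_congr_right fun h1 => and_congr_right fun h2 => ?_
  rw [h a.1 j (by omega)]

theorem maxPairs_congr {M : Type*} {net net' : ℕ → ℕ → Set M} {map map' : ℕ → ℕ → M → M → M} {i j : ℕ}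
    (h : ∀ k l, l - k < j - i → net k l = net' k l)
    (h' : ∀ k l, l - k < j - i → map k l = map' k l) :
    maxPairs net map i j = maxPairs net' map' i j := by
  ext a
  have hp := pairs_congr h
  unfold maxPairs
  rw [hp]
  refine and_congr_right fun h1 => forall₂_congr fun b hb => ?_
  have h2 := h1.1
  have h3 := hb.1
  have h4 := hb.2.1
  rw [pairLT, pairLT, h' b.1 j (by omega), h a.1 b.1 (by omega)]

variable (n : ℕ) {M : Type*} [MetricSpace M] [ChartedSpace (EuclideanSpace ℝ (Fin n)) M]
  [IsManifold (𝓡 n) ∞ M] [RiemannianBundle (fun x : M => TangentSpace (𝓡 n) x)]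

/-- The set in which `\hat M_i^j` is a maximal separated set. -/
def hatRegion (p : M) (r s t lam : ℕ → ℝ) (net : ℕ → ℕ → Set M) (map : ℕ → ℕ → M → M → M)
    (i j : ℕ) : Set M :=
  (Omega n p i (r i) (lam i) ∩ closedBall p (r j - t i)) \
    (⋃ a ∈ maxPairs net map i j, fatBall r s lam i j a)

/-- The recursion step for nested systems: the net `N`, its part `Q` and the maps `H` at
`(i, j)` are constructed from the nets and maps at `(k, l)` with `l - k < j - i`. -/
structure IsNestedStep (p : M) (r s t lam : ℕ → ℝ) (net : ℕ → ℕ → Set M)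
    (map : ℕ → ℕ → M → M → M) (i j : ℕ) (N Q : Set M) (H : M → M → M) : Prop where
  hat_max : Maximal (fun Q : Set M => Q ⊆ hatRegion n p r s t lam net map i j ∧ IsSep (s i) Q) Q
  base_mem_hat : p ∈ hatRegion n p r s t lam net map i j → p ∈ Q
  net_eq : N = Q ∪ ⋃ a ∈ pairs net i j, map a.1 j a.2 '' net i a.1
  map_eq : ∀ x, (∃ a ∈ maxPairs net map i j, ∃ x' ∈ net i a.1, map a.1 j a.2 x' = x ∧
      H x = map a.1 j a.2 ∘ map i a.1 x') ∨
    (∀ a ∈ maxPairs net map i j, ∀ x' ∈ net i a.1, map a.1 j a.2 x' ≠ x) ∧ (x = p → H x = id) ∧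
      (x ≠ p → x ∈ Omega n p i (r i) (lam i) → IsPPQI n i (r i) (lam i) p x (H x))

variable (p : M) (r s t lam : ℕ → ℝ)

theorem exists_isNestedStep (net : ℕ → ℕ → Set M) (map : ℕ → ℕ → M → M → M) (i j : ℕ) :
    ∃ d : Set M × Set M × (M → M → M), IsNestedStep n p r s t lam net map i j d.1 d.2.1 d.2.2 := by
  classical
  -- The maximal set is grown from `p` whenever `p` is available, so that `p` ends up in the net.
  obtain ⟨Q, hQ, hQm⟩ := exists_maximal_isSep (ρ := s i)
    (S := {p} ∩ hatRegion n p r s t lam net map i j) inter_subset_right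
    fun x hx y hy => isSep_singleton p x hx.1 y hy.1
  have hH : ∀ x, ∃ H : M → M, (∃ a ∈ maxPairs net map i j, ∃ x' ∈ net i a.1,
      map a.1 j a.2 x' = x ∧ H = map a.1 j a.2 ∘ map i a.1 x') ∨
    (∀ a ∈ maxPairs net map i j, ∀ x' ∈ net i a.1, map a.1 j a.2 x' ≠ x) ∧ (x = p → H = id) ∧
      (x ≠ p → x ∈ Omega n p i (r i) (lam i) → IsPPQI n i (r i) (lam i) p x H) := fun x => by
    by_cases h : ∃ a ∈ maxPairs net map i j, ∃ x' ∈ net i a.1, map a.1 j a.2 x' = x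
    · obtain ⟨a, ha, x', hx', he⟩ := h
      exact ⟨_, Or.inl ⟨a, ha, x', hx', he, rfl⟩⟩
    · push Not at h
      by_cases hp : x = p
      · exact ⟨id, Or.inr ⟨h, fun _ => rfl, fun h => absurd hp h⟩⟩
      · by_cases hx : x ∈ Omega n p i (r i) (lam i)
        · obtain ⟨H, hH⟩ := id hx
          exact ⟨H, Or.inr ⟨h, fun h => absurd h hp, fun _ _ => hH⟩⟩
        · exact ⟨id, Or.inr ⟨h, fun h => absurd h hp, fun _ h => absurd h hx⟩⟩
  choose H hH using hH
  exact ⟨(Q ∪ ⋃ a ∈ pairs net i j, map a.1 j a.2 '' net i a.1, Q, H), hQm, fun h => hQ ⟨rfl, h⟩,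
    rfl, hH⟩

theorem IsNestedStep.congr {net net' : ℕ → ℕ → Set M} {map map' : ℕ → ℕ → M → M → M} {i j : ℕ}
    (h : ∀ k l, l - k < j - i → net k l = net' k l)
    (h' : ∀ k l, l - k < j - i → map k l = map' k l) {N Q : Set M} {H : M → M → M}
    (hS : IsNestedStep n p r s t lam net map i j N Q H) :
    IsNestedStep n p r s t lam net' map' i j N Q H := by
  have hm := maxPairs_congr h h'
  have hp := pairs_congr h
  have hr : hatRegion n p r s t lam net' map' i j = hatRegion n p r s t lam net map i j := by
    rw [hatRegion, hatRegion, hm]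
  have key : ∀ a ∈ pairs net' i j,
      net i a.1 = net' i a.1 ∧ map a.1 j = map' a.1 j ∧ map i a.1 = map' i a.1 := fun a ha => by
    have h1 := ha.1
    have h2 := ha.2.1
    exact ⟨h _ _ (by omega), h' _ _ (by omega), h' _ _ (by omega)⟩
  refine ⟨hr ▸ hS.hat_max, hr ▸ hS.base_mem_hat, ?_, fun x => ?_⟩
  · rw [hS.net_eq, hp]
    congr 1
    refine iUnion₂_congr fun a ha => ?_
    rw [(key a ha).1, (key a ha).2.1]
  · have h3 := hS.map_eq x
    rw [hm] at h3
    refine h3.imp ?_ ?_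
    · rintro ⟨a, ha, x', hx', he, hH⟩
      obtain ⟨k1, k2, k3⟩ := key a ha.1
      exact ⟨a, ha, x', k1 ▸ hx', k2 ▸ he, k2 ▸ k3 ▸ hH⟩
    · rintro ⟨k, hk⟩
      refine ⟨fun a ha x' hx' => ?_, hk⟩
      obtain ⟨k1, k2, k3⟩ := key a ha.1
      rw [← k1] at hx'
      rw [← k2]
      exact k a ha x' hx'

theorem exists_nestedSteps : ∃ (net hat : ℕ → ℕ → Set M) (map : ℕ → ℕ → M → M → M),
    (∀ i, net i i = {p}) ∧ (∀ i x, map i i x = id) ∧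
    ∀ i j, i < j → IsNestedStep n p r s t lam net map i j (net i j) (hat i j) (map i j) := by
  obtain ⟨F, h0, hF⟩ := exists_rec_sub (D := Set M × Set M × (M → M → M)) ({p}, ∅, fun _ => id)
    (fun i j F d => IsNestedStep n p r s t lam (fun k l => (F k l).1) (fun k l => (F k l).2.2) i j
      d.1 d.2.1 d.2.2)
    (fun i j F _ => exists_isNestedStep n p r s t lam _ _ i j)
    (fun i j F G d _ hFG hS => hS.congr n p r s t lam (fun k l hkl => congrArg (·.1) (hFG k l hkl))
      fun k l hkl => congrArg (·.2.2) (hFG k l hkl))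
  exact ⟨fun i j => (F i j).1, fun i j => (F i j).2.1, fun i j => (F i j).2.2,
    fun i => by simp only [h0], fun i x => by simp only [h0], hF⟩

end NestedConstruction

/-! ### The properties of nested systems, by induction on the difference of the indices. -/

section NestedInduction

variable {n : ℕ} {M : Type*} [MetricSpace M] [ChartedSpace (EuclideanSpace ℝ (Fin n)) M]
  [IsManifold (𝓡 n) ∞ M] [RiemannianBundle (fun x : M => TangentSpace (𝓡 n) x)]
  {p : M} {r s t lam : ℕ → ℝ}

namespace IsAdmissible

variable (hA : IsAdmissible n p r s t lam)
include hA

theorem lam_mul_LamFin_le (i j : ℕ) : lam i * LamFin lam i j ≤ lam i ^ 3 := by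
  have h1 := hA.one_le_lam i
  have h2 := hA.LamFin_le i j
  nlinarith

theorem lam_cube_le (i : ℕ) : lam i ^ 3 ≤ lam 0 ^ 3 := by
  have := hA.one_le_lam i
  gcongr
  exact hA.lam_le i

theorem le_prev {i l : ℕ} (h : i < l) : s i ≤ prev s l := by
  obtain ⟨k, rfl⟩ : ∃ k, l = k + 1 := ⟨l - 1, by omega⟩
  exact hA.s_mono (by omega)

theorem s_gt_of_lt {i l : ℕ} (h : i < l) : 2 * lam 0 ^ 5 * (r l + s i) < s l := by
  refine lt_of_le_of_lt ?_ (hA.s_gt_r l)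
  have h2 := hA.one_le_lam 0
  exact mul_le_mul_of_nonneg_left (by linarith [hA.le_prev h]) (by positivity)

/-- For disjointness of fat balls of different levels. By `hsm`, distortion adds at most 1 to
r_{l'}; s_l pays for the rest. -/
theorem fat_add_fat_lt (hsm : ∀ l, 0 < l → r l * (lam l ^ 3 - 1) ≤ 1) {i l l' j : ℕ} (hil : i < l)
    (hll : l < l') : lam l * LamFin lam l j * (r l + s i) + lam l' * LamFin lam l' j * (r l' + s i)
      < lam l' * LamInf lam j * (r l' + s l) := by
  have h1 := hA.s_gt_of_lt hil
  have h2 := hsm l' (by omega)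
  have h3 := (hA.lam_mul_LamFin_le l j).trans (hA.lam_cube_le l)
  have h4 := hA.lam_mul_LamFin_le l' j
  have h5 := hA.lam_cube_le l'
  have h6 := one_le_LamInf hA.one_le_lam j
  have h7 := hA.one_le_lam l'
  have h8 := hA.one_le_lam 0
  have hrl := hA.one_lt_r l
  have hrl' := hA.r_pos l'
  have hsi := hA.s_pos i
  have hsl := hA.s_pos l
  have e1 : lam l * LamFin lam l j * (r l + s i) ≤ lam 0 ^ 3 * (r l + s i) := by gcongr
  have e2 : lam l' * LamFin lam l' j * (r l' + s i) ≤ lam l' ^ 3 * (r l' + s i) := by gcongr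
  have e3 : lam l' ^ 3 * s i ≤ lam 0 ^ 3 * s i := by gcongr
  have e4 : r l' + s l ≤ lam l' * LamInf lam j * (r l' + s l) :=
    le_mul_of_one_le_left (by positivity) (by nlinarith)
  have e5 : lam 0 ^ 3 ≤ lam 0 ^ 5 := pow_le_pow_right₀ h8 (by norm_num)
  have e6 : lam 0 ^ 3 * (r l + s i) ≤ lam 0 ^ 5 * (r l + s i) := by gcongr
  have e7 : 1 ≤ lam 0 ^ 3 := one_le_pow₀ h8
  nlinarith

theorem two_fat_lt {i l : ℕ} (hil : i < l) (j : ℕ) :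
    2 * (lam l * LamFin lam l j * (r l + s i)) < s l / LamFin lam (l + 1) j := by
  have h1 := hA.s_gt_of_lt hil
  have h3 := (hA.lam_mul_LamFin_le l j).trans (hA.lam_cube_le l)
  have h4 := hA.LamFin_le (l + 1) j
  have h5 := one_le_LamFin hA.one_le_lam (l + 1) j
  have h6 := (hA.lam_sq l).le.trans (hA.lam_le l)
  have h8 := hA.one_le_lam 0
  have hrl := hA.r_pos l
  have hsi := hA.s_pos i
  have hsl := hA.s_pos l
  rw [lt_div_iff₀ (by linarith)]
  have e1 : lam l * LamFin lam l j * (r l + s i) ≤ lam 0 ^ 3 * (r l + s i) := by gcongr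
  have e2 : 2 * (lam l * LamFin lam l j * (r l + s i)) * LamFin lam (l + 1) j ≤
      2 * (lam 0 ^ 3 * (r l + s i)) * lam 0 := by
    gcongr
    exact h4.trans h6
  have e5 : lam 0 ^ 4 ≤ lam 0 ^ 5 := pow_le_pow_right₀ h8 (by norm_num)
  have e6 : lam 0 ^ 4 * (r l + s i) ≤ lam 0 ^ 5 * (r l + s i) := by gcongr
  nlinarith

theorem LamInf_le (j : ℕ) : LamInf lam j ≤ lam j ^ 2 :=
  LamInf_le_sq hA.one_le_lam (fun i => (hA.lam_sq i).le) j

/-- Hence t_l is room enough to transport the distance bound of `far_or` by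
`IsPPQI.min_le_mul_dist`. -/
theorem lam_mul_LamInf_le_t {i l : ℕ} (hil : i < l) (j : ℕ) :
    lam l * LamInf lam j * (r l + s i) ≤ t l := by
  have h1 := hA.LamInf_le j
  have h2 := hA.lam_sq_le j
  have h3 := hA.lam_le l
  have h4 := hA.one_le_lam l
  have h5 := one_le_LamInf hA.one_le_lam j
  have hrl := hA.r_pos l
  have hsi := hA.s_pos i
  have e1 : lam l * LamInf lam j * (r l + s i) ≤ lam 0 * lam 0 ^ 2 * (r l + s i) := by
    gcongr
    · linarith
    · exact h1.trans h2
  refine e1.trans (le_trans ?_ (hA.t_gt l).le)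
  rw [show lam 0 * lam 0 ^ 2 = lam 0 ^ 3 by ring]
  have h6 := prev_nonneg (fun i => (hA.t_pos i).le) l
  have h7 := prev_nonneg (omegaSeq_nonneg n p r lam) l
  have h8 := hA.one_le_lam 0
  exact mul_le_mul_of_nonneg_left (by linarith [hA.le_prev hil]) (by positivity)

theorem LamInf_le_LamFin {l j : ℕ} (h : l < j) : LamInf lam j ≤ LamFin lam l j := by
  obtain ⟨k, rfl⟩ : ∃ k, j = k + 1 := ⟨j - 1, by omega⟩
  rw [LamFin_succ_right (by omega)]
  have h1 := hA.LamInf_le (k + 1)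
  have h2 := hA.lam_sq k
  have h3 := one_le_LamFin hA.one_le_lam l k
  have h4 := hA.one_le_lam k
  nlinarith

theorem t_le_r (i : ℕ) : t i ≤ r (i + 1) := by
  refine le_trans ?_ (hA.r_gt (i + 1)).le
  have h1 := hA.one_lt_lam 0
  have h2 : 1 ≤ lam 0 ^ 5 / (lam 0 - 1) := by
    rw [one_le_div (by linarith)]
    have := le_self_pow₀ h1.le (n := 5) (by norm_num)
    linarith
  have h3 := hA.r_pos i
  have h4 := hA.s_pos i
  have h5 := hA.t_pos i
  have h6 := omegaSeq_nonneg n p r lam i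
  change t i ≤ _ * (r i + s i + t i + 2 * omegaSeq n p r lam i + 1)
  nlinarith

end IsAdmissible

variable (n p r s t lam)

/-- The properties of a nested system at the indices `i < j`. -/
structure IsNestedAt (net : ℕ → ℕ → Set M) (map : ℕ → ℕ → M → M → M) (i j : ℕ) : Prop where
  isPPQI : ∀ x ∈ net i j, IsPPQI n i (r i) (LamFin lam i j) p x (map i j x)
  disjoint : (maxPairs net map i j).PairwiseDisjoint (fatBall r s lam i j)
  sep : IsSep (s i / LamFin lam (i + 1) j) (net i j)
  dist_le : ∀ x ∈ net i j, dist p x ≤ r j - t i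
  comp : ∀ a ∈ pairs net i j, ∀ x ∈ net i j,
    ∀ x' ∈ closedBall p (r a.1), map a.1 j a.2 x' = x →
      MapsTo (map i a.1 x') (closedBall p (r i)) (closedBall p (r a.1)) ∧
      EqOn (map i j x) (map a.1 j a.2 ∘ map i a.1 x') (closedBall p (r i))
  inter : ∀ a ∈ pairs net i j,
    net i j ∩ map a.1 j a.2 '' closedBall p (r a.1) = map a.1 j a.2 '' net i a.1
  far_or : ∀ x ∈ net i j, ∀ a ∈ pairs net i j,
    lam a.1 * LamInf lam j * (r a.1 + s i) ≤ dist x a.2 ∨ x ∈ map a.1 j a.2 '' net i a.1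
  mono : ∀ k l, k ≤ l → (l < j ∧ i ≤ k ∨ l = j ∧ i < k) →
    net k l ⊆ net i j ∧ ∀ z ∈ net k l, EqOn (map i j z) (map k l z) (closedBall p (r i))
  base_mem : p ∈ net i j
  map_base : EqOn (map i j p) id (closedBall p (r i))

variable {n p r s t lam}
variable {net hat : ℕ → ℕ → Set M} {map : ℕ → ℕ → M → M → M}

theorem IsNestedAt.mem_closedBall {i j : ℕ} (h : IsNestedAt n p r s t lam net map i j)
    (ht : 0 < t i) {x : M} (hx : x ∈ net i j) : x ∈ closedBall p (r j) := by
  rw [Metric.mem_closedBall, dist_comm]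
  linarith [h.dist_le x hx]

namespace IsNestedStep

variable [IsContMDiffRiemannianBundle (𝓡 n) ∞ (EuclideanSpace ℝ (Fin n))
    (fun x : M => TangentSpace (𝓡 n) x)] [IsRiemannianManifold (𝓡 n) M]
  {i j : ℕ} (hA : IsAdmissible n p r s t lam)
  (hsm : ∀ l, 0 < l → r l * (lam l ^ 3 - 1) ≤ 1) (hst : ∀ i, s i ≤ t i)
  (hS : IsNestedStep n p r s t lam net map i j (net i j) (hat i j) (map i j))
  (IH : ∀ k l, k < l → l - k < j - i → IsNestedAt n p r s t lam net map k l)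

include IH in
omit [IsContMDiffRiemannianBundle (𝓡 n) ∞ (EuclideanSpace ℝ (Fin n))
    (fun x : M => TangentSpace (𝓡 n) x)] [IsRiemannianManifold (𝓡 n) M] in
theorem left_right {a : ℕ × M} (ha : a ∈ pairs net i j) :
    IsNestedAt n p r s t lam net map i a.1 ∧ IsNestedAt n p r s t lam net map a.1 j := by
  have h1 := ha.1
  have h2 := ha.2.1
  exact ⟨IH _ _ h1 (by omega), IH _ _ h2 (by omega)⟩

include IH hA

theorem dist_map_le {a : ℕ × M} (ha : a ∈ pairs net i j) {y : M} (hy : y ∈ closedBall p (r a.1)) :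
    dist a.2 (map a.1 j a.2 y) ≤ LamFin lam a.1 j * dist p y := by
  have h0 := one_le_LamFin hA.one_le_lam a.1 j
  rw [mem_closedBall, dist_comm] at hy
  exact ((left_right IH ha).2.isPPQI a.2 ha.2.2).dist_le_mul (by linarith) hy

theorem map_mem_fatBall {a : ℕ × M} (ha : a ∈ pairs net i j) {y : M}
    (hy : y ∈ closedBall p (r a.1)) : map a.1 j a.2 y ∈ fatBall r s lam i j a := by
  have h1 := dist_map_le hA IH ha hy
  have h0 := one_le_LamFin hA.one_le_lam a.1 j
  have h2 := hA.one_le_lam a.1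
  have h3 := hA.s_pos i
  have h4 := hA.r_pos a.1
  rw [mem_closedBall, dist_comm] at hy
  rw [fatBall, mem_closedBall, dist_comm]
  calc _ ≤ LamFin lam a.1 j * dist p y := h1
    _ ≤ LamFin lam a.1 j * (r a.1 + s i) := by gcongr; linarith
    _ ≤ lam a.1 * LamFin lam a.1 j * (r a.1 + s i) := by
      gcongr
      exact le_mul_of_one_le_left (by linarith) h2

omit [IsContMDiffRiemannianBundle (𝓡 n) ∞ (EuclideanSpace ℝ (Fin n))
    (fun x : M => TangentSpace (𝓡 n) x)] [IsRiemannianManifold (𝓡 n) M] in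
theorem net_subset_closedBall {a : ℕ × M} (ha : a ∈ pairs net i j) :
    net i a.1 ⊆ closedBall p (r a.1) := fun _ hx =>
  (left_right IH ha).1.mem_closedBall (hA.t_pos i) hx

omit hA [IsContMDiffRiemannianBundle (𝓡 n) ∞ (EuclideanSpace ℝ (Fin n))
    (fun x : M => TangentSpace (𝓡 n) x)] in
theorem injOn {a : ℕ × M} (ha : a ∈ pairs net i j) :
    InjOn (map a.1 j a.2) (closedBall p (r a.1)) :=
  ((left_right IH ha).2.isPPQI a.2 ha.2.2).injOn

omit [IsContMDiffRiemannianBundle (𝓡 n) ∞ (EuclideanSpace ℝ (Fin n))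
    (fun x : M => TangentSpace (𝓡 n) x)] [IsRiemannianManifold (𝓡 n) M] in
-- A pair below `b` comes from a pair at the smaller stage `b.1`, and its map factors through that
-- of `b`. This reduces statements about all pairs to maximal ones plus the induction hypothesis.
theorem decompose {a b : ℕ × M} (ha : a ∈ pairs net i j) (hb : b ∈ pairs net i j)
    (hab : pairLT net map j a b) : ∃ z₀ ∈ net a.1 b.1, z₀ ∈ closedBall p (r b.1) ∧
      map b.1 j b.2 z₀ = a.2 ∧ (a.1, z₀) ∈ pairs net i b.1 ∧
      MapsTo (map a.1 b.1 z₀) (closedBall p (r a.1)) (closedBall p (r b.1)) ∧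
      EqOn (map a.1 j a.2) (map b.1 j b.2 ∘ map a.1 b.1 z₀) (closedBall p (r a.1)) := by
  obtain ⟨hlt, z₀, hz₀, he⟩ := hab
  have h1 := ha.1
  have h2 := hb.2.1
  have hz := (IH a.1 b.1 hlt (by omega)).mem_closedBall (hA.t_pos _) hz₀
  obtain ⟨h3, h4⟩ := (left_right IH ha).2.comp b ⟨hlt, h2, hb.2.2⟩ a.2 ha.2.2 z₀ hz he
  exact ⟨z₀, hz₀, hz, he, ⟨h1, hlt, hz₀⟩, h3, h4⟩

omit [IsContMDiffRiemannianBundle (𝓡 n) ∞ (EuclideanSpace ℝ (Fin n))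
    (fun x : M => TangentSpace (𝓡 n) x)] [IsRiemannianManifold (𝓡 n) M] in
theorem pairLT_trans {a b c : ℕ × M} (ha : a ∈ pairs net i j) (hb : b ∈ pairs net i j)
    (hc : c ∈ pairs net i j) (hab : pairLT net map j a b) (hbc : pairLT net map j b c) :
    pairLT net map j a c := by
  obtain ⟨z₁, hz₁, hz₁b, he₁, hp₁, hm₁, hE₁⟩ := decompose hA IH hb hc hbc
  obtain ⟨z₀, hz₀, hz₀b, he₀, hp₀, -⟩ := decompose hA IH ha hb hab
  refine ⟨hab.1.trans hbc.1, map b.1 c.1 z₁ z₀, ?_, ?_⟩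
  · have h1 := ha.1
    have h2 := hc.2.1
    have h3 := hab.1
    have h4 := hbc.1
    have := (IH a.1 c.1 (h3.trans h4) (by omega)).inter (b.1, z₁) ⟨h3, h4, hz₁⟩
    exact (this.superset (mem_image_of_mem _ hz₀)).1
  · rw [← he₀]
    exact (hE₁ hz₀b).symm

omit [IsContMDiffRiemannianBundle (𝓡 n) ∞ (EuclideanSpace ℝ (Fin n))
    (fun x : M => TangentSpace (𝓡 n) x)] [IsRiemannianManifold (𝓡 n) M] in
-- Levels strictly increase along the order and stay below j.
theorem exists_maxPairs {a : ℕ × M} (ha : a ∈ pairs net i j) :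
    ∃ b ∈ maxPairs net map i j, a = b ∨ pairLT net map j a b := by
  by_cases hmax : a ∈ maxPairs net map i j
  · exact ⟨a, hmax, Or.inl rfl⟩
  · obtain ⟨b, hb, hab⟩ : ∃ b ∈ pairs net i j, pairLT net map j a b := by
      by_contra! h
      exact hmax ⟨ha, h⟩
    have hlt := hab.1
    have hbj := hb.2.1
    obtain ⟨c, hc, hbc⟩ := exists_maxPairs hb
    refine ⟨c, hc, Or.inr ?_⟩
    rcases hbc with rfl | hbc
    · exact hab
    · exact pairLT_trans hA IH ha hb hc.1 hab hbc
termination_by j - a.1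

include hsm in
omit [IsContMDiffRiemannianBundle (𝓡 n) ∞ (EuclideanSpace ℝ (Fin n))
    (fun x : M => TangentSpace (𝓡 n) x)] [IsRiemannianManifold (𝓡 n) M] in
-- Equal levels are handled by separation of the centres. For different levels, `far_or` at a
-- smaller difference applies, and its nested alternative contradicts maximality.
theorem fatBall_disjoint : (maxPairs net map i j).PairwiseDisjoint (fatBall r s lam i j) := by
  have key : ∀ a ∈ maxPairs net map i j, ∀ b ∈ maxPairs net map i j, a ≠ b → a.1 ≤ b.1 →
      Disjoint (fatBall r s lam i j a) (fatBall r s lam i j b) := by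
    intro a ha b hb hne hle
    refine closedBall_disjoint_closedBall ?_
    rcases hle.eq_or_lt with heq | hlt
    · obtain ⟨l, z⟩ := a
      obtain ⟨l', z'⟩ := b
      obtain rfl : l = l' := heq
      have h1 := (left_right IH ha.1).2.sep z ha.1.2.2 z' hb.1.2.2 (by rintro rfl; exact hne rfl)
      have h2 := hA.two_fat_lt ha.1.1 j
      dsimp only at h1 h2 ⊢
      linarith
    · have h1 := hA.fat_add_fat_lt hsm (j := j) ha.1.1 hlt
      rcases (left_right IH ha.1).2.far_or a.2 ha.1.2.2 b ⟨hlt, hb.1.2.1, hb.1.2.2⟩ with h | h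
      · linarith
      · exact absurd ⟨hlt, h⟩ (ha.2 b hb.1)
  intro a ha b hb hne
  rcases le_total a.1 b.1 with h | h
  · exact key a ha b hb hne h
  · exact (key b hb a ha hne.symm h).symm

include hS in
omit [IsContMDiffRiemannianBundle (𝓡 n) ∞ (EuclideanSpace ℝ (Fin n))
    (fun x : M => TangentSpace (𝓡 n) x)] [IsRiemannianManifold (𝓡 n) M] in
theorem mem_net_iff {x : M} : x ∈ net i j ↔
    x ∈ hat i j ∨ ∃ b ∈ maxPairs net map i j, x ∈ map b.1 j b.2 '' net i b.1 := by
  rw [hS.net_eq]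
  simp only [mem_union, mem_iUnion₂, exists_prop]
  refine or_congr_right ⟨?_, fun ⟨b, hb, h⟩ => ⟨b, hb.1, h⟩⟩
  rintro ⟨a, ha, x', hx', rfl⟩
  obtain ⟨b, hb, rfl | hab⟩ := exists_maxPairs hA IH ha
  · exact ⟨a, hb, x', hx', rfl⟩
  · obtain ⟨z₀, hz₀, hz₀b, he₀, hp₀, hm, hE⟩ := decompose hA IH ha hb.1 hab
    refine ⟨b, hb, map a.1 b.1 z₀ x', ?_, (hE (net_subset_closedBall hA IH ha hx')).symm⟩
    exact (((left_right IH hb.1).1.inter (a.1, z₀) hp₀).superset (mem_image_of_mem _ hx')).1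

include hsm hS in
-- New points avoid the fat balls by construction, and translates by other maximal pairs lie in
-- other, disjoint fat balls.
theorem mem_of_mem_fatBall {x : M} (hx : x ∈ net i j) {b : ℕ × M} (hb : b ∈ maxPairs net map i j)
    (hxb : x ∈ fatBall r s lam i j b) : x ∈ map b.1 j b.2 '' net i b.1 := by
  rcases (mem_net_iff hA hS IH).1 hx with h | ⟨a, ha, x', hx', rfl⟩
  · exact absurd (mem_iUnion₂.2 ⟨b, hb, hxb⟩) (hS.hat_max.1.1 h).2
  · have h1 := map_mem_fatBall hA IH ha.1 (net_subset_closedBall hA IH ha.1 hx')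
    obtain rfl := (fatBall_disjoint hA hsm IH).elim_set ha hb _ h1 hxb
    exact ⟨x', hx', rfl⟩

include hsm hS in
-- The construction chose some maximal pair through which to define the map; disjointness of fat
-- balls and injectivity leave no choice.
theorem map_eq_comp {b : ℕ × M} (hb : b ∈ maxPairs net map i j) {x' : M} (hx' : x' ∈ net i b.1) :
    map i j (map b.1 j b.2 x') = map b.1 j b.2 ∘ map i b.1 x' := by
  have hxb := net_subset_closedBall hA IH hb.1 hx'
  rcases hS.map_eq (map b.1 j b.2 x') with ⟨a, ha, x'', hx'', he, hH⟩ | ⟨h, -⟩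
  · have hxa := net_subset_closedBall hA IH ha.1 hx''
    have h1 := map_mem_fatBall hA IH ha.1 hxa
    rw [he] at h1
    obtain rfl := (fatBall_disjoint hA hsm IH).elim_set ha hb _ h1 (map_mem_fatBall hA IH hb.1 hxb)
    rw [hH, injOn IH ha.1 hxa hxb he]
  · exact absurd rfl (h b hb x' hx')

theorem comp_isPPQI {a : ℕ × M} (ha : a ∈ pairs net i j) {x' : M} (hx' : x' ∈ net i a.1) :
    IsPPQI n i (r i) (LamFin lam i j) p (map a.1 j a.2 x') (map a.1 j a.2 ∘ map i a.1 x') ∧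
      MapsTo (map i a.1 x') (closedBall p (r i)) (closedBall p (r a.1)) := by
  obtain ⟨hl, hr⟩ := left_right IH ha
  have h0 := one_le_LamFin hA.one_le_lam i a.1
  have h1 := one_le_LamFin hA.one_le_lam a.1 j
  have h2 := (hA.LamFin_le i a.1).trans (hA.lam_sq_le i)
  have h3 := hA.r_pos i
  have h4 : LamFin lam i a.1 * r i ≤ lam 0 ^ 2 * r i := by gcongr
  have h5 := (hr.isPPQI a.2 ha.2.2).comp h3.le (hl.isPPQI x' hx') ha.1.le (by linarith)
    (by linarith) (by linarith [hl.dist_le x' hx', hA.add_le_t i])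
  rwa [LamFin_mul ha.1.le ha.2.1.le] at h5

include hsm hS in
-- For maximal `a` this is `mem_of_mem_fatBall`; otherwise pull back by the map of a maximal pair
-- above `a` and use the statement at the smaller stage.
theorem net_inter {a : ℕ × M} (ha : a ∈ pairs net i j) :
    net i j ∩ map a.1 j a.2 '' closedBall p (r a.1) = map a.1 j a.2 '' net i a.1 := by
  refine Subset.antisymm ?_ (subset_inter ?_ (image_mono (net_subset_closedBall hA IH ha)))
  · rintro _ ⟨hx, y, hy, rfl⟩
    obtain ⟨b, hb, rfl | hab⟩ := exists_maxPairs hA IH ha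
    · exact mem_of_mem_fatBall hA hsm hS IH hx hb (map_mem_fatBall hA IH ha hy)
    · obtain ⟨z₀, hz₀, hz₀b, he₀, hp₀, hm, hE⟩ := decompose hA IH ha hb.1 hab
      rw [hE hy, Function.comp_apply] at hx ⊢
      obtain ⟨x', hx', he⟩ := mem_of_mem_fatBall hA hsm hS IH hx hb
        (map_mem_fatBall hA IH hb.1 (hm hy))
      have h1 := injOn IH hb.1 (net_subset_closedBall hA IH hb.1 hx') (hm hy) he
      obtain ⟨y', hy', he'⟩ := ((left_right IH hb.1).1.inter (a.1, z₀) hp₀).subset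
        ⟨hx', y, hy, h1.symm⟩
      refine ⟨y', hy', ?_⟩
      rw [hE (net_subset_closedBall hA IH ha hy'), Function.comp_apply]
      dsimp only at he'
      rw [he', he]
  · rw [hS.net_eq]
    exact fun x hx => Or.inr (mem_iUnion₂.2 ⟨a, ha, hx⟩)

include hsm hS in
theorem map_comp {a : ℕ × M} (ha : a ∈ pairs net i j) {x x' : M} (hx : x ∈ net i j)
    (hx' : x' ∈ closedBall p (r a.1)) (he : map a.1 j a.2 x' = x) :
    MapsTo (map i a.1 x') (closedBall p (r i)) (closedBall p (r a.1)) ∧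
      EqOn (map i j x) (map a.1 j a.2 ∘ map i a.1 x') (closedBall p (r i)) := by
  subst he
  have hx'n : x' ∈ net i a.1 := by
    obtain ⟨y, hy, he⟩ := (net_inter hA hsm hS IH ha).subset ⟨hx, x', hx', rfl⟩
    rwa [← injOn IH ha (net_subset_closedBall hA IH ha hy) hx' he]
  have hmaps := (comp_isPPQI hA IH ha hx'n).2
  refine ⟨hmaps, ?_⟩
  obtain ⟨b, hb, rfl | hab⟩ := exists_maxPairs hA IH ha
  · rw [map_eq_comp hA hsm hS IH hb hx'n]
    exact fun _ _ => rfl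
  · obtain ⟨z₀, hz₀, hz₀b, he₀, hp₀, hm, hE⟩ := decompose hA IH ha hb.1 hab
    have hg := (left_right IH hb.1).1
    have h1 : map a.1 b.1 z₀ x' ∈ net i b.1 :=
      ((hg.inter (a.1, z₀) hp₀).superset (mem_image_of_mem _ hx'n)).1
    intro y hy
    rw [hE hx', Function.comp_apply, map_eq_comp hA hsm hS IH hb h1, Function.comp_apply,
      (hg.comp (a.1, z₀) hp₀ _ h1 x' hx' rfl).2 hy, Function.comp_apply, Function.comp_apply,
      hE (hmaps hy), Function.comp_apply]

include hsm hS in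
theorem isPPQI (hij : i < j) {x : M} (hx : x ∈ net i j) :
    IsPPQI n i (r i) (LamFin lam i j) p x (map i j x) := by
  rcases (mem_net_iff hA hS IH).1 hx with h | ⟨b, hb, x', hx', rfl⟩
  · rcases hS.map_eq x with ⟨a, ha, x', hx', he, hH⟩ | ⟨-, h1, h2⟩
    · rw [hH, ← he]
      exact (comp_isPPQI hA IH ha.1 hx').1
    · by_cases hp : x = p
      · rw [h1 hp, hp]
        exact isPPQI_id i _ (one_le_LamFin hA.one_le_lam i j) p
      · refine (h2 hp (hS.hat_max.1.1 h).1.1).mono (by linarith [hA.one_le_lam i]) ?_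
        rw [LamFin_succ_left hij]
        exact le_mul_of_one_le_right (by linarith [hA.one_le_lam i])
          (one_le_LamFin hA.one_le_lam _ _)
  · rw [map_eq_comp hA hsm hS IH hb hx']
    exact (comp_isPPQI hA IH hb.1 hx').1

include hS in
theorem dist_le {x : M} (hx : x ∈ net i j) : dist p x ≤ r j - t i := by
  rcases (mem_net_iff hA hS IH).1 hx with h | ⟨b, hb, x', hx', rfl⟩
  · rw [dist_comm]
    exact (hS.hat_max.1.1 h).1.2
  · obtain ⟨hl, hr⟩ := left_right IH hb.1
    have h1 := dist_map_le hA IH hb.1 (net_subset_closedBall hA IH hb.1 hx')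
    have h2 := hr.dist_le b.2 hb.1.2.2
    have h3 := hl.dist_le x' hx'
    have h4 := hA.add_le_t b.1
    have h5 := (hA.LamFin_le b.1 j).trans (hA.lam_sq_le b.1)
    have h6 := dist_triangle p b.2 (map b.1 j b.2 x')
    have h7 : LamFin lam b.1 j * dist p x' ≤ lam 0 ^ 2 * (r b.1 - t i) := by
      gcongr
    have h8 : t i ≤ lam 0 ^ 2 * t i :=
      le_mul_of_one_le_left (hA.t_pos i).le (one_le_pow₀ (hA.one_le_lam 0))
    linarith

theorem le_dist_of_notMem_fatBall {b : ℕ × M} (hb : b ∈ pairs net i j) {x x' : M}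
    (hx : x ∉ fatBall r s lam i j b) (hx' : x' ∈ net i b.1) :
    s i ≤ dist x (map b.1 j b.2 x') := by
  have hxb := net_subset_closedBall hA IH hb hx'
  have h1 := dist_map_le hA IH hb hxb
  have h0 := one_le_LamFin hA.one_le_lam b.1 j
  have h2 := hA.one_le_lam b.1
  have h3 := hA.s_pos i
  have h4 := hA.r_pos b.1
  rw [fatBall, mem_closedBall, not_le] at hx
  rw [mem_closedBall, dist_comm] at hxb
  have h5 := dist_triangle x (map b.1 j b.2 x') b.2
  rw [dist_comm (map b.1 j b.2 x') b.2] at h5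
  have h6 : LamFin lam b.1 j * (r b.1 + s i) ≤ lam b.1 * LamFin lam b.1 j * (r b.1 + s i) := by
    gcongr
    exact le_mul_of_one_le_left (by linarith) h2
  have h7 : LamFin lam b.1 j * dist p x' ≤ LamFin lam b.1 j * r b.1 := by gcongr
  nlinarith

variable [CompleteSpace M]

include hsm hst hS in
-- Only two points in the same translate lose separation, by the factor Λ_{l,j} of its map, which
-- completes Λ_{i+1,l} to Λ_{i+1,j}. In the remaining cases the distance is at least s_i.
theorem net_sep : IsSep (s i / LamFin lam (i + 1) j) (net i j) := by
  have hdiv : ∀ k, s i / LamFin lam (i + 1) k ≤ s i := fun k =>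
    div_le_self (hA.s_pos i).le (one_le_LamFin hA.one_le_lam _ _)
  have key : ∀ x ∈ net i j, ∀ b ∈ maxPairs net map i j, ∀ x' ∈ net i b.1,
      x ∉ map b.1 j b.2 '' net i b.1 →
      s i / LamFin lam (i + 1) j ≤ dist x (map b.1 j b.2 x') := fun x hx b hb x' hx' hxb =>
    (hdiv j).trans (le_dist_of_notMem_fatBall hA IH hb.1
      (fun h => hxb (mem_of_mem_fatBall hA hsm hS IH hx hb h)) hx')
  intro x hx y hy hne
  rcases (mem_net_iff hA hS IH).1 hy with hyh | ⟨b, hb, y', hy', rfl⟩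
  · rcases (mem_net_iff hA hS IH).1 hx with hxh | ⟨a, ha, x', hx', rfl⟩
    · exact (hdiv j).trans (hS.hat_max.1.2 x hxh y hyh hne)
    · rw [dist_comm]
      refine key y hy a ha x' hx' fun h => ?_
      refine (hS.hat_max.1.1 hyh).2 (mem_iUnion₂.2 ⟨a, ha, ?_⟩)
      obtain ⟨y', hy', rfl⟩ := h
      exact map_mem_fatBall hA IH ha.1 (net_subset_closedBall hA IH ha.1 hy')
  · by_cases hxb : x ∈ map b.1 j b.2 '' net i b.1
    · obtain ⟨x', hx', rfl⟩ := hxb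
      obtain ⟨hl, hr⟩ := left_right IH hb.1
      have h0 := one_le_LamFin hA.one_le_lam b.1 j
      have h0' := one_le_LamFin hA.one_le_lam (i + 1) b.1
      have h1 := hl.sep x' hx' y' hy' (by rintro rfl; exact hne rfl)
      have hyb := net_subset_closedBall hA IH hb.1 hy'
      rw [mem_closedBall, dist_comm] at hyb
      have h2 := (hr.isPPQI b.2 hb.1.2.2).min_le_mul_dist (by linarith) (a := x') (b := y')
        (ρ := t i) (by linarith [hl.dist_le x' hx']) hyb
      -- The condition s_i ≤ t_i ensures that the margin t_i around `x'` does not limit the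
      -- estimate.
      have h3 := (le_min ((hdiv b.1).trans (hst i)) h1).trans h2
      rw [← LamFin_mul (j := b.1) hb.1.1 hb.1.2.1.le, ← div_div, div_le_iff₀ (by linarith), mul_comm]
      exact h3
    · exact key x hx b hb y' hy' hxb

include hsm hS in
-- Inside the translate of a maximal pair (l,z) above `a`, the bound with Λ_l loses the factor
-- Λ_{l,j} and becomes the bound with Λ_j, since Λ_l = Λ_{l,j} Λ_j.
theorem far_or {x : M} (hx : x ∈ net i j) {a : ℕ × M} (ha : a ∈ pairs net i j) :
    lam a.1 * LamInf lam j * (r a.1 + s i) ≤ dist x a.2 ∨ x ∈ map a.1 j a.2 '' net i a.1 := by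
  have hfat : ∀ b ∈ maxPairs net map i j, x ∈ map b.1 j b.2 '' net i b.1 ∨
      lam b.1 * LamFin lam b.1 j * (r b.1 + s i) < dist x b.2 := fun b hb => by
    by_cases h : x ∈ fatBall r s lam i j b
    · exact Or.inl (mem_of_mem_fatBall hA hsm hS IH hx hb h)
    · right
      simpa [fatBall] using h
  obtain ⟨b, hb, rfl | hab⟩ := exists_maxPairs hA IH ha
  · refine (hfat a hb).symm.imp_left fun h => le_trans ?_ h.le
    have h1 := hA.LamInf_le_LamFin ha.2.1
    have h2 := hA.one_le_lam a.1
    have h3 := hA.s_pos i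
    have h4 := hA.r_pos a.1
    gcongr
  obtain ⟨z₀, hz₀, hz₀b, he₀, hp₀, hm, hE⟩ := decompose hA IH ha hb.1 hab
  obtain ⟨hl, hr⟩ := left_right IH hb.1
  have hz₀d := (IH a.1 b.1 hab.1 (by
    have := ha.1; have := hb.1.2.1; have := hab.1; omega)).dist_le z₀ hz₀
  have h0 := one_le_LamFin hA.one_le_lam b.1 j
  rcases hfat b hb with ⟨x', hx', rfl⟩ | hlt
  · have hxb := net_subset_closedBall hA IH hb.1 hx'
    rcases hl.far_or x' hx' (a.1, z₀) hp₀ with h | ⟨y, hy, he⟩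
    · left
      rw [mem_closedBall, dist_comm] at hxb
      have h2 := (hr.isPPQI b.2 hb.1.2.2).min_le_mul_dist (by linarith) (a := z₀) (b := x')
        (ρ := t a.1) (by linarith) hxb
      have h3 := hA.lam_mul_LamInf_le_t ha.1 b.1
      rw [dist_comm x'] at h
      have h4 := (le_min h3 h).trans h2
      rw [he₀, ← LamFin_mul_LamInf hA.one_le_lam (fun i => (hA.lam_sq i).le) hb.1.2.1.le,
        dist_comm] at h4
      refine le_of_mul_le_mul_left (le_trans (le_of_eq ?_) h4) (by linarith : 0 < LamFin lam b.1 j)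
      ring
    · right
      refine ⟨y, hy, ?_⟩
      rw [hE (net_subset_closedBall hA IH ha hy), Function.comp_apply]
      exact congrArg _ he
  -- Outside the fat ball of `b`, the margin t separating the centre of `a` from the edge of the
  -- ball of `b` suffices.
  · left
    refine (hA.lam_mul_LamInf_le_t ha.1 j).trans ?_
    have h1 := dist_map_le hA IH hb.1 hz₀b
    rw [he₀] at h1
    have h2 := dist_triangle x a.2 b.2
    rw [dist_comm a.2 b.2] at h2
    have h3 := hA.s_pos i
    have h4 := hA.r_pos b.1
    have h5 : LamFin lam b.1 j * dist p z₀ ≤ LamFin lam b.1 j * (r b.1 - t a.1) := by gcongr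
    have h6 : LamFin lam b.1 j * (r b.1 + s i) ≤ lam b.1 * LamFin lam b.1 j * (r b.1 + s i) := by
      gcongr
      exact le_mul_of_one_le_left (by linarith) (hA.one_le_lam b.1)
    have h7 : t a.1 ≤ LamFin lam b.1 j * t a.1 := le_mul_of_one_le_left (hA.t_pos _).le h0
    nlinarith

include hsm hS in
omit [CompleteSpace M] in
-- For j = i + 1 there are no pairs, hence no fat balls, and `p` was put into the maximal set. For
-- larger j it is inherited through the pair (i+1, p), whose map is the identity.
theorem base (hij : i < j) : p ∈ net i j ∧ EqOn (map i j p) id (closedBall p (r i)) := by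
  have hpb : ∀ k, p ∈ closedBall p (r k) := fun k => mem_closedBall_self (hA.r_pos k).le
  rcases (Nat.succ_le_of_lt hij).eq_or_lt with rfl | hlt
  · have hempty : maxPairs net map i (i + 1) = ∅ := by
      refine eq_empty_of_forall_notMem fun a ha => ?_
      have h1 := ha.1.1
      have h2 := ha.1.2.1
      omega
    refine ⟨?_, ?_⟩
    · rw [hS.net_eq]
      refine Or.inl (hS.base_mem_hat ⟨⟨⟨id, isPPQI_id i _ (hA.one_le_lam i) p⟩, ?_⟩, ?_⟩)
      · exact mem_closedBall_self (sub_nonneg.2 (hA.t_le_r i))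
      · simp [hempty]
    · rcases hS.map_eq p with ⟨a, ha, -⟩ | ⟨-, h, -⟩
      · simp [hempty] at ha
      · rw [h rfl]
        exact fun _ _ => rfl
  · have g1 := IH (i + 1) j hlt (by omega)
    have g2 := IH i (i + 1) i.lt_succ_self (by omega)
    have ha : (i + 1, p) ∈ pairs net i j := ⟨i.lt_succ_self, hlt, g1.base_mem⟩
    have he : map (i + 1) j p p = p := g1.map_base (hpb _)
    have hp : p ∈ net i j :=
      ((net_inter hA hsm hS IH ha).superset ⟨p, g2.base_mem, he⟩).1
    refine ⟨hp, ?_⟩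
    obtain ⟨h1, h2⟩ := map_comp hA hsm hS IH ha hp (hpb _) he
    intro y hy
    rw [h2 hy, Function.comp_apply]
    exact (g1.map_base (h1 hy)).trans (g2.map_base hy)

include hsm hS in
omit [CompleteSpace M] in
theorem net_mono_right (hij : i < j) {l : ℕ} (hil : i < l) (hlj : l < j) :
    net i l ⊆ net i j ∧ ∀ z ∈ net i l, EqOn (map i j z) (map i l z) (closedBall p (r i)) := by
  have g1 := IH l j hlj (by omega)
  have g2 := IH i l hil (by omega)
  have ha : (l, p) ∈ pairs net i j := ⟨hil, hlj, g1.base_mem⟩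
  have h0 : ∀ z ∈ net i l, map l j p z = z := fun z hz =>
    g1.map_base (g2.mem_closedBall (hA.t_pos i) hz)
  have h1 : net i l ⊆ net i j := fun z hz =>
    ((net_inter hA hsm hS IH ha).superset ⟨z, hz, h0 z hz⟩).1
  refine ⟨h1, fun z hz y hy => ?_⟩
  obtain ⟨h2, h3⟩ := map_comp hA hsm hS IH ha (h1 hz) (g2.mem_closedBall (hA.t_pos i) hz) (h0 z hz)
  rw [h3 hy, Function.comp_apply]
  exact g1.map_base (h2 hy)

include hsm hS in
omit [CompleteSpace M] in
-- A point z of M_k^j is h_{k,z}(p), and p is in M_i^k.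
theorem net_mono_left {k : ℕ} (hik : i < k) (hkj : k < j) :
    net k j ⊆ net i j ∧ ∀ z ∈ net k j, EqOn (map i j z) (map k j z) (closedBall p (r i)) := by
  have g1 := IH k j hkj (by omega)
  have g2 := IH i k hik (by omega)
  have hpk : p ∈ closedBall p (r k) := mem_closedBall_self (hA.r_pos k).le
  have key : ∀ z ∈ net k j, (k, z) ∈ pairs net i j ∧ map k j z p = z ∧ z ∈ net i j := fun z hz => by
    have ha : (k, z) ∈ pairs net i j := ⟨hik, hkj, hz⟩
    have he := (g1.isPPQI z hz).1
    exact ⟨ha, he, ((net_inter hA hsm hS IH ha).superset ⟨p, g2.base_mem, he⟩).1⟩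
  refine ⟨fun z hz => (key z hz).2.2, fun z hz y hy => ?_⟩
  obtain ⟨ha, he, hzn⟩ := key z hz
  rw [(map_comp hA hsm hS IH ha hzn hpk he).2 hy, Function.comp_apply, g2.map_base hy, id]

include hsm hS in
omit [CompleteSpace M] in
theorem net_mono (hn : ∀ i, net i i = {p}) (hm : ∀ i x, map i i x = id) (hij : i < j) {k l : ℕ}
    (hkl : k ≤ l) (h : l < j ∧ i ≤ k ∨ l = j ∧ i < k) :
    net k l ⊆ net i j ∧ ∀ z ∈ net k l, EqOn (map i j z) (map k l z) (closedBall p (r i)) := by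
  have hbase := base hA hsm hS IH hij
  have hself : ∀ k, net k k ⊆ net i j ∧
      ∀ z ∈ net k k, EqOn (map i j z) (map k k z) (closedBall p (r i)) := fun k => by
    rw [hn]
    refine ⟨singleton_subset_iff.2 hbase.1, ?_⟩
    rintro z rfl
    rw [hm]
    exact hbase.2
  rcases hkl.eq_or_lt with rfl | hkl'
  · exact hself k
  rcases h with ⟨hlj, hik⟩ | ⟨rfl, hik⟩
  · rcases hik.eq_or_lt with rfl | hik
    · exact net_mono_right hA hsm hS IH hij hkl' hlj
    · obtain ⟨h1, h2⟩ := net_mono_right hA hsm hS IH hij (hik.trans hkl') hlj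
      obtain ⟨h3, h4⟩ := (IH i l (hik.trans hkl') (by omega)).mono k l hkl (Or.inr ⟨rfl, hik⟩)
      exact ⟨h3.trans h1, fun z hz => (h2 z (h3 hz)).trans (h4 z hz)⟩
  · exact net_mono_left hA hsm hS IH hik hkl'

include hsm hst hS in
theorem isNestedAt (hn : ∀ i, net i i = {p}) (hm : ∀ i x, map i i x = id) (hij : i < j) :
    IsNestedAt n p r s t lam net map i j where
  isPPQI _ hx := isPPQI hA hsm hS IH hij hx
  disjoint := fatBall_disjoint hA hsm IH
  sep := net_sep hA hsm hst hS IH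
  dist_le _ hx := dist_le hA hS IH hx
  comp _ ha _ hx _ hx' he := map_comp hA hsm hS IH ha hx hx' he
  inter _ ha := net_inter hA hsm hS IH ha
  far_or _ hx _ ha := far_or hA hsm hS IH hx ha
  mono _ _ hkl h := net_mono hA hsm hS IH hn hm hij hkl h
  base_mem := (base hA hsm hS IH hij).1
  map_base := (base hA hsm hS IH hij).2

end IsNestedStep

theorem IsAdmissible.nonempty_nestedSystem [IsContMDiffRiemannianBundle (𝓡 n) ∞
    (EuclideanSpace ℝ (Fin n)) (fun x : M => TangentSpace (𝓡 n) x)] [IsRiemannianManifold (𝓡 n) M]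
    [CompleteSpace M] (hA : IsAdmissible n p r s t lam)
    (hsm : ∀ l, 0 < l → r l * (lam l ^ 3 - 1) ≤ 1) (hst : ∀ i, s i ≤ t i) :
    Nonempty (NestedSystem n p r s t lam) := by
  obtain ⟨net, hat, map, hn, hm, hS⟩ := exists_nestedSteps n p r s t lam
  have key : ∀ d i j, i < j → j - i = d → IsNestedAt n p r s t lam net map i j := by
    intro d
    induction d using Nat.strong_induction_on with
    | _ d ih =>
      rintro i j hij rfl
      exact IsNestedStep.isNestedAt hA hsm hst (hS i j hij)
        (fun k l hkl h => ih (l - k) h k l hkl rfl) hn hm hij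
  have hG : ∀ i j, i < j → IsNestedAt n p r s t lam net map i j := fun i j hij => key _ i j hij rfl
  exact ⟨{
    net := net
    hatNet := hat
    map := map
    net_self := hn
    map_self := fun i => by rw [hm]; exact fun _ _ => rfl
    hatNet_subset := fun i j hij => by rw [(hS i j hij).net_eq]; exact subset_union_left
    isPPQI := fun i j hij => (hG i j hij).isPPQI
    fatBall_disjoint := fun i j hij => (hG i j hij).disjoint
    hatNet_maximal := fun i j hij => (hS i j hij).hat_max
    net_sep := fun i j hij => (hG i j hij).sep
    net_subset := fun i j hij x hx =>
      ⟨⟨_, (hG i j hij).isPPQI x hx⟩, by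
        rw [mem_closedBall, dist_comm]; exact (hG i j hij).dist_le x hx⟩
    map_comp := fun i j hij => (hG i j hij).comp
    net_inter := fun i j hij => (hG i j hij).inter
    net_far_or := fun i j hij x hx a ha => (hG i j hij).far_or x hx a ha
    net_mono := fun i j hij => (hG i j hij).mono
    base_mem := fun i j hij => (hG i j hij).base_mem
    map_base := fun i j hij => (hG i j hij).map_base }⟩

end NestedInduction

/-! ### Choice of admissible sequences. -/

section Sequences

/-- All conditions are strict and hold in the limit λ' → 1, with the next radius r' already fixed.
The bound 1 + 1/(i+1) forces convergence to 1. -/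
theorem exists_next_lam (i : ℕ) {r lam c : ℝ} (r' : ℝ) (hr : 0 < r) (hlam : 1 < lam) (hc : 0 < c) :
    ∃ lam', 1 < lam' ∧ lam' < 1 + 1 / ((i : ℝ) + 1) ∧ lam' ^ 2 < lam ∧ r' * (lam' ^ 3 - 1) < 1 ∧
      r' * (lam' ^ 5 - 1) * lam ^ 2 / (r * (lam ^ 5 - 1) * lam' ^ 2) < c ∧
      r' * (lam' ^ 6 - 1) * lam ^ 2 / (r * (lam ^ 6 - 1) * lam' ^ 2) < c := by
  have h0 : ∀ {f : ℝ → ℝ} {a : ℝ}, ContinuousAt f 1 → f 1 < a → ∀ᶠ x in 𝓝[>] 1, f x < a :=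
    fun hf h => (hf.eventually_lt_const h).filter_mono nhdsWithin_le_nhds
  have hq : ∀ q : ℕ, q ≠ 0 → ∀ᶠ x in 𝓝[>] (1 : ℝ),
      r' * (x ^ q - 1) * lam ^ 2 / (r * (lam ^ q - 1) * x ^ 2) < c := fun q hq => by
    have h1 : r * (lam ^ q - 1) ≠ 0 := by
      have := one_lt_pow₀ hlam hq
      have : 0 < lam ^ q - 1 := by linarith
      positivity
    refine h0 (ContinuousAt.div (by fun_prop) (by fun_prop) (by simpa using h1)) ?_
    simpa using hc
  have h1 : ∀ᶠ x in 𝓝[>] (1 : ℝ), x < 1 + 1 / ((i : ℝ) + 1) := h0 continuousAt_id (by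
    have : (0 : ℝ) < 1 / ((i : ℝ) + 1) := by positivity
    simpa using this)
  have h2 : ∀ᶠ x in 𝓝[>] (1 : ℝ), x ^ 2 < lam := h0 (f := fun x => x ^ 2) (by fun_prop)
    (by simpa using hlam)
  have h3 : ∀ᶠ x in 𝓝[>] (1 : ℝ), r' * (x ^ 3 - 1) < 1 :=
    h0 (f := fun x => r' * (x ^ 3 - 1)) (by fun_prop) (by simp)
  obtain ⟨x, hx⟩ := (eventually_mem_nhdsWithin.and (h1.and (h2.and (h3.and
    ((hq 5 (by norm_num)).and (hq 6 (by norm_num))))))).exists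
  exact ⟨x, hx⟩

/-- The values of the sequences `r, s, t, ω, lam` at one index. -/
structure SeqState where
  r : ℝ
  s : ℝ
  t : ℝ
  w : ℝ
  lam : ℝ

namespace SeqState

/-- The next radius. -/
def nextR (σ : SeqState) : ℝ := 32 * (σ.r + σ.s + σ.t + 2 * σ.w + 1) + 1

/-- The values at the next index. -/
def next (W : ℝ → ℝ → ℝ) (σ : SeqState) (lam : ℝ) : SeqState where
  r := σ.nextR
  w := W σ.nextR lam
  lam := lam
  -- With λ_0 = 2 the constants are 32 = λ_0⁵/(λ_0 - 1), 64 = 2λ_0⁵, 8 = λ_0³, and 4 ≥ Λ_i. The last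
  -- summand of `t` is the new `s`, which gives s_i ≤ t_i.
  s := 64 * (σ.nextR + σ.s + W σ.nextR lam) + 1
  t := 8 * (5 * σ.t + σ.nextR + σ.s + 2 * σ.w + 1) +
    4 * ((lam ^ 4 + lam ^ 2 - 1) / lam ^ 2) * σ.nextR + σ.t + 4 * (σ.s + 2 * σ.w + W σ.nextR lam) +
    (64 * (σ.nextR + σ.s + W σ.nextR lam) + 1)

end SeqState

theorem exists_seqState (W : ℕ → ℝ → ℝ → ℝ) : ∃ σ : ℕ → SeqState,
    (σ 0 = SeqState.next (W 0) ⟨0, 0, 0, 0, 0⟩ 2) ∧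
    ∀ i, σ (i + 1) = SeqState.next (W (i + 1)) (σ i) (σ (i + 1)).lam ∧
      (0 < (σ i).r → 1 < (σ i).lam → 1 < (σ (i + 1)).lam ∧
        (σ (i + 1)).lam < 1 + 1 / ((i : ℝ) + 1) ∧ (σ (i + 1)).lam ^ 2 < (σ i).lam ∧
        (σ (i + 1)).r * ((σ (i + 1)).lam ^ 3 - 1) < 1 ∧
        (σ (i + 1)).r * ((σ (i + 1)).lam ^ 5 - 1) * (σ i).lam ^ 2 /
          ((σ i).r * ((σ i).lam ^ 5 - 1) * (σ (i + 1)).lam ^ 2) <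
            (2 : ℝ) ^ ((2 : ℝ) ^ (-((i : ℝ) + 1))) ∧
        (σ (i + 1)).r * ((σ (i + 1)).lam ^ 6 - 1) * (σ i).lam ^ 2 /
          ((σ i).r * ((σ i).lam ^ 6 - 1) * (σ (i + 1)).lam ^ 2) <
            (2 : ℝ) ^ ((2 : ℝ) ^ (-((i : ℝ) + 1)))) := by
  classical
  have h : ∀ (i : ℕ) (τ : SeqState), ∃ lam', 0 < τ.r → 1 < τ.lam → 1 < lam' ∧
      lam' < 1 + 1 / ((i : ℝ) + 1) ∧ lam' ^ 2 < τ.lam ∧ τ.nextR * (lam' ^ 3 - 1) < 1 ∧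
      τ.nextR * (lam' ^ 5 - 1) * τ.lam ^ 2 / (τ.r * (τ.lam ^ 5 - 1) * lam' ^ 2) <
        (2 : ℝ) ^ ((2 : ℝ) ^ (-((i : ℝ) + 1))) ∧
      τ.nextR * (lam' ^ 6 - 1) * τ.lam ^ 2 / (τ.r * (τ.lam ^ 6 - 1) * lam' ^ 2) <
        (2 : ℝ) ^ ((2 : ℝ) ^ (-((i : ℝ) + 1))) := fun i τ => by
    by_cases hτ : 0 < τ.r ∧ 1 < τ.lam
    · obtain ⟨lam', hl⟩ := exists_next_lam i τ.nextR hτ.1 hτ.2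
        (c := (2 : ℝ) ^ ((2 : ℝ) ^ (-((i : ℝ) + 1)))) (by positivity)
      exact ⟨lam', fun _ _ => hl⟩
    · exact ⟨0, fun h1 h2 => absurd ⟨h1, h2⟩ hτ⟩
  choose f hf using h
  exact ⟨fun i => Nat.rec (SeqState.next (W 0) ⟨0, 0, 0, 0, 0⟩ 2)
    (fun i τ => SeqState.next (W (i + 1)) τ (f i τ)) i, rfl, fun i => ⟨rfl, hf i _⟩⟩

theorem tendsto_atTop_of_add_one_le {f : ℕ → ℝ} (h0 : 0 ≤ f 0) (h : ∀ i, f i + 1 ≤ f (i + 1)) :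
    Tendsto f atTop atTop := by
  refine tendsto_atTop_mono (fun i => ?_) tendsto_natCast_atTop_atTop
  induction i with
  | zero => simpa using h0
  | succ i ih => push_cast; linarith [h i]

variable (n : ℕ) {M : Type*} [MetricSpace M] [ChartedSpace (EuclideanSpace ℝ (Fin n)) M]
  [IsManifold (𝓡 n) ∞ M] [RiemannianBundle (fun x : M => TangentSpace (𝓡 n) x)]

theorem exists_isAdmissible (p : M) : ∃ r s t lam : ℕ → ℝ, IsAdmissible n p r s t lam ∧
    (∀ l, 0 < l → r l * (lam l ^ 3 - 1) ≤ 1) ∧ ∀ i, s i ≤ t i := by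
  let W : ℕ → ℝ → ℝ → ℝ := fun i r lam => sInf {C : ℝ | 0 < C ∧ IsRelDense C (Omega n p i r lam)}
  have hW : ∀ i r lam, 0 ≤ W i r lam := fun i r lam => Real.sInf_nonneg fun _ h => h.1.le
  obtain ⟨σ, h0, hσ⟩ := exists_seqState W
  -- The sequence shifted by one, with the zero state at index -1 as in `prev`.
  let σ' : ℕ → SeqState := fun i => Nat.casesOn i ⟨0, 0, 0, 0, 0⟩ σ
  have hstep : ∀ i, σ i = SeqState.next (W i) (σ' i) (σ i).lam := fun i => by
    cases i with
    | zero => simp only [h0]; rfl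
    | succ i => exact (hσ i).1
  have hr : ∀ i, (σ i).r = (σ' i).nextR := fun i => congrArg SeqState.r (hstep i)
  have hw : ∀ i, (σ i).w = W i (σ i).r (σ i).lam := fun i => by
    rw [hr]
    conv_lhs => rw [hstep i]
    rfl
  have hs : ∀ i, (σ i).s = 64 * ((σ i).r + (σ' i).s + (σ i).w) + 1 := fun i => by
    rw [hw, hr]
    conv_lhs => rw [hstep i]
    rfl
  have ht : ∀ i, (σ i).t = 8 * (5 * (σ' i).t + (σ i).r + (σ' i).s + 2 * (σ' i).w + 1) +
      4 * (((σ i).lam ^ 4 + (σ i).lam ^ 2 - 1) / (σ i).lam ^ 2) * (σ i).r + (σ' i).t +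
      4 * ((σ' i).s + 2 * (σ' i).w + (σ i).w) + (σ i).s := fun i => by
    rw [hs, hw, hr]
    conv_lhs => rw [hstep i]
    rfl
  simp only [SeqState.nextR] at hr
  have hw0 : ∀ i, 0 ≤ (σ i).w := fun i => hw i ▸ hW _ _ _
  have hquot : ∀ i, 1 < (σ i).lam →
      0 ≤ ((σ i).lam ^ 4 + (σ i).lam ^ 2 - 1) / (σ i).lam ^ 2 := fun i h => by
    have : 1 ≤ (σ i).lam ^ 2 := one_le_pow₀ h.le
    have h4 : 0 ≤ (σ i).lam ^ 4 + (σ i).lam ^ 2 - 1 := by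
      have : 0 ≤ (σ i).lam ^ 4 := by positivity
      linarith
    positivity
  have hpos : ∀ i, 0 ≤ (σ' i).r ∧ 0 ≤ (σ' i).s ∧ 0 ≤ (σ' i).t ∧ 0 ≤ (σ' i).w →
      1 < (σ i).lam → 0 < (σ i).r ∧ 0 < (σ i).s ∧ 0 < (σ i).t := by
    rintro i ⟨h1, h2, h3, h4⟩ hl
    have e1 : 0 < (σ i).r := by rw [hr]; positivity
    have e2 : 0 < (σ i).s := by rw [hs]; have := hw0 i; positivity
    have e3 : 0 < (σ i).t := by rw [ht]; have := hw0 i; have := hquot i hl; positivity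
    exact ⟨e1, e2, e3⟩
  have hall : ∀ i, 1 < (σ i).lam ∧ 0 < (σ i).r ∧ 0 < (σ i).s ∧ 0 < (σ i).t := by
    intro i
    induction i with
    | zero =>
      have hl : 1 < (σ 0).lam := by rw [h0]; exact one_lt_two
      exact ⟨hl, hpos 0 ⟨le_rfl, le_rfl, le_rfl, le_rfl⟩ hl⟩
    | succ i ih =>
      have hl := ((hσ i).2 ih.2.1 ih.1).1
      exact ⟨hl, hpos (i + 1) ⟨ih.2.1.le, ih.2.2.1.le, ih.2.2.2.le, hw0 i⟩ hl⟩
  have hlam : ∀ i, _ := fun i => (hσ i).2 (hall i).2.1 (hall i).1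
  have hσ'0 : ∀ i, 0 ≤ (σ' i).r ∧ 0 ≤ (σ' i).s ∧ 0 ≤ (σ' i).t ∧ 0 ≤ (σ' i).w := fun i => by
    cases i with
    | zero => exact ⟨le_rfl, le_rfl, le_rfl, le_rfl⟩
    | succ i => exact ⟨(hall i).2.1.le, (hall i).2.2.1.le, (hall i).2.2.2.le, hw0 i⟩
  have hl0 : (σ 0).lam = 2 := by rw [h0]; rfl
  have hr1 : ∀ i, (σ i).r + 1 ≤ (σ (i + 1)).r := fun i => by
    obtain ⟨-, h1, h2, h3⟩ := hall i
    rw [hr (i + 1)]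
    change _ ≤ 32 * ((σ i).r + (σ i).s + (σ i).t + 2 * (σ i).w + 1) + 1
    linarith [hw0 i]
  have hs1 : ∀ i, (σ i).s + 1 ≤ (σ (i + 1)).s := fun i => by
    obtain ⟨-, h1, h2, h3⟩ := hall i
    rw [hs (i + 1)]
    change _ ≤ 64 * ((σ (i + 1)).r + (σ i).s + (σ (i + 1)).w) + 1
    linarith [hw0 (i + 1), (hall (i + 1)).2.1]
  have hst : ∀ i, (σ i).s + 8 * (5 * (σ' i).t + (σ i).r + (σ' i).s + 2 * (σ' i).w + 1) ≤ (σ i).t :=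
    fun i => by
      obtain ⟨h1, h2, h3, h4⟩ := hσ'0 i
      have := hw0 i
      have := mul_nonneg (mul_nonneg (zero_le_four (α := ℝ)) (hquot i (hall i).1)) (hall i).2.1.le
      rw [ht i]
      linarith
  have ht1 : ∀ i, (σ i).t + 1 ≤ (σ (i + 1)).t := fun i => by
    obtain ⟨-, h1, h2, h3⟩ := hall i
    refine le_trans ?_ (hst (i + 1))
    change _ ≤ (σ (i + 1)).s +
      8 * (5 * (σ i).t + (σ (i + 1)).r + (σ i).s + 2 * (σ i).w + 1)
    linarith [hw0 i, (hall (i + 1)).2.1, (hall (i + 1)).2.2.1]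
  have hle1 : ∀ i, 1 ≤ (σ i).lam := fun i => (hall i).1.le
  have hanti : Antitone fun i => (σ i).lam := antitone_nat_of_succ_le fun i => by
    have h1 := (hlam i).2.2.1
    have h2 := hle1 (i + 1)
    nlinarith
  have hpr : ∀ i, prev (fun i => (σ i).r) i = (σ' i).r := fun i => by cases i <;> rfl
  have hps : ∀ i, prev (fun i => (σ i).s) i = (σ' i).s := fun i => by cases i <;> rfl
  have hpt : ∀ i, prev (fun i => (σ i).t) i = (σ' i).t := fun i => by cases i <;> rfl
  have hom : ∀ i, omegaSeq n p (fun i => (σ i).r) (fun i => (σ i).lam) i = (σ i).w := fun i =>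
    (hw i).symm
  have hpw : ∀ i, prev (omegaSeq n p (fun i => (σ i).r) (fun i => (σ i).lam)) i = (σ' i).w :=
    fun i => by
      cases i with
      | zero => rfl
      | succ i => exact hom i
  refine ⟨fun i => (σ i).r, fun i => (σ i).s, fun i => (σ i).t, fun i => (σ i).lam, ?_, ?_, ?_⟩
  · refine {
      r_pos := fun i => (hall i).2.1
      s_pos := fun i => (hall i).2.2.1
      t_pos := fun i => (hall i).2.2.2
      r_mono := monotone_nat_of_le_succ fun i => by linarith [hr1 i]
      s_mono := monotone_nat_of_le_succ fun i => by linarith [hs1 i]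
      t_mono := monotone_nat_of_le_succ fun i => by linarith [ht1 i]
      r_lim := tendsto_atTop_of_add_one_le (hall 0).2.1.le hr1
      s_lim := tendsto_atTop_of_add_one_le (hall 0).2.2.1.le hs1
      t_lim := tendsto_atTop_of_add_one_le (hall 0).2.2.2.le ht1
      lam_anti := hanti
      lam_lim := ?_
      r_gt := fun i => ?_
      s_gt := fun i => ?_
      t_gt := fun i => ?_
      t_gt' := fun i => ?_
      lam_sq := fun i => (hlam i).2.2.1
      lam_five := fun i => (hlam i).2.2.2.2.1
      lam_six := fun i => (hlam i).2.2.2.2.2 }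
    · refine (tendsto_add_atTop_iff_nat 1).1 ?_
      have h1 : Tendsto (fun i : ℕ => 1 + 1 / ((i : ℝ) + 1)) atTop (𝓝 1) := by
        simpa using tendsto_one_div_add_atTop_nhds_zero_nat.const_add (1 : ℝ)
      exact tendsto_of_tendsto_of_tendsto_of_le_of_le tendsto_const_nhds h1
        (fun i => (hlam i).1.le) fun i => (hlam i).2.1.le
    · rw [hpr, hps, hpt, hpw, hl0, hr i]
      norm_num
    · rw [hps, hom, hl0, hs i]
      norm_num
    · rw [hps, hpt, hpw, hl0]
      have := hst i
      have := (hall i).2.2.1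
      norm_num
      linarith
    · rw [hps, hpt, hpw, hom]
      obtain ⟨h1, h2, h3, h4⟩ := hσ'0 i
      have h5 := hw0 i
      have h6 := LamInf_le_sq hle1 (fun i => (hlam i).2.2.1.le) i
      have h7 : (σ i).lam ≤ 2 := hl0 ▸ hanti (Nat.zero_le i)
      have h8 : LamInf (fun i => (σ i).lam) i ≤ 4 := h6.trans (by nlinarith [hle1 i])
      have h9 : LamInf (fun i => (σ i).lam) i * ((σ' i).s + 2 * (σ' i).w + (σ i).w) ≤
          4 * ((σ' i).s + 2 * (σ' i).w + (σ i).w) := by gcongr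
      have h10 := (hall i).2.2.1
      have h11 := (hall i).2.1
      rw [ht i]
      linarith
  · intro l hl
    obtain ⟨k, rfl⟩ : ∃ k, l = k + 1 := ⟨l - 1, by omega⟩
    exact (hlam k).2.2.2.1.le
  · intro i
    obtain ⟨h1, h2, h3, h4⟩ := hσ'0 i
    have := (hall i).2.1
    have := hst i
    dsimp only
    linarith

end Sequences
end

theorem mainTheorem8 (n : ℕ) {M : Type*} [MetricSpace M]
    [ChartedSpace (EuclideanSpace ℝ (Fin n)) M] [IsManifold (𝓡 n) ∞ M]
    [RiemannianBundle (fun x : M => TangentSpace (𝓡 n) x)]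
    [IsContMDiffRiemannianBundle (𝓡 n) ∞ (EuclideanSpace ℝ (Fin n))
      (fun x : M => TangentSpace (𝓡 n) x)]
    [IsRiemannianManifold (𝓡 n) M] [CompleteSpace M] [ConnectedSpace M]
    (hrep : IsRepetitive n M) (p : M) :
    (∃ r s t lam : ℕ → ℝ, IsAdmissible n p r s t lam ∧
      Nonempty (NestedSystem n p r s t lam)) ∧
    ∀ r s t lam : ℕ → ℝ, IsAdmissible n p r s t lam →
      ∀ S : NestedSystem n p r s t lam, ∀ η : ℝ, 0 < η →
        ∃ X : Set M, p ∈ X ∧ (∃ K : ℝ, 0 < K ∧ IsSep K X) ∧ IsRelDense η X ∧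
          ∀ a ∈ S.limPairs 0,
            X ∩ S.limMap a.1 a.2 '' closedBall p (r a.1) =
              S.limMap a.1 a.2 '' (X ∩ closedBall p (r a.1)) := by
  obtain ⟨r, s, t, lam, hA, hsm, hst⟩ := exists_isAdmissible n p
  exact ⟨⟨r, s, t, lam, hA, hA.nonempty_nestedSystem hsm hst⟩,
    fun _ _ _ _ hA S _ hη => S.exists_separated_dense_invariant hA hη⟩
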